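/- Let $n,d\in\mathbb N$, and let $V_1\in C^\infty(\mathbb R^n;\mathbb R)$, $V_2\in C^\infty(\mathbb R^d;\mathbb R)$, $W\in C^\infty(\mathbb R^{n+d};\mathbb R)$ have bounded partial derivatives of every order $\ge 2$. Assume also that $\nabla_yW\in L^\infty$. Let $\varphi_0^x\in\mathcal S(\mathbb R^n;\mathbb C)$ and $\varphi_0^y\in\mathcal S(\mathbb R^d;\mathbb C)$. Put $H_x=-\frac12\Delta_x+V_1(x)$, $H_y=-\frac12\Delta_y+V_2(y)$, $H=H_x+H_y+W(x,y)$, and let $\psi\in C(\mathbb R;L^2(\mathbb R^{n+d}))$ be the solution of $$i\partial_t\psi=H\psi,\qquad \psi(0,x,y)=\varphi_0^x(x)\varphi_0^y(y).$$ All evolution equations are understood in the sense of tempered distributions in space: for every Schwartz function $\chi$, $t\mapsto\langle\chi,u(t)\rangle_{L^2}$ is differentiable with $i\frac{d}{dt}\langle\chi,u(t)\rangle=\langle H(t)\chi,u(t)\rangle$, where $H(t)$ is the Hamiltonian of the equation. $\Sigma^1(\mathbb R^N)$ is the space of $f\in L^2$ with $z_jf,\ \partial_jf\in L^2$ for all $j$.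 The norm $\|\nabla_x\nabla_yW\|_{L^\infty}$ is taken with respect to the operator norm (largest singular value) of the matrix $(\partial_{x_j}\partial_{y_k}W)_{j,k}$. The time integrals below have values in $[0,\infty]$, with the convention $0\cdot\infty=0$. **Brute-force approach.** Let $\varphi^x\in C(\mathbb R;L^2(\mathbb R^n))$, $\varphi^y\in C(\mathbb R;L^2(\mathbb R^d))$ solve $$i\partial_t\varphi^x=H_x\varphi^x+W(x,0)\varphi^x,\quad \varphi^x|_{t=0}=\varphi_0^x,\qquad i\partial_t\varphi^y=H_y\varphi^y+W(0,y)\varphi^y,\quad \varphi^y|_{t=0}=\varphi_0^y,$$ and let $\psi_{\rm app}(t,x,y)=e^{itW(0,0)}\varphi^x(t,x)\varphi^y(t,y)$. Then, for all $t\ge0$, both of the following bounds hold: $$\|\psi(t)-\psi_{\rm app}(t)\|_{L^2}\le 2\,\|\nabla_yW\|_{L^\infty}\|\varphi_0^x\|_{L^2}\int_0^t\|y\varphi^y(s)\|_{L^2}\,ds,$$ $$\|\psi(t)-\psi_{\rm app}(t)\|_{L^2}\le \|\nabla_x\nabla_yW\|_{L^\infty}\int_0^t\|x\varphi^x(s)\|_{L^2}\|y\varphi^y(s)\|_{L^2}\,ds.$$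 **Mean-field approach.** Let $(\phi^x,\phi^y)\in C(\mathbb R;\Sigma^1(\mathbb R^n)\times\Sigma^1(\mathbb R^d))$ solve the time-dependent Hartree system $$i\partial_t\phi^x=H_x\phi^x+\langle W\rangle_y(t,x)\,\phi^x,\quad \phi^x|_{t=0}=\varphi_0^x,\qquad i\partial_t\phi^y=H_y\phi^y+\langle W\rangle_x(t,y)\,\phi^y,\quad \phi^y|_{t=0}=\varphi_0^y,$$ with the averages (read as $0$ where a denominator vanishes) $$\langle W\rangle_y(t,x)=\frac{\int W(x,y)|\phi^y(t,y)|^2dy}{\int|\phi^y(t,y)|^2dy},\qquad \langle W\rangle_x(t,y)=\frac{\int W(x,y)|\phi^x(t,x)|^2dx}{\int|\phi^x(t,x)|^2dx},$$ $$\langle W\rangle(t)=\frac{\iint W(x,y)|\phi^x(t,x)\phi^y(t,y)|^2dx\,dy}{\iint|\phi^x(t,x)\phi^y(t,y)|^2dx\,dy},$$ and let $\phi_{\rm app}(t,x,y)=\phi^x(t,x)\phi^y(t,y)\,e^{i\int_0^t\langle W\rangle(s)ds}$. Then, for all $t\ge0$, both of the following bounds hold: $$\|\psi(t)-\phi_{\rm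 app}(t)\|_{L^2}\le 4\,\|\nabla_yW\|_{L^\infty}\|\varphi_0^x\|_{L^2}\int_0^t\|y\phi^y(s)\|_{L^2}\,ds,$$ $$\|\psi(t)-\phi_{\rm app}(t)\|_{L^2}\le 4\,\|\nabla_x\nabla_yW\|_{L^\infty}\int_0^t\|x\phi^x(s)\|_{L^2}\|y\phi^y(s)\|_{L^2}\,ds.$$ -/

import Mathlib

open MeasureTheory Laplacian Set
open scoped SchwartzMap ContDiff ENNReal

noncomputable section

/-- Euclidean space `ℝ^N`. -/
abbrev Euc (N : ℕ) : Type := EuclideanSpace ℝ (Fin N)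

/-- The complex Hilbert space `L²(Z)` with respect to Lebesgue measure.
It is used for `Z = ℝⁿ`, `Z = ℝᵈ` and `Z = ℝⁿ × ℝᵈ` (with the product measure). -/
abbrev LTwo (Z : Type*) [MeasureSpace Z] : Type _ := Lp ℂ 2 (volume : Measure Z)

/-- A real-valued potential that is smooth and at most quadratic: all derivatives of order
at least two are bounded. -/
structure AtMostQuadratic {Z : Type*} [NormedAddCommGroup Z] [NormedSpace ℝ Z]
    (V : Z → ℝ) : Prop where
  smooth : ContDiff ℝ ∞ V
  bounded : ∀ k : ℕ, 2 ≤ k → ∃ C : ℝ, ∀ z, ‖iteratedFDeriv ℝ k V z‖ ≤ C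

/-- The partial gradient `∇_y W(x,y) ∈ ℝᵈ`. -/
def gradY {n d : ℕ} (W : Euc n × Euc d → ℝ) (z : Euc n × Euc d) : Euc d :=
  gradient (fun y => W (z.1, y)) z.2

/-- The mixed second derivative `∇_x ∇_y W(x,y)`, a linear map `ℝⁿ → ℝᵈ` with matrix entries
`∂_{x_j} ∂_{y_k} W(x,y)`; its norm is the largest singular value. -/
def gradXGradY {n d : ℕ} (W : Euc n × Euc d → ℝ) (z : Euc n × Euc d) : Euc n →L[ℝ] Euc d :=
  fderiv ℝ (fun x => gradY W (x, z.2)) z.1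

/-- The Schrödinger operator `-½ Δ + V` on `ℝ^N`, acting on smooth functions. -/
def schrodingerOp {N : ℕ} (V : Euc N → ℝ) (f : Euc N → ℂ) (z : Euc N) : ℂ :=
  -(1 / 2 : ℂ) * (Δ f) z + (V z : ℂ) * f z

/-- The full Hamiltonian `H = H_x + H_y + W = -½ Δ_x + V₁(x) - ½ Δ_y + V₂(y) + W(x,y)`. -/
def fullHamiltonian {n d : ℕ} (V₁ : Euc n → ℝ) (V₂ : Euc d → ℝ) (W : Euc n × Euc d → ℝ)
    (f : Euc n × Euc d → ℂ) (z : Euc n × Euc d) : ℂ :=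
  schrodingerOp V₁ (fun x => f (x, z.2)) z.1 + schrodingerOp V₂ (fun y => f (z.1, y)) z.2
    + (W z : ℂ) * f z

/-- `u ∈ C(ℝ; L²)` is a solution of `i ∂_t u = H(t) u`, `u(0) = u₀`, where the equation holds in
the sense of tempered distributions, i.e. for every Schwartz test function `χ` one has
`i (d/dt) ⟨χ, u(t)⟩ = ⟨H(t) χ, u(t)⟩` for all `t` (each `H(t)` being formally self-adjoint). -/
structure IsSchrodingerSolution {Z : Type*} [NormedAddCommGroup Z] [NormedSpace ℝ Z]
    [MeasureSpace Z] (H : ℝ → (Z → ℂ) → Z → ℂ) (u₀ : Z → ℂ) (u : ℝ → LTwo Z) : Prop where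
  continuous : Continuous u
  initial : u 0 =ᵐ[volume] u₀
  equation : ∀ (χ : 𝓢(Z, ℂ)) (t : ℝ),
    HasDerivAt (fun s => ∫ z, inner ℂ (χ z) (u s z))
      (-Complex.I * ∫ z, inner ℂ (H t χ z) (u t z)) t

/-- `u ∈ C(ℝ; Σ¹(ℝ^N))`, where `Σ¹` is the space of all `f ∈ L²` such that all `z_j f` and all
weak derivatives `∂_j f` are in `L²`, with the corresponding norm. -/
structure IsContSigmaOne {N : ℕ} (u : ℝ → LTwo (Euc N)) : Prop where
  continuous : Continuous u
  moment : ∀ j : Fin N, ∃ m : ℝ → LTwo (Euc N), Continuous m ∧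
    ∀ t, m t =ᵐ[volume] fun z => (z j : ℂ) * u t z
  derivative : ∀ j : Fin N, ∃ g : ℝ → LTwo (Euc N), Continuous g ∧
    ∀ (t : ℝ) (χ : 𝓢(Euc N, ℂ)),
      ∫ z, g t z * χ z = -∫ z, u t z * fderiv ℝ χ z (EuclideanSpace.single j 1)

/-- The partial average `⟨W⟩_y(x) = ∫ W(x,y) |v(y)|² dy / ∫ |v(y)|² dy`. -/
def avgY {n d : ℕ} (W : Euc n × Euc d → ℝ) (v : Euc d → ℂ) (x : Euc n) : ℝ :=
  (∫ y, W (x, y) * ‖v y‖ ^ 2) / ∫ y, ‖v y‖ ^ 2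

/-- The partial average `⟨W⟩_x(y) = ∫ W(x,y) |u(x)|² dx / ∫ |u(x)|² dx`. -/
def avgX {n d : ℕ} (W : Euc n × Euc d → ℝ) (u : Euc n → ℂ) (y : Euc d) : ℝ :=
  (∫ x, W (x, y) * ‖u x‖ ^ 2) / ∫ x, ‖u x‖ ^ 2

/-- The full average `⟨W⟩ = ∫ W(x,y) |u(x) v(y)|² dx dy / ∫ |u(x) v(y)|² dx dy`. -/
def avgFull {n d : ℕ} (W : Euc n × Euc d → ℝ) (u : Euc n → ℂ) (v : Euc d → ℂ) : ℝ :=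
  (∫ z : Euc n × Euc d, W z * ‖u z.1 * v z.2‖ ^ 2) /
    ∫ z : Euc n × Euc d, ‖u z.1 * v z.2‖ ^ 2

/-- The uncoupled system of the brute-force approach:
`i ∂_t φˣ = H_x φˣ + W(x,0) φˣ`, `i ∂_t φʸ = H_y φʸ + W(0,y) φʸ`. -/
structure IsBruteForceSolution {n d : ℕ} (V₁ : Euc n → ℝ) (V₂ : Euc d → ℝ)
    (W : Euc n × Euc d → ℝ) (u₀ : Euc n → ℂ) (v₀ : Euc d → ℂ)
    (u : ℝ → LTwo (Euc n)) (v : ℝ → LTwo (Euc d)) : Prop where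
  eq_x : IsSchrodingerSolution (fun _ => schrodingerOp fun x => V₁ x + W (x, 0)) u₀ u
  eq_y : IsSchrodingerSolution (fun _ => schrodingerOp fun y => V₂ y + W (0, y)) v₀ v

/-- The time-dependent Hartree system
`i ∂_t φˣ = H_x φˣ + ⟨W⟩_y(t) φˣ`, `i ∂_t φʸ = H_y φʸ + ⟨W⟩_x(t) φʸ`,
with solution `(φˣ, φʸ) ∈ C(ℝ; Σ¹ × Σ¹)`. -/
structure IsHartreeSolution {n d : ℕ} (V₁ : Euc n → ℝ) (V₂ : Euc d → ℝ)
    (W : Euc n × Euc d → ℝ) (u₀ : Euc n → ℂ) (v₀ : Euc d → ℂ)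
    (u : ℝ → LTwo (Euc n)) (v : ℝ → LTwo (Euc d)) : Prop where
  sigma_x : IsContSigmaOne u
  sigma_y : IsContSigmaOne v
  eq_x : IsSchrodingerSolution (fun t => schrodingerOp fun x => V₁ x + avgY W (v t) x) u₀ u
  eq_y : IsSchrodingerSolution (fun t => schrodingerOp fun y => V₂ y + avgX W (u t) y) v₀ v

/-- The brute-force approximation `e^{i t W(0,0)} φˣ(t,x) φʸ(t,y)`. -/
def bruteForceApprox {n d : ℕ} (W : Euc n × Euc d → ℝ)
    (u : ℝ → LTwo (Euc n)) (v : ℝ → LTwo (Euc d)) (t : ℝ) (z : Euc n × Euc d) : ℂ :=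
  Complex.exp (Complex.I * t * W (0, 0)) * (u t z.1 * v t z.2)

/-- The mean-field approximation `φˣ(t,x) φʸ(t,y) e^{i ∫₀ᵗ ⟨W⟩(s) ds}`. -/
def meanFieldApprox {n d : ℕ} (W : Euc n × Euc d → ℝ)
    (u : ℝ → LTwo (Euc n)) (v : ℝ → LTwo (Euc d)) (t : ℝ) (z : Euc n × Euc d) : ℂ :=
  u t z.1 * v t z.2 * Complex.exp (Complex.I * ((∫ s in (0 : ℝ)..t, avgFull W (u s) (v s) : ℝ) : ℂ))

/-- The first moment norm `‖z f‖_{L²} = (∫ |z|² |f(z)|² dz)^{1/2}`, an extended non-negative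
real. -/
def momentNorm {N : ℕ} (f : Euc N → ℂ) : ℝ≥0∞ :=
  eLpNorm (fun z => (‖z‖ : ℂ) * f z) 2 volume

end

/-! Insert a product ansatz exp(iθ) u ⊗ v into the full equation, where u and v solve one-particle
equations with extra potentials A₁(t,x), A₂(t,y) and θ' = c. By the product rule the ansatz solves
the full equation up to a source: the residual potential W − A₁ − A₂ + c times the ansatz, up to
sign. As data agree at time zero, the L² energy estimate bounds the error by the time integral of
the norm of this source (`eLpNorm_sub_tensor_le`).

For the brute-force choice the residual is the second difference of W with base point (0,0). For the
mean-field choice it is the average of the second differences W(x,y) − W(x,y') − W(x',y) + W(x',y')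
over the probability density of (x',y') (`abs_residual_le`). The mean value theorem, used once in y
or once in each variable, bounds a second difference by the gradient or by the mixed derivative. In
the mean-field case the mean of |y'| is returned to the moment norm by Cauchy–Schwarz, which costs a
factor two for each variable carrying a moment.

The main work is the energy estimate (`abs_norm_sub_norm_le_lintegral`), since solutions are only
continuous L² curves satisfying the equation against Schwartz functions and cannot be paired with
themselves. The solution is averaged against Gaussians of width ε, and the averages are summed in L²
over their centres with a slowly decaying Gaussian weight of width 1/ε. The derivative of this
regularised mass is a source term plus a commutator. Antisymmetrising the commutator kernel leaves
only increments of an at most quadratic potential and a drift caused by the weight. Both are bounded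
by a Gaussian of width comparable to ε, and the phase factor Im(conj u(y) u(x)) sees only u(x) −
u(y). So the commutator is controlled by the L² modulus of continuity of u at scale ε, which tends
to zero with no regularity assumed (`abs_integral_commutator_le`).

Gaussians serve this purpose because −½Δ multiplies them by an explicit quadratic, and because they
factor over a product of Euclidean spaces, so the weak equation for u ⊗ v follows from the scalar
product rule with no density argument. -/

/-! ### Gaussians as Schwartz functions, and their Laplacians. -/

section Gaussian

variable {F : Type*} [NormedAddCommGroup F]

/-- The unnormalised Gaussian `exp (-a |x - r|²)` centred at `r`. -/
noncomputable def gauss (a : ℝ) (r x : F) : ℝ := Real.exp (-a * ‖x - r‖ ^ 2)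

theorem gauss_pos (a : ℝ) (r x : F) : 0 < gauss a r x := Real.exp_pos _

theorem gauss_comm (a : ℝ) (r x : F) : gauss a r x = gauss a x r := by
  simp [gauss, norm_sub_rev]

theorem continuous_gauss (a : ℝ) : Continuous fun p : F × F => gauss a p.1 p.2 := by
  unfold gauss; fun_prop

variable [InnerProductSpace ℝ F]

theorem contDiff_gauss (a : ℝ) (r : F) {n : ℕ∞ω} : ContDiff ℝ n (gauss a r) := by
  unfold gauss
  exact Real.contDiff_exp.comp (contDiff_const.mul ((contDiff_id.sub contDiff_const).norm_sq ℝ))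

theorem exists_pow_mul_exp_neg_sq_le (a : ℝ) (ha : 0 < a) (m : ℕ) :
    ∃ C : ℝ, ∀ t : ℝ, 0 ≤ t → (1 + t) ^ m * Real.exp (-a * t ^ 2) ≤ C := by
  have h0 : ∀ t : ℝ, 0 ≤ t → (1 + t) ^ m ≤ (2 : ℝ) ^ m * (1 + (t ^ 2) ^ m) := by
    intro t ht
    rcases le_total t 1 with h | h
    · have : (1 + t) ^ m ≤ (2 : ℝ) ^ m := by gcongr; linarith
      have h2 : (0 : ℝ) ≤ 2 ^ m * (t ^ 2) ^ m := by positivity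
      linarith
    · have : (1 + t) ^ m ≤ (2 * t ^ 2) ^ m := by gcongr; nlinarith
      rw [mul_pow] at this
      have h2 : (0 : ℝ) ≤ 2 ^ m := by positivity
      linarith
  -- The factor m!/a^m comes from keeping only the m-th term of the exponential series of a t².
  refine ⟨2 ^ m * (1 + m.factorial / a ^ m), fun t ht => ?_⟩
  have h1 := Real.pow_div_factorial_le_exp (a * t ^ 2) (by positivity) m
  have h2 : (t ^ 2) ^ m ≤ m.factorial / a ^ m * Real.exp (a * t ^ 2) := by
    rw [div_le_iff₀ (by positivity), mul_pow] at h1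
    rw [div_mul_eq_mul_div, le_div_iff₀ (by positivity)]
    linarith
  have h3 : (1 : ℝ) ≤ Real.exp (a * t ^ 2) := Real.one_le_exp (by positivity)
  have h4 : (1 + t) ^ m ≤ 2 ^ m * (1 + m.factorial / a ^ m) * Real.exp (a * t ^ 2) := by
    refine (h0 t ht).trans ?_
    rw [mul_assoc]
    gcongr
    nlinarith
  rw [neg_mul, Real.exp_neg, ← div_eq_mul_inv, div_le_iff₀ (Real.exp_pos _)]
  exact h4

/-- A centred Gaussian is exp composed with a function of temperate growth. Every derivative of exp
is exp, so a derivative of order n costs only a polynomial factor, which the Gaussian absorbs.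
Translation and the cast to ℂ give the general case. -/
theorem exists_schwartz_gauss (a : ℝ) (ha : 0 < a) (r : F) :
    ∃ χ : 𝓢(F, ℂ), ∀ x, χ x = (gauss a r x : ℂ) := by
  have hq : (fun x : F => -a * ‖x‖ ^ 2).HasTemperateGrowth := by
    have : (fun x : F => ‖x‖ ^ 2) = fun x : F => inner ℝ x x := by
      ext x; rw [real_inner_self_eq_norm_sq]
    rw [show (fun x : F => -a * ‖x‖ ^ 2) = fun x : F => -a * inner ℝ x x by
      ext x; rw [real_inner_self_eq_norm_sq]]
    have h1 : (fun x : F => inner ℝ x x).HasTemperateGrowth := by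
      exact (innerSL ℝ).bilinear_hasTemperateGrowth (Function.HasTemperateGrowth.id)
        (Function.HasTemperateGrowth.id)
    exact (Function.HasTemperateGrowth.const (-a)).mul h1
  have hexp : ∀ (i : ℕ) (y : ℝ), ‖iteratedFDeriv ℝ i Real.exp y‖ = Real.exp y := by
    intro i y
    rw [norm_iteratedFDeriv_eq_norm_iteratedDeriv, iteratedDeriv_eq_iterate]
    simp
  let χ₀ : 𝓢(F, ℝ) :=
    { toFun := fun x => Real.exp (-a * ‖x‖ ^ 2)
      smooth' := Real.contDiff_exp.comp hq.1
      decay' := by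
        intro k n
        obtain ⟨l, C, hC0, hC⟩ := hq.norm_iteratedFDeriv_le_uniform n
        obtain ⟨M, hM⟩ := exists_pow_mul_exp_neg_sq_le a ha (k + l * n)
        refine ⟨n.factorial * (1 + C) ^ n * M, fun x => ?_⟩
        have h1 : (1 : ℝ) ≤ (1 + ‖x‖) ^ l := one_le_pow₀ (by linarith [norm_nonneg x])
        -- The composition bound wants inner derivatives of order i ≥ 1 below D ^ i. Taking 1 + C
        -- instead of C makes D at least 1, hence D ≤ D ^ i.
        have hb := norm_iteratedFDeriv_comp_le (n := n) Real.contDiff_exp hq.1 (mod_cast le_top) x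
          (C := Real.exp (-a * ‖x‖ ^ 2)) (D := (1 + C) * (1 + ‖x‖) ^ l)
          (fun i _ => (hexp i _).le) (fun i hi hin => by
            have h2 : (1 : ℝ) ≤ (1 + C) * (1 + ‖x‖) ^ l := by nlinarith
            calc _ ≤ C * (1 + ‖x‖) ^ l := hC i hin x
              _ ≤ (1 + C) * (1 + ‖x‖) ^ l := by nlinarith
              _ ≤ _ := le_self_pow₀ h2 (by omega))
        calc ‖x‖ ^ k * ‖iteratedFDeriv ℝ n (fun x : F => Real.exp (-a * ‖x‖ ^ 2)) x‖
            ≤ (1 + ‖x‖) ^ k * (n.factorial * Real.exp (-a * ‖x‖ ^ 2)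
              * ((1 + C) * (1 + ‖x‖) ^ l) ^ n) := by
              gcongr
              · linarith [norm_nonneg x]
              · exact hb
          _ = n.factorial * (1 + C) ^ n *
              ((1 + ‖x‖) ^ (k + l * n) * Real.exp (-a * ‖x‖ ^ 2)) := by
              rw [mul_pow, ← pow_mul, pow_add]; ring
          _ ≤ _ := by
              gcongr
              exact hM _ (norm_nonneg x) }
  refine ⟨SchwartzMap.postcompCLM (𝕜 := ℝ) Complex.ofRealCLM (χ₀.compSubConstCLM ℝ r), fun x => ?_⟩
  rfl

theorem hasFDerivAt_gauss (a : ℝ) (r x : F) :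
    HasFDerivAt (gauss a r) ((-2 * a * gauss a r x) • innerSL ℝ (x - r)) x := by
  have h := (((hasFDerivAt_id x).sub_const r).norm_sq.const_mul (-a)).exp
  refine h.congr_fderiv ?_
  ext v
  simp [gauss]
  ring

theorem laplacian_gauss [FiniteDimensional ℝ F] (a : ℝ) (r x : F) :
    (Δ (fun y => (gauss a r y : ℂ))) x =
      (((4 * a ^ 2 * ‖x - r‖ ^ 2 - 2 * a * Module.finrank ℝ F) * gauss a r x : ℝ) : ℂ) := by
  have h1 : (Δ (fun y => (gauss a r y : ℂ))) x = ((Δ (gauss a r)) x : ℂ) := by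
    have := (contDiff_gauss a r (n := 2)).contDiffAt (x := x) |>.laplacian_CLM_comp_left
      (l := Complex.ofRealCLM)
    exact this
  rw [h1, InnerProductSpace.laplacian_eq_iteratedFDeriv_stdOrthonormalBasis]
  congr 1
  have hf : fderiv ℝ (gauss a r) = fun y => (-2 * a * gauss a r y) • innerSL ℝ (y - r) := by
    ext1 y; exact (hasFDerivAt_gauss a r y).fderiv
  have h2 : ∀ v : F, iteratedFDeriv ℝ 2 (gauss a r) x ![v, v] =
      (4 * a ^ 2 * (inner ℝ v (x - r)) ^ 2 - 2 * a * ‖v‖ ^ 2) * gauss a r x := by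
    intro v
    rw [iteratedFDeriv_two_apply, hf]
    have h3 : HasFDerivAt (fun y => innerSL ℝ (y - r)) (innerSL ℝ : F →L[ℝ] F →L[ℝ] ℝ) x := by
      exact (innerSL ℝ : F →L[ℝ] F →L[ℝ] ℝ).hasFDerivAt.comp x ((hasFDerivAt_id x).sub_const r)
    have h4 : HasFDerivAt (fun y => (-2 * a * gauss a r y) • innerSL ℝ (y - r)) _ x :=
      ((hasFDerivAt_gauss a r x).const_mul (-2 * a)).smul h3
    rw [h4.fderiv]
    simp
    have h5 : (innerSL ℝ v) v = ‖v‖ ^ 2 := by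
      rw [innerSL_apply_apply, real_inner_self_eq_norm_sq]
    rw [h5, inner_sub_right, real_inner_comm v x, real_inner_comm v r]
    ring
  simp_rw [h2]
  rw [← Finset.sum_mul, Finset.sum_sub_distrib, ← Finset.mul_sum, ← Finset.mul_sum]
  rw [OrthonormalBasis.sum_sq_inner_right]
  simp
end Gaussian

/-! ### Cauchy–Schwarz for extended non-negative integrals. -/

section CauchySchwarz

theorem lintegral_enorm_mul_enorm_le {α E E' : Type*} [MeasurableSpace α] {μ : Measure α}
    [NormedAddCommGroup E] [NormedAddCommGroup E'] {f : α → E} {g : α → E'}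
    (hf : AEStronglyMeasurable f μ) (hg : AEStronglyMeasurable g μ) :
    ∫⁻ x, ‖f x‖ₑ * ‖g x‖ₑ ∂μ ≤ eLpNorm f 2 μ * eLpNorm g 2 μ := by
  have h := ENNReal.lintegral_mul_le_Lp_mul_Lq μ Real.HolderConjugate.two_two hf.enorm hg.enorm
  rw [eLpNorm_eq_lintegral_rpow_enorm_toReal (by norm_num) (by norm_num),
    eLpNorm_eq_lintegral_rpow_enorm_toReal (by norm_num) (by norm_num)]
  simpa using h

theorem eLpNorm_two_sq {α E : Type*} [MeasurableSpace α] {μ : Measure α}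
    [NormedAddCommGroup E] (f : α → E) :
    eLpNorm f 2 μ ^ 2 = ∫⁻ x, ‖f x‖ₑ ^ 2 ∂μ := by
  rw [eLpNorm_eq_lintegral_rpow_enorm_toReal (by norm_num) (by norm_num),
    ← ENNReal.rpow_natCast, ← ENNReal.rpow_mul]
  simp

end CauchySchwarz

/-! ### Masses and polynomially weighted integrals of Gaussians. -/

section GaussianIntegrals

variable {F : Type*} [NormedAddCommGroup F]

/-- Since 1 + |x| ≤ (1 + |x − r|)(1 + |r|), half of the exponent absorbs the power of 1 + |x − r|
and only growth in the centre r is left. -/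
theorem one_add_norm_pow_mul_gauss_le (a : ℝ) (ha : 0 < a) (m : ℕ) :
    ∃ C : ℝ, 0 ≤ C ∧ ∀ r x : F,
      (1 + ‖x‖) ^ m * gauss a r x ≤ C * (1 + ‖r‖) ^ m * gauss (a / 2) r x := by
  obtain ⟨C, hC⟩ := exists_pow_mul_exp_neg_sq_le (a / 2) (by positivity) m
  refine ⟨C, le_trans (by positivity) (hC 0 le_rfl), fun r x => ?_⟩
  have h1 : 1 + ‖x‖ ≤ (1 + ‖x - r‖) * (1 + ‖r‖) := by
    have : ‖x‖ ≤ ‖x - r‖ + ‖r‖ := by simpa using norm_add_le (x - r) r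
    nlinarith [norm_nonneg (x - r), norm_nonneg r]
  have h2 : gauss a r x = Real.exp (-(a / 2) * ‖x - r‖ ^ 2) * gauss (a / 2) r x := by
    rw [gauss, gauss, ← Real.exp_add]; ring_nf
  calc (1 + ‖x‖) ^ m * gauss a r x
      ≤ ((1 + ‖x - r‖) * (1 + ‖r‖)) ^ m * gauss a r x := by
        gcongr
        exact (gauss_pos _ _ _).le
    _ = ((1 + ‖x - r‖) ^ m * Real.exp (-(a / 2) * ‖x - r‖ ^ 2)) *
        ((1 + ‖r‖) ^ m * gauss (a / 2) r x) := by rw [h2, mul_pow]; ring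
    _ ≤ C * ((1 + ‖r‖) ^ m * gauss (a / 2) r x) := by
        gcongr
        · exact mul_nonneg (by positivity) (gauss_pos _ _ _).le
        · exact hC _ (norm_nonneg _)
    _ = _ := by ring

theorem continuous_gauss_right (a : ℝ) (r : F) : Continuous (gauss a r) := by
  unfold gauss; fun_prop

theorem gauss_le_one {a : ℝ} (ha : 0 ≤ a) (r x : F) : gauss a r x ≤ 1 := by
  rw [gauss, Real.exp_le_one_iff]
  nlinarith [sq_nonneg ‖x - r‖]

variable [InnerProductSpace ℝ F] [FiniteDimensional ℝ F] [MeasurableSpace F] [BorelSpace F]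

theorem integrable_gauss {a : ℝ} (ha : 0 < a) (r : F) : Integrable (gauss a r) := by
  obtain ⟨χ, hχ⟩ := exists_schwartz_gauss a ha r
  have := (χ.integrable (μ := volume)).re
  refine this.congr (Filter.Eventually.of_forall fun x => ?_)
  simp [hχ]

theorem memLp_gauss {a : ℝ} (ha : 0 < a) (r : F) : MemLp (gauss a r) 2 := by
  obtain ⟨χ, hχ⟩ := exists_schwartz_gauss a ha r
  refine ((χ.memLp 2 volume).re).ae_eq (Filter.Eventually.of_forall fun x => ?_)
  simp [hχ]

/-- The total mass of the Gaussian. -/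
noncomputable def gaussMass (F : Type*) [NormedAddCommGroup F] [InnerProductSpace ℝ F]
    [FiniteDimensional ℝ F] [MeasurableSpace F] [BorelSpace F] (a : ℝ) : ℝ :=
  ∫ x : F, gauss a 0 x

theorem integral_gauss (a : ℝ) (r : F) : ∫ x, gauss a r x = gaussMass F a := by
  have := integral_sub_right_eq_self (μ := volume) (fun x : F => gauss a 0 x) r
  rw [gaussMass, ← this]
  simp [gauss]

theorem gaussMass_pos {a : ℝ} (ha : 0 < a) : 0 < gaussMass F a := by
  rw [gaussMass, integral_pos_iff_support_of_nonneg (fun x => (gauss_pos _ _ _).le)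
    (integrable_gauss ha 0)]
  have : Function.support (gauss a (0 : F)) = univ := by
    ext x; simp [(gauss_pos a 0 x).ne']
  rw [this]
  exact Measure.measure_univ_pos.2 (NeZero.ne _)

theorem gaussMass_anti {a b : ℝ} (ha : 0 < a) (hab : a ≤ b) : gaussMass F b ≤ gaussMass F a := by
  refine integral_mono (integrable_gauss (ha.trans_le hab) 0) (integrable_gauss ha 0) fun x => ?_
  simp only [gauss]
  gcongr

theorem gaussMass_inv_sq {ε : ℝ} (hε : 0 < ε) :
    gaussMass F (ε⁻¹ ^ 2) = ε ^ Module.finrank ℝ F * gaussMass F 1 := by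
  have := Measure.integral_comp_smul_of_nonneg (volume : Measure F) (gauss 1 0) ε⁻¹
    (hR := by positivity)
  have h2 : ∀ x : F, gauss 1 0 (ε⁻¹ • x) = gauss (ε⁻¹ ^ 2) 0 x := by
    intro x
    simp only [gauss, sub_zero, norm_smul, Real.norm_eq_abs, mul_pow, sq_abs]
    ring_nf
  simp_rw [h2] at this
  rw [gaussMass, this, inv_pow, inv_inv, smul_eq_mul, gaussMass]

theorem eLpNorm_gauss (a : ℝ) (r : F) :
    eLpNorm (gauss a r) 2 volume = eLpNorm (gauss a (0 : F)) 2 volume := by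
  have := eLpNorm_comp_measurePreserving (p := 2) (g := gauss a (0 : F))
    (continuous_gauss_right a 0).aestronglyMeasurable (measurePreserving_sub_right volume r)
  rw [← this]
  congr 1
  ext x
  simp [gauss]

/-- Pairings with Gaussians grow at most polynomially in the centre, with a constant uniform over
L². This supplies the dominating functions for Fubini and for differentiation in time. -/
theorem exists_integral_weight_gauss_le (a : ℝ) (ha : 0 < a) (m : ℕ) :
    ∃ C : ℝ, 0 ≤ C ∧ ∀ (r : F) (u : LTwo F),
      Integrable (fun x => (1 + ‖x‖) ^ m * gauss a r x * ‖u x‖) ∧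
      ∫ x, (1 + ‖x‖) ^ m * gauss a r x * ‖u x‖ ≤ C * (1 + ‖r‖) ^ m * ‖u‖ := by
  obtain ⟨C, hC0, hC⟩ := one_add_norm_pow_mul_gauss_le (F := F) a ha m
  set D := (eLpNorm (gauss (a / 2) (0 : F)) 2 volume).toReal
  refine ⟨C * D, by positivity, fun r u => ?_⟩
  have hmeas : AEStronglyMeasurable (fun x => (1 + ‖x‖) ^ m * gauss a r x * ‖u x‖) volume := by
    refine AEStronglyMeasurable.mul ?_ (Lp.aestronglyMeasurable u).norm
    exact (((continuous_const.add continuous_norm).pow m).mul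
      (continuous_gauss_right a r)).aestronglyMeasurable
  have h1 : Integrable (fun x => gauss (a / 2) r x * ‖u x‖) :=
    (memLp_gauss (by positivity) r).integrable_mul (Lp.memLp u).norm
  have h2 : ∫ x, gauss (a / 2) r x * ‖u x‖ ≤ D * ‖u‖ := by
    have h3 := lintegral_enorm_mul_enorm_le (μ := volume)
      (continuous_gauss_right (a / 2) r).aestronglyMeasurable (Lp.aestronglyMeasurable u)
    have h4 : ∫ x, gauss (a / 2) r x * ‖u x‖ =
        (∫⁻ x, ‖gauss (a / 2) r x‖ₑ * ‖u x‖ₑ).toReal := by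
      rw [integral_eq_lintegral_of_nonneg_ae
        (Filter.Eventually.of_forall fun x => mul_nonneg (gauss_pos _ _ _).le (norm_nonneg _))
        h1.1]
      congr 2 with x
      rw [ENNReal.ofReal_mul (gauss_pos _ _ _).le, ofReal_norm,
        ← Real.enorm_eq_ofReal (gauss_pos _ _ _).le]
    rw [h4, Lp.norm_def, ← ENNReal.toReal_mul]
    rw [eLpNorm_gauss] at h3
    exact ENNReal.toReal_mono (ENNReal.mul_ne_top (memLp_gauss (by positivity) 0).2.ne
      (Lp.eLpNorm_ne_top u)) h3
  have h5 : ∀ x, (1 + ‖x‖) ^ m * gauss a r x * ‖u x‖ ≤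
      C * (1 + ‖r‖) ^ m * (gauss (a / 2) r x * ‖u x‖) := by
    intro x
    rw [← mul_assoc]
    exact mul_le_mul_of_nonneg_right (hC r x) (norm_nonneg _)
  have h6 : Integrable (fun x => (1 + ‖x‖) ^ m * gauss a r x * ‖u x‖) := by
    refine (h1.const_mul (C * (1 + ‖r‖) ^ m)).mono' hmeas (Filter.Eventually.of_forall fun x => ?_)
    rw [Real.norm_of_nonneg]
    · exact h5 x
    · have := (gauss_pos a r x).le
      positivity
  refine ⟨h6, (integral_mono h6 (h1.const_mul (C * (1 + ‖r‖) ^ m)) h5).trans ?_⟩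
  rw [integral_const_mul]
  calc C * (1 + ‖r‖) ^ m * ∫ x, gauss (a / 2) r x * ‖u x‖
      ≤ C * (1 + ‖r‖) ^ m * (D * ‖u‖) := by gcongr
    _ = _ := by ring

theorem integrable_weight_gauss {a : ℝ} (ha : 0 < a) (m : ℕ) (r : F) :
    Integrable (fun x : F => (1 + ‖x‖) ^ m * gauss a r x) := by
  obtain ⟨C, hC0, hC⟩ := one_add_norm_pow_mul_gauss_le (F := F) a ha m
  refine ((integrable_gauss (half_pos ha) r).const_mul (C * (1 + ‖r‖) ^ m)).mono'
    (Continuous.aestronglyMeasurable ?_) (Filter.Eventually.of_forall fun x => ?_)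
  · exact ((continuous_const.add continuous_norm).pow m).mul (continuous_gauss_right a r)
  · rw [Real.norm_of_nonneg (mul_nonneg (by positivity) (gauss_pos _ _ _).le)]
    exact hC r x

end GaussianIntegrals

theorem gauss_half_sq {F : Type*} [NormedAddCommGroup F] (a : ℝ) (r x : F) :
    gauss (a / 2) r x ^ 2 = gauss a r x := by
  rw [gauss, gauss, ← Real.exp_nat_mul]
  ring_nf

/-! ### The averaged L² modulus of continuity and Gaussian averages. -/

section Translation

variable {F : Type*} [NormedAddCommGroup F] [InnerProductSpace ℝ F] [FiniteDimensional ℝ F]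
  [MeasurableSpace F] [BorelSpace F]

/-- Translation `u ↦ u (· + s)` on `L²`. -/
noncomputable def translateLp (s : F) (u : LTwo F) : LTwo F :=
  Lp.compMeasurePreserving (fun x => x + s) (measurePreserving_add_right volume s) u

theorem coeFn_translateLp (s : F) (u : LTwo F) :
    translateLp s u =ᵐ[volume] fun x => u (x + s) :=
  Lp.coeFn_compMeasurePreserving _ _

theorem norm_translateLp (s : F) (u : LTwo F) : ‖translateLp s u‖ = ‖u‖ :=
  Lp.norm_compMeasurePreserving _ _

theorem translateLp_zero (u : LTwo F) : translateLp 0 u = u := by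
  refine Lp.ext ((coeFn_translateLp 0 u).trans ?_)
  simp

theorem continuous_translateLp : Continuous fun p : F × LTwo F => translateLp p.1 p.2 := by
  let g : C(F × LTwo F, C(F, F)) :=
    (ContinuousMap.mk (fun q : (F × LTwo F) × F => q.2 + q.1.1) (by fun_prop)).curry
  exact Continuous.compMeasurePreservingLp (μ := (volume : Measure F)) (ν := (volume : Measure F))
    (p := 2) continuous_snd g.continuous (fun z => measurePreserving_add_right volume z.1)
    (by norm_num)

/-- The `L²` modulus of continuity of `u`, averaged against a Gaussian at scale `ε`. -/
noncomputable def oscLp (ε : ℝ) (u : LTwo F) : ℝ :=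
  ∫ σ : F, gauss (1 / 4) 0 σ * ‖translateLp (ε • σ) u - u‖

theorem oscLp_nonneg (ε : ℝ) (u : LTwo F) : 0 ≤ oscLp ε u :=
  integral_nonneg fun _ => mul_nonneg (gauss_pos _ _ _).le (norm_nonneg _)

theorem oscLp_zero (u : LTwo F) : oscLp 0 u = 0 := by
  simp [oscLp, translateLp_zero]

theorem norm_translateLp_sub_le (s : F) (u : LTwo F) : ‖translateLp s u - u‖ ≤ 2 * ‖u‖ := by
  refine (norm_sub_le _ _).trans ?_
  rw [norm_translateLp]; linarith

/-- Joint continuity, including at ε = 0 where the quantity vanishes, replaces any rate of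
convergence: along a continuous curve in L², the time integral of the modulus tends to zero with ε.
-/
theorem continuous_oscLp : Continuous fun p : ℝ × LTwo F => oscLp p.1 p.2 := by
  rw [continuous_iff_continuousAt]
  rintro ⟨ε, u⟩
  refine continuousAt_of_dominated (bound := fun σ => gauss (1 / 4) 0 σ * (2 * (‖u‖ + 1)))
    (Filter.Eventually.of_forall fun p => ?_) ?_
    ((integrable_gauss (by norm_num) 0).mul_const _) (Filter.Eventually.of_forall fun σ => ?_)
  · refine Continuous.aestronglyMeasurable ?_
    refine (continuous_gauss_right _ _).mul (Continuous.norm (Continuous.sub ?_ continuous_const))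
    exact continuous_translateLp.comp ((continuous_id.const_smul p.1).prodMk continuous_const)
  · have h : ∀ᶠ p : ℝ × LTwo F in nhds (ε, u), ‖p.2‖ < ‖u‖ + 1 :=
      (continuous_snd.norm.tendsto (ε, u)).eventually (gt_mem_nhds (by simp))
    filter_upwards [h] with p hp
    refine Filter.Eventually.of_forall fun σ => ?_
    rw [Real.norm_of_nonneg (mul_nonneg (gauss_pos _ _ _).le (norm_nonneg _))]
    have := gauss_pos (1 / 4) 0 σ
    gcongr
    exact (norm_translateLp_sub_le _ _).trans (by linarith)
  · refine Continuous.continuousAt ?_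
    refine continuous_const.mul (Continuous.norm (Continuous.sub ?_ continuous_snd))
    exact continuous_translateLp.comp ((continuous_fst.smul continuous_const).prodMk continuous_snd)

/-- Put x = y + s, exchange the integrals, apply Cauchy–Schwarz in y, and rescale s = εσ. The
Jacobian of the rescaling is the power of ε. -/
theorem lintegral_gauss_mul_diff_le {ε : ℝ} (hε : 0 < ε) (u : LTwo F) :
    ∫⁻ y, ∫⁻ x, ENNReal.ofReal (gauss (ε⁻¹ ^ 2 / 4) y x) * (‖u y‖ₑ * ‖u x - u y‖ₑ) ≤
      ENNReal.ofReal (ε ^ Module.finrank ℝ F * (‖u‖ * oscLp ε u)) := by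
  have hu : Measurable u := (Lp.stronglyMeasurable u).measurable
  have hg : Measurable (gauss (ε⁻¹ ^ 2 / 4) (0 : F)) := (continuous_gauss_right _ _).measurable
  calc ∫⁻ y, ∫⁻ x, ENNReal.ofReal (gauss (ε⁻¹ ^ 2 / 4) y x) * (‖u y‖ₑ * ‖u x - u y‖ₑ)
      = ∫⁻ y, ∫⁻ s, ENNReal.ofReal (gauss (ε⁻¹ ^ 2 / 4) 0 s) * (‖u y‖ₑ * ‖u (y + s) - u y‖ₑ) := by
        refine lintegral_congr fun y => ?_
        rw [← lintegral_add_left_eq_self _ y]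
        simp [gauss]
    _ = ∫⁻ s, ∫⁻ y, ENNReal.ofReal (gauss (ε⁻¹ ^ 2 / 4) 0 s) *
          (‖u y‖ₑ * ‖u (y + s) - u y‖ₑ) := by
        refine lintegral_lintegral_swap (Measurable.aemeasurable ?_)
        refine (hg.comp measurable_snd).ennreal_ofReal.mul ?_
        exact (hu.comp measurable_fst).enorm.mul
          (((hu.comp (measurable_fst.add measurable_snd)).sub (hu.comp measurable_fst)).enorm)
    _ ≤ ∫⁻ s, ENNReal.ofReal (gauss (ε⁻¹ ^ 2 / 4) 0 s * (‖u‖ * ‖translateLp s u - u‖)) := by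
        refine lintegral_mono fun s => ?_
        dsimp only
        rw [lintegral_const_mul' _ _ ENNReal.ofReal_ne_top, ENNReal.ofReal_mul (gauss_pos _ _ _).le]
        gcongr
        have h1 := lintegral_enorm_mul_enorm_le (μ := volume) (Lp.aestronglyMeasurable u)
          (Lp.aestronglyMeasurable (translateLp s u - u))
        rw [← Lp.enorm_def, ← Lp.enorm_def, ← ofReal_norm, ← ofReal_norm,
          ← ENNReal.ofReal_mul (norm_nonneg _)] at h1
        refine le_of_eq_of_le (lintegral_congr_ae ?_) h1
        filter_upwards [Lp.coeFn_sub (translateLp s u) u, coeFn_translateLp s u] with y h2 h3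
        rw [h2, Pi.sub_apply, h3]
    _ = ENNReal.ofReal (∫ s, gauss (ε⁻¹ ^ 2 / 4) 0 s * (‖u‖ * ‖translateLp s u - u‖)) := by
        rw [ofReal_integral_eq_lintegral_ofReal]
        · refine Integrable.mono' ((integrable_gauss (a := ε⁻¹ ^ 2 / 4) (by positivity)
            (0 : F)).mul_const (‖u‖ * (2 * ‖u‖))) (Continuous.aestronglyMeasurable ?_)
            (Filter.Eventually.of_forall fun s => ?_)
          · refine (continuous_gauss_right _ _).mul (continuous_const.mul (Continuous.norm
              (Continuous.sub ?_ continuous_const)))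
            exact continuous_translateLp.comp (continuous_id.prodMk continuous_const)
          · have := (gauss_pos (ε⁻¹ ^ 2 / 4) 0 s).le
            rw [Real.norm_of_nonneg (by positivity)]
            gcongr
            exact norm_translateLp_sub_le _ _
        · refine Filter.Eventually.of_forall fun s => ?_
          have := (gauss_pos (ε⁻¹ ^ 2 / 4) 0 s).le
          simp only [Pi.zero_apply]
          positivity
    _ = _ := by
        congr 1
        have h := Measure.integral_comp_smul_of_nonneg (volume : Measure F)
          (fun s => gauss (ε⁻¹ ^ 2 / 4) 0 s * (‖u‖ * ‖translateLp s u - u‖)) ε (hR := hε.le)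
        have h2 : ∀ σ : F, gauss (ε⁻¹ ^ 2 / 4) 0 (ε • σ) = gauss (1 / 4) 0 σ := by
          intro σ
          simp only [gauss, sub_zero, norm_smul, Real.norm_eq_abs, mul_pow, sq_abs]
          congr 1
          field_simp
        simp_rw [h2] at h
        rw [smul_eq_mul, eq_inv_mul_iff_mul_eq₀ (by positivity)] at h
        rw [← h, oscLp, ← integral_const_mul ‖u‖]
        congr 2 with σ
        ring

/-- The Gaussian average of a function. -/
noncomputable def gaussAvg (a : ℝ) (u : F → ℂ) (r : F) : ℂ := ∫ x, (gauss a r x : ℂ) * u x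

theorem lintegral_gauss {a : ℝ} (ha : 0 < a) (r : F) :
    ∫⁻ x, ENNReal.ofReal (gauss a r x) = ENNReal.ofReal (gaussMass F a) := by
  rw [← integral_gauss a r, ofReal_integral_eq_lintegral_ofReal (integrable_gauss ha r)]
  exact Filter.Eventually.of_forall fun x => (gauss_pos _ _ _).le

/-- Cauchy–Schwarz after writing the Gaussian as the square of the Gaussian with half the exponent.
-/
theorem enorm_gaussAvg_sq_le {a : ℝ} (ha : 0 < a) {f : F → ℂ}
    (hf : AEStronglyMeasurable f volume) (r : F) :
    ‖gaussAvg a f r‖ₑ ^ 2 ≤ ENNReal.ofReal (gaussMass F a) *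
      ∫⁻ x, ENNReal.ofReal (gauss a r x) * ‖f x‖ₑ ^ 2 := by
  have hm : AEStronglyMeasurable (gauss (a / 2) r) volume :=
    (continuous_gauss_right _ _).aestronglyMeasurable
  have h1 := lintegral_enorm_mul_enorm_le (μ := volume) hm
    (hm.mul hf.norm)
  have h2 : ‖gaussAvg a f r‖ₑ ≤
      ∫⁻ x, ‖gauss (a / 2) r x‖ₑ * ‖(gauss (a / 2) r * fun x => ‖f x‖) x‖ₑ := by
    refine (enorm_integral_le_lintegral_enorm _).trans (le_of_eq (lintegral_congr fun x => ?_))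
    rw [← gauss_half_sq]
    simp only [Pi.mul_apply, enorm_mul, enorm_norm, sq, Complex.ofReal_mul]
    rw [show ‖((gauss (a / 2) r x : ℝ) : ℂ)‖ₑ = ‖gauss (a / 2) r x‖ₑ by
      rw [← ofReal_norm, ← ofReal_norm, Complex.norm_real], mul_assoc]
  calc ‖gaussAvg a f r‖ₑ ^ 2 ≤ _ := pow_le_pow_left' (h2.trans h1) 2
    _ = _ := by
      rw [mul_pow, eLpNorm_two_sq, eLpNorm_two_sq, ← lintegral_gauss ha r]
      congr 1
      · refine lintegral_congr fun x => ?_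
        rw [← gauss_half_sq a, Real.enorm_eq_ofReal (gauss_pos _ _ _).le,
          ENNReal.ofReal_pow (gauss_pos _ _ _).le]
      · refine lintegral_congr fun x => ?_
        rw [← gauss_half_sq a, Pi.mul_apply, enorm_mul, mul_pow, enorm_norm,
          Real.enorm_eq_ofReal (gauss_pos _ _ _).le, ENNReal.ofReal_pow (gauss_pos _ _ _).le]

/-- Young's inequality for convolution with a Gaussian: integrate the pointwise Cauchy–Schwarz bound
over the centre and use symmetry of the kernel. -/
theorem lintegral_gaussAvg_sq_le {a : ℝ} (ha : 0 < a) {f : F → ℂ}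
    (hf : AEStronglyMeasurable f volume) :
    ∫⁻ r, ‖gaussAvg a f r‖ₑ ^ 2 ≤
      ENNReal.ofReal (gaussMass F a) ^ 2 * eLpNorm f 2 volume ^ 2 := by
  calc ∫⁻ r, ‖gaussAvg a f r‖ₑ ^ 2
      ≤ ∫⁻ r, ENNReal.ofReal (gaussMass F a) *
          ∫⁻ x, ENNReal.ofReal (gauss a r x) * ‖f x‖ₑ ^ 2 :=
        lintegral_mono fun r => enorm_gaussAvg_sq_le ha hf r
    _ = ENNReal.ofReal (gaussMass F a) *
          ∫⁻ x, ∫⁻ r, ENNReal.ofReal (gauss a r x) * ‖f x‖ₑ ^ 2 := by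
        rw [lintegral_const_mul' _ _ ENNReal.ofReal_ne_top, lintegral_lintegral_swap]
        exact AEMeasurable.mul (continuous_gauss a).measurable.ennreal_ofReal.aemeasurable
          ((hf.comp_snd (μ := (volume : Measure F))).enorm.pow_const 2)
    _ = ENNReal.ofReal (gaussMass F a) *
          ∫⁻ x, ENNReal.ofReal (gaussMass F a) * ‖f x‖ₑ ^ 2 := by
        congr 1
        refine lintegral_congr fun x => ?_
        simp_rw [gauss_comm a _ x]
        rw [lintegral_mul_const _ (continuous_gauss_right a x).measurable.ennreal_ofReal,
          lintegral_gauss ha x]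
    _ = _ := by
        rw [lintegral_const_mul' _ _ ENNReal.ofReal_ne_top, eLpNorm_two_sq]
        ring
attribute [irreducible] oscLp

end Translation

theorem integral_norm_mul_norm_le_sqrt {α E : Type*} [MeasurableSpace α] {μ : Measure α}
    [NormedAddCommGroup E] {f g : α → E} (hf : MemLp f 2 μ) (hg : MemLp g 2 μ) :
    ∫ x, ‖f x‖ * ‖g x‖ ∂μ ≤ √(∫ x, ‖f x‖ ^ 2 ∂μ) * √(∫ x, ‖g x‖ ^ 2 ∂μ) := by
  have h := integral_mul_norm_le_Lp_mul_Lq Real.HolderConjugate.two_two (by simpa using hf)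
    (by simpa using hg)
  simpa [Real.sqrt_eq_rpow] using h

theorem integral_norm_sq_eq {α E : Type*} [MeasurableSpace α] {μ : Measure α}
    [NormedAddCommGroup E] {f : α → E} (hf : MemLp f 2 μ) :
    ∫ x, ‖f x‖ ^ 2 ∂μ = (eLpNorm f 2 μ).toReal ^ 2 := by
  rw [integral_eq_lintegral_of_nonneg_ae (Filter.Eventually.of_forall fun x => sq_nonneg _)
    (hf.1.norm.pow 2), ← ENNReal.toReal_pow, eLpNorm_two_sq]
  congr 2 with x
  rw [ENNReal.ofReal_pow (norm_nonneg _), ofReal_norm]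

/-! ### The regularised mass and its convergence to the L² norm. -/

section RegularisedMass

variable {F : Type*} [NormedAddCommGroup F] [InnerProductSpace ℝ F] [FiniteDimensional ℝ F]
  [MeasurableSpace F] [BorelSpace F]

theorem aestronglyMeasurable_integral_mul {Q : F × F → ℝ} (hQ : Continuous Q) {f : F → ℂ}
    (hf : AEStronglyMeasurable f volume) :
    AEStronglyMeasurable (fun r => ∫ x, (Q (r, x) : ℂ) * f x) (volume : Measure F) := by
  have h : AEStronglyMeasurable (fun p : F × F => (Q p : ℂ) * f p.2) (volume.prod volume) :=
    (Complex.continuous_ofReal.comp hQ).aestronglyMeasurable.mul hf.comp_snd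
  exact h.integral_prod_right'

theorem aestronglyMeasurable_gaussAvg (a : ℝ) {f : F → ℂ} (hf : AEStronglyMeasurable f volume) :
    AEStronglyMeasurable (gaussAvg a f) volume :=
  aestronglyMeasurable_integral_mul (continuous_gauss a) hf

/-- The gaussAvg, localised by a Gaussian weight in the centre variable. -/
noncomputable def locAvg (b a : ℝ) (f : F → ℂ) (r : F) : ℂ :=
  (gauss (b / 2) 0 r : ℂ) * gaussAvg a f r

theorem aestronglyMeasurable_locAvg (b a : ℝ) {f : F → ℂ} (hf : AEStronglyMeasurable f volume) :
    AEStronglyMeasurable (locAvg b a f) volume :=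
  (Complex.continuous_ofReal.comp (continuous_gauss_right _ _)).aestronglyMeasurable.mul
    (aestronglyMeasurable_gaussAvg a hf)

theorem norm_locAvg_sq (b a : ℝ) (f : F → ℂ) (r : F) :
    ‖locAvg b a f r‖ ^ 2 = gauss b 0 r * ‖gaussAvg a f r‖ ^ 2 := by
  rw [locAvg, norm_mul, mul_pow, Complex.norm_real, Real.norm_eq_abs, sq_abs, gauss_half_sq]

theorem eLpNorm_locAvg_le {b a : ℝ} (hb : 0 ≤ b) (ha : 0 < a) {f : F → ℂ}
    (hf : AEStronglyMeasurable f volume) :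
    eLpNorm (locAvg b a f) 2 volume ≤
      ENNReal.ofReal (gaussMass F a) * eLpNorm f 2 volume := by
  have h : eLpNorm (locAvg b a f) 2 volume ^ 2 ≤
      (ENNReal.ofReal (gaussMass F a) * eLpNorm f 2 volume) ^ 2 := by
    rw [mul_pow]
    refine le_trans ?_ (lintegral_gaussAvg_sq_le ha hf)
    rw [eLpNorm_two_sq]
    refine lintegral_mono fun r => ?_
    gcongr
    rw [locAvg, enorm_mul]
    refine mul_le_of_le_one_left (by positivity) ?_
    rw [← ofReal_norm, Complex.norm_real, Real.norm_of_nonneg (gauss_pos _ _ _).le]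
    exact ENNReal.ofReal_le_one.2 (gauss_le_one (by positivity) _ _)
  exact (ENNReal.pow_le_pow_left_iff two_ne_zero).1 h

theorem memLp_locAvg {b a : ℝ} (hb : 0 ≤ b) (ha : 0 < a) {f : F → ℂ} (hf : MemLp f 2 volume) :
    MemLp (locAvg b a f) 2 volume :=
  ⟨aestronglyMeasurable_locAvg b a hf.1, (eLpNorm_locAvg_le hb ha hf.1).trans_lt
    (ENNReal.mul_lt_top ENNReal.ofReal_lt_top hf.2)⟩

/-- The `L²` mass of the regularisation of `u` at scale `ε`. -/
noncomputable def regMass (ε : ℝ) (u : F → ℂ) : ℝ :=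
  ∫ r, gauss (ε ^ 2) 0 r * ‖gaussAvg (ε⁻¹ ^ 2) u r‖ ^ 2

theorem regMass_nonneg (ε : ℝ) (u : F → ℂ) : 0 ≤ regMass ε u :=
  integral_nonneg fun _ => mul_nonneg (gauss_pos _ _ _).le (sq_nonneg _)

theorem sqrt_regMass (ε : ℝ) (hε : 0 < ε) {u : F → ℂ} (hu : MemLp u 2 volume) :
    √(regMass ε u) = (eLpNorm (locAvg (ε ^ 2) (ε⁻¹ ^ 2) u) 2 volume).toReal := by
  rw [regMass]
  simp_rw [← norm_locAvg_sq]
  rw [integral_norm_sq_eq (memLp_locAvg (by positivity) (by positivity) hu),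
    Real.sqrt_sq ENNReal.toReal_nonneg]

theorem sqrt_regMass_le {ε : ℝ} (hε : 0 < ε) {u : F → ℂ} (hu : MemLp u 2 volume) :
    √(regMass ε u) ≤ gaussMass F (ε⁻¹ ^ 2) * (eLpNorm u 2 volume).toReal := by
  rw [sqrt_regMass ε hε hu, ← ENNReal.toReal_ofReal (gaussMass_pos (F := F)
    (a := ε⁻¹ ^ 2) (by positivity)).le, ← ENNReal.toReal_mul]
  exact ENNReal.toReal_mono (ENNReal.mul_ne_top ENNReal.ofReal_ne_top hu.2.ne)
    (eLpNorm_locAvg_le (by positivity) (by positivity) hu.1)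

/-- Keeping the square root of the regularised mass as a factor lets it cancel when that square root
is differentiated, so the source enters linearly with constant one. -/
theorem abs_integral_inner_gaussAvg_le {ε : ℝ} (hε : 0 < ε) {u f : F → ℂ}
    (hu : MemLp u 2 volume) (hf : MemLp f 2 volume) :
    |∫ r, gauss (ε ^ 2) 0 r * (star (gaussAvg (ε⁻¹ ^ 2) u r) * gaussAvg (ε⁻¹ ^ 2) f r).im| ≤
      √(regMass ε u) * (gaussMass F (ε⁻¹ ^ 2) * (eLpNorm f 2 volume).toReal) := by
  have hb : 0 ≤ ε ^ 2 := by positivity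
  have ha : 0 < ε⁻¹ ^ 2 := by positivity
  have h := integral_norm_mul_norm_le_sqrt (memLp_locAvg hb ha hu) (memLp_locAvg hb ha hf)
  simp_rw [norm_locAvg_sq] at h
  refine le_trans ?_ (h.trans ?_)
  · rw [← Real.norm_eq_abs]
    refine norm_integral_le_of_norm_le
      ((memLp_locAvg hb ha hu).norm.integrable_mul (memLp_locAvg hb ha hf).norm)
      (Filter.Eventually.of_forall fun r => ?_)
    rw [norm_mul, Real.norm_of_nonneg (gauss_pos _ _ _).le, locAvg, locAvg, norm_mul, norm_mul,
      Complex.norm_real, Real.norm_of_nonneg (gauss_pos _ _ _).le, ← gauss_half_sq (ε ^ 2)]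
    have h2 := Complex.abs_im_le_norm (star (gaussAvg (ε⁻¹ ^ 2) u r) * gaussAvg (ε⁻¹ ^ 2) f r)
    rw [norm_mul, norm_star] at h2
    calc gauss (ε ^ 2 / 2) 0 r ^ 2 * _ ≤ gauss (ε ^ 2 / 2) 0 r ^ 2 *
          (‖gaussAvg (ε⁻¹ ^ 2) u r‖ * ‖gaussAvg (ε⁻¹ ^ 2) f r‖) := by gcongr; exact h2
      _ = _ := by ring
  · exact mul_le_mul_of_nonneg_left (sqrt_regMass_le hε hf) (Real.sqrt_nonneg _)

theorem enorm_sub_gaussAvg_le {a : ℝ} (ha : 0 < a) (u : LTwo F) (r : F) :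
    ENNReal.ofReal (gaussMass F a) * ‖u r‖ₑ ≤ ‖gaussAvg a u r‖ₑ +
      ∫⁻ x, ENNReal.ofReal (gauss a r x) * ‖u x - u r‖ₑ := by
  have hi : Integrable (fun x => (gauss a r x : ℂ) * u x) :=
    (memLp_gauss ha r).ofReal.integrable_mul (Lp.memLp u)
  have h1 : (gaussMass F a : ℂ) * u r = gaussAvg a u r -
      ∫ x, (gauss a r x : ℂ) * (u x - u r) := by
    rw [gaussAvg]
    have h3 : ∫ x, (gauss a r x : ℂ) * (u x - u r) =
        (∫ x, (gauss a r x : ℂ) * u x) - ∫ x, (gauss a r x : ℂ) * u r := by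
      refine Eq.trans ?_ (integral_sub hi ((integrable_gauss ha r).ofReal.mul_const (u r)))
      congr 1 with x
      exact mul_sub _ _ _
    rw [h3, integral_mul_const, integral_complex_ofReal, integral_gauss]
    ring
  have h4 : ENNReal.ofReal (gaussMass F a) * ‖u r‖ₑ = ‖(gaussMass F a : ℂ) * u r‖ₑ := by
    rw [enorm_mul]
    congr 1
    rw [← ofReal_norm, Complex.norm_real, Real.norm_of_nonneg (gaussMass_pos ha).le]
  rw [h4, h1]
  refine enorm_sub_le.trans ?_
  gcongr
  refine (enorm_integral_le_lintegral_enorm _).trans (le_of_eq (lintegral_congr fun x => ?_))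
  rw [enorm_mul]
  congr 1
  rw [← ofReal_norm, Complex.norm_real, Real.norm_of_nonneg (gauss_pos _ _ _).le]

/-- This is the lower bound on the regularised mass. In |u(r)|² one factor is replaced by its
normalised Gaussian average; the error is an average of |u(r)| |u(x) − u(r)|, which is an
oscillation term. -/
theorem integral_gauss_mul_sq_le {ε : ℝ} (hε : 0 < ε) (u : LTwo F) :
    ∫ r, gauss (ε ^ 2 / 2) 0 r * ‖u r‖ ^ 2 ≤
      ‖u‖ * (√(regMass ε u) / gaussMass F (ε⁻¹ ^ 2)) + ‖u‖ * oscLp ε u / gaussMass F 1 := by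
  have ha : 0 < ε⁻¹ ^ 2 := by positivity
  set Z := gaussMass F (ε⁻¹ ^ 2) with hZ
  have hZ0 : 0 < Z := gaussMass_pos ha
  have hu : Measurable u := (Lp.stronglyMeasurable u).measurable
  have hm := aestronglyMeasurable_locAvg (ε ^ 2) (ε⁻¹ ^ 2) (Lp.aestronglyMeasurable u)
  have h1 : ∀ r, ENNReal.ofReal Z * ENNReal.ofReal (gauss (ε ^ 2 / 2) 0 r * ‖u r‖ ^ 2) ≤
      ‖u r‖ₑ * ‖locAvg (ε ^ 2) (ε⁻¹ ^ 2) u r‖ₑ +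
      ∫⁻ x, ENNReal.ofReal (gauss (ε⁻¹ ^ 2 / 4) r x) * (‖u r‖ₑ * ‖u x - u r‖ₑ) := by
    intro r
    have h2 := enorm_sub_gaussAvg_le ha u r
    have hg1 : ENNReal.ofReal (gauss (ε ^ 2 / 2) 0 r) ≤ 1 :=
      ENNReal.ofReal_le_one.2 (gauss_le_one (by positivity) _ _)
    calc ENNReal.ofReal Z * ENNReal.ofReal (gauss (ε ^ 2 / 2) 0 r * ‖u r‖ ^ 2)
        = ENNReal.ofReal (gauss (ε ^ 2 / 2) 0 r) * ‖u r‖ₑ * (ENNReal.ofReal Z * ‖u r‖ₑ) := by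
          rw [ENNReal.ofReal_mul (gauss_pos _ _ _).le, ENNReal.ofReal_pow (norm_nonneg _),
            ofReal_norm]
          ring
      _ ≤ ENNReal.ofReal (gauss (ε ^ 2 / 2) 0 r) * ‖u r‖ₑ * (‖gaussAvg (ε⁻¹ ^ 2) u r‖ₑ +
          ∫⁻ x, ENNReal.ofReal (gauss (ε⁻¹ ^ 2) r x) * ‖u x - u r‖ₑ) := by gcongr
      _ = ‖u r‖ₑ * ‖locAvg (ε ^ 2) (ε⁻¹ ^ 2) u r‖ₑ + ENNReal.ofReal (gauss (ε ^ 2 / 2) 0 r) *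
          (‖u r‖ₑ * ∫⁻ x, ENNReal.ofReal (gauss (ε⁻¹ ^ 2) r x) * ‖u x - u r‖ₑ) := by
          rw [locAvg, enorm_mul, ← ofReal_norm ((gauss (ε ^ 2 / 2) 0 r : ℝ) : ℂ),
            Complex.norm_real, Real.norm_of_nonneg (gauss_pos _ _ _).le]
          ring
      _ ≤ ‖u r‖ₑ * ‖locAvg (ε ^ 2) (ε⁻¹ ^ 2) u r‖ₑ + 1 *
          (‖u r‖ₑ * ∫⁻ x, ENNReal.ofReal (gauss (ε⁻¹ ^ 2) r x) * ‖u x - u r‖ₑ) := by gcongr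
      _ ≤ _ := by
          rw [one_mul, ← lintegral_const_mul' _ _ enorm_ne_top]
          refine add_le_add le_rfl (lintegral_mono fun x => ?_)
          dsimp only
          rw [mul_left_comm]
          -- Weakening the exponent to a quarter gives the kernel that also dominates the
          -- commutator, so one oscillation bound serves both.
          refine mul_le_mul' (ENNReal.ofReal_le_ofReal ?_) le_rfl
          simp only [gauss]
          gcongr
          have : 0 ≤ ε⁻¹ ^ 2 := ha.le
          linarith
  have h2 : ENNReal.ofReal Z * ∫⁻ r, ENNReal.ofReal (gauss (ε ^ 2 / 2) 0 r * ‖u r‖ ^ 2) ≤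
      ENNReal.ofReal (‖u‖ * √(regMass ε u) + ε ^ Module.finrank ℝ F * (‖u‖ * oscLp ε u)) := by
    rw [← lintegral_const_mul' _ _ ENNReal.ofReal_ne_top]
    refine (lintegral_mono h1).trans ?_
    have hmm : AEMeasurable (fun r => ‖u r‖ₑ * ‖locAvg (ε ^ 2) (ε⁻¹ ^ 2) u r‖ₑ) volume :=
      (Lp.aestronglyMeasurable u).enorm.mul hm.enorm
    rw [lintegral_add_left' hmm]
    have hosc := oscLp_nonneg ε u
    rw [ENNReal.ofReal_add (by positivity) (by positivity)]
    refine add_le_add ?_ (lintegral_gauss_mul_diff_le hε u)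
    refine (lintegral_enorm_mul_enorm_le (Lp.aestronglyMeasurable u) hm).trans (le_of_eq ?_)
    rw [ENNReal.ofReal_mul (norm_nonneg _), sqrt_regMass ε hε (Lp.memLp u), ENNReal.ofReal_toReal
      (memLp_locAvg (by positivity) (by positivity) (Lp.memLp u)).2.ne, ofReal_norm, Lp.enorm_def]
  have hint : Integrable (fun r => gauss (ε ^ 2 / 2) 0 r * ‖u r‖ ^ 2) := by
    refine ((Lp.memLp u).norm.integrable_sq).mono'
      ((continuous_gauss_right _ _).aestronglyMeasurable.mul
        ((Lp.aestronglyMeasurable u).norm.pow 2)) (Filter.Eventually.of_forall fun r => ?_)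
    have h3 := gauss_le_one (a := ε ^ 2 / 2) (by positivity) 0 r
    have h4 := gauss_pos (ε ^ 2 / 2) 0 r
    rw [Real.norm_of_nonneg (by positivity)]
    nlinarith [sq_nonneg ‖u r‖]
  rw [← ofReal_integral_eq_lintegral_ofReal hint (Filter.Eventually.of_forall fun r =>
    mul_nonneg (gauss_pos _ _ _).le (sq_nonneg _)), ← ENNReal.ofReal_mul hZ0.le,
    ENNReal.ofReal_le_ofReal_iff (by have := oscLp_nonneg ε u; positivity)] at h2
  have h5 : Z = ε ^ Module.finrank ℝ F * gaussMass F 1 := gaussMass_inv_sq hε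
  have h6 : 0 < gaussMass F 1 := gaussMass_pos one_pos
  rw [mul_comm, ← le_div_iff₀ hZ0] at h2
  refine h2.trans (le_of_eq ?_)
  rw [add_div, mul_div_assoc]
  congr 1
  rw [h5]
  field_simp

/-- A squeeze: Young's inequality bounds the quotient above by the norm, and
`integral_gauss_mul_sq_le` divided by the norm bounds it below. -/
theorem tendsto_sqrt_regMass (u : LTwo F) :
    Filter.Tendsto (fun ε => √(regMass ε u) / gaussMass F (ε⁻¹ ^ 2)) (nhdsWithin 0 (Ioi 0))
      (nhds ‖u‖) := by
  have hnorm : ‖u‖ ^ 2 = ∫ r, ‖u r‖ ^ 2 := by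
    rw [integral_norm_sq_eq (Lp.memLp u), Lp.norm_def]
  have h1 : Filter.Tendsto (fun ε : ℝ => ∫ r, gauss (ε ^ 2 / 2) 0 r * ‖u r‖ ^ 2)
      (nhdsWithin 0 (Ioi 0)) (nhds (‖u‖ ^ 2)) := by
    rw [hnorm]
    refine tendsto_integral_filter_of_dominated_convergence (fun r => ‖u r‖ ^ 2)
      (Filter.Eventually.of_forall fun ε => ?_) (Filter.Eventually.of_forall fun ε =>
        Filter.Eventually.of_forall fun r => ?_) (Lp.memLp u).norm.integrable_sq
      (Filter.Eventually.of_forall fun r => ?_)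
    · exact (continuous_gauss_right _ _).aestronglyMeasurable.mul
        ((Lp.aestronglyMeasurable u).norm.pow 2)
    · have h3 := gauss_le_one (a := ε ^ 2 / 2) (by positivity) 0 r
      have h4 := gauss_pos (ε ^ 2 / 2) 0 r
      rw [Real.norm_of_nonneg (by positivity)]
      nlinarith [sq_nonneg ‖u r‖]
    · have : Continuous fun ε : ℝ => gauss (ε ^ 2 / 2) 0 r * ‖u r‖ ^ 2 := by
        unfold gauss; fun_prop
      have h5 := (this.tendsto 0).mono_left (nhdsWithin_le_nhds (s := Ioi (0 : ℝ)))
      simpa [gauss] using h5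
  have h2 : Filter.Tendsto (fun ε : ℝ => oscLp ε u) (nhdsWithin 0 (Ioi 0)) (nhds 0) := by
    have h := (continuous_oscLp.comp (continuous_id.prodMk
      (continuous_const (y := u)))).tendsto (0 : ℝ)
    simp only [Function.comp_def, id, oscLp_zero] at h
    exact h.mono_left nhdsWithin_le_nhds
  -- For u = 0 division by zero makes this quotient 0, which is the required limit.
  have h3 : Filter.Tendsto (fun ε : ℝ => ((∫ r, gauss (ε ^ 2 / 2) 0 r * ‖u r‖ ^ 2) -
      ‖u‖ * oscLp ε u / gaussMass F 1) / ‖u‖) (nhdsWithin 0 (Ioi 0)) (nhds ‖u‖) := by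
    have := (h1.sub ((h2.const_mul ‖u‖).div_const (gaussMass F 1))).div_const ‖u‖
    simpa [sq] using this
  refine tendsto_of_tendsto_of_tendsto_of_le_of_le' h3 tendsto_const_nhds ?_ ?_
  · filter_upwards [self_mem_nhdsWithin] with ε hε
    have hε' : 0 < ε := hε
    refine div_le_of_le_mul₀ (norm_nonneg _)
      (div_nonneg (Real.sqrt_nonneg _) (gaussMass_pos (by positivity)).le) ?_
    linarith [integral_gauss_mul_sq_le hε' u]
  · filter_upwards [self_mem_nhdsWithin] with ε hε
    have hε' : 0 < ε := hε
    rw [div_le_iff₀ (gaussMass_pos (by positivity)), mul_comm, Lp.norm_def]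
    exact sqrt_regMass_le hε' (Lp.memLp u)

end RegularisedMass

/-- A continuous potential of at most quadratic growth whose increments grow at most like those
of a quadratic polynomial. -/
structure QuadPotential {F : Type*} [NormedAddCommGroup F] (C : ℝ) (V : F → ℝ) : Prop where
  continuous : Continuous V
  bound : ∀ x, |V x| ≤ C * (1 + ‖x‖) ^ 2
  lip : ∀ x y, |V x - V y| ≤ C * (‖x - y‖ * (1 + ‖x‖ + ‖y‖))

theorem QuadPotential.nonneg {F : Type*} [NormedAddCommGroup F] {C : ℝ} {V : F → ℝ}
    (h : QuadPotential C V) : 0 ≤ C := by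
  have := (abs_nonneg _).trans (h.bound 0)
  simpa using this

/-! ### The commutator of the Hamiltonian with Gaussian regularisation. -/

section Commutator

theorem one_add_norm_sub_sq_le {F : Type*} [NormedAddCommGroup F] (x r : F) :
    ‖x - r‖ ^ 2 ≤ (1 + ‖x‖) ^ 2 * (1 + ‖r‖) ^ 2 := by
  rw [← mul_pow]
  gcongr
  refine (norm_sub_le _ _).trans ?_
  nlinarith [norm_nonneg x, norm_nonneg r]

/-- Completing the square twice: the two Gaussians at x and y combine around the midpoint, and the
weight at the origin then pulls the centre towards 0 by the factor 2a/(2a+b). -/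
theorem gauss_mul_gauss_mul_gauss {F : Type*} [NormedAddCommGroup F]
    [InnerProductSpace ℝ F] {a b : ℝ} (ha : 0 < a) (hb : 0 < b) (x y r : F) :
    gauss b 0 r * (gauss a r x * gauss a r y) =
      Real.exp (-(a / 2) * ‖x - y‖ ^ 2 - (2 * a * b / (2 * a + b)) * ‖(1 / 2 : ℝ) • (x + y)‖ ^ 2) *
        gauss (2 * a + b) ((2 * a / (2 * a + b)) • (1 / 2 : ℝ) • (x + y)) r := by
  simp only [gauss, ← Real.exp_add]
  congr 1
  have h : ∀ z : F, ‖z‖ ^ 2 = inner ℝ z z := fun z => (real_inner_self_eq_norm_sq z).symm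
  simp only [h, inner_sub_left, inner_sub_right, inner_add_left, inner_add_right, inner_smul_left,
    inner_smul_right, inner_zero_left, inner_zero_right, real_inner_comm x y, real_inner_comm x r,
    real_inner_comm y r]
  simp
  have : 2 * a + b ≠ 0 := by positivity
  field_simp
  ring

/-- `-½ Δ` applied to `gauss a r` equals `kin a r * gauss a r`. -/
noncomputable def kin {F : Type*} [NormedAddCommGroup F] [InnerProductSpace ℝ F]
    (a : ℝ) (r x : F) : ℝ :=
  a * Module.finrank ℝ F - 2 * a ^ 2 * ‖x - r‖ ^ 2

theorem continuous_kin {F : Type*} [NormedAddCommGroup F] [InnerProductSpace ℝ F]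
    (a : ℝ) : Continuous fun p : F × F => kin a p.1 p.2 := by
  unfold kin; fun_prop

/-- The difference is affine in r. The free point z will be the centre of the Gaussian in r, so that
the second term is odd about it and integrates to zero. -/
theorem kin_sub_kin {F : Type*} [NormedAddCommGroup F] [InnerProductSpace ℝ F]
    (a : ℝ) (x y r z : F) :
    kin a r x - kin a r y = -(4 * a ^ 2) * inner ℝ (x - y) ((1 / 2 : ℝ) • (x + y) - z) +
      4 * a ^ 2 * inner ℝ (x - y) (r - z) := by
  have h : ∀ z : F, ‖z‖ ^ 2 = inner ℝ z z := fun z => (real_inner_self_eq_norm_sq z).symm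
  simp only [kin, h, inner_sub_left, inner_sub_right, inner_add_right,
    inner_smul_right, real_inner_comm x y, real_inner_comm x r,
    real_inner_comm y r]
  ring


variable {F : Type*} [NormedAddCommGroup F] [InnerProductSpace ℝ F] [FiniteDimensional ℝ F]

theorem abs_kin_add_le {a C : ℝ} (ha : 0 ≤ a) {V : F → ℝ} (hV : QuadPotential C V) (r x : F) :
    |kin a r x + V x| ≤
      (a * Module.finrank ℝ F + 2 * a ^ 2 + C) * ((1 + ‖r‖) ^ 2 * (1 + ‖x‖) ^ 2) := by
  have h1 := hV.bound x
  have h2 := one_add_norm_sub_sq_le x r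
  have hC := hV.nonneg
  have h3 : (1 : ℝ) ≤ (1 + ‖r‖) ^ 2 := one_le_pow₀ (by linarith [norm_nonneg r])
  have h4 : (1 : ℝ) ≤ (1 + ‖x‖) ^ 2 := one_le_pow₀ (by linarith [norm_nonneg x])
  have h5 : |kin a r x| ≤ a * Module.finrank ℝ F + 2 * a ^ 2 * ‖x - r‖ ^ 2 := by
    rw [kin]
    refine (abs_sub _ _).trans (le_of_eq ?_)
    rw [abs_of_nonneg (by positivity), abs_of_nonneg (by positivity)]
  refine (abs_add_le _ _).trans ?_
  have h6 : a * Module.finrank ℝ F ≤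
      a * Module.finrank ℝ F * ((1 + ‖r‖) ^ 2 * (1 + ‖x‖) ^ 2) :=
    le_mul_of_one_le_right (by positivity) (one_le_mul_of_one_le_of_one_le h3 h4)
  have h7 : 2 * a ^ 2 * ‖x - r‖ ^ 2 ≤ 2 * a ^ 2 * ((1 + ‖r‖) ^ 2 * (1 + ‖x‖) ^ 2) := by
    rw [mul_comm ((1 + ‖r‖) ^ 2)]
    gcongr
  have h8 : C * (1 + ‖x‖) ^ 2 ≤ C * ((1 + ‖r‖) ^ 2 * (1 + ‖x‖) ^ 2) := by
    gcongr
    exact le_mul_of_one_le_left (by positivity) h3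
  linarith

variable [MeasurableSpace F] [BorelSpace F]

/-- The pairing of `(-½ Δ + V) (gauss a r)` with `u`. -/
noncomputable def hamAvg (a : ℝ) (V : F → ℝ) (u : F → ℂ) (r : F) : ℂ :=
  ∫ x, ((gauss a r x * (kin a r x + V x) : ℝ) : ℂ) * u x

theorem exists_integrable_gauss_mul_bound {a : ℝ} (ha : 0 < a) :
    ∃ D : ℝ, 0 ≤ D ∧ ∀ (c : ℝ) (Q : F → ℝ) (r : F) (u : LTwo F) (f : F → ℂ), 0 ≤ c →
      Continuous Q → AEStronglyMeasurable f volume → (∀ᵐ x, ‖f x‖ ≤ ‖u x‖) →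
      (∀ x, |Q x| ≤ c * ((1 + ‖r‖) ^ 2 * (1 + ‖x‖) ^ 2)) →
      Integrable (fun x => ((gauss a r x * Q x : ℝ) : ℂ) * f x) ∧
      ∫ x, ‖((gauss a r x * Q x : ℝ) : ℂ) * f x‖ ≤ c * D * (1 + ‖r‖) ^ 4 * ‖u‖ := by
  obtain ⟨D, hD0, hD⟩ := exists_integral_weight_gauss_le (F := F) a ha 2
  refine ⟨D, hD0, fun c Q r u f hc hQ hf hfu hb => ?_⟩
  obtain ⟨hi, hle⟩ := hD r u
  have hpt : ∀ᵐ x, ‖((gauss a r x * Q x : ℝ) : ℂ) * f x‖ ≤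
      c * (1 + ‖r‖) ^ 2 * ((1 + ‖x‖) ^ 2 * gauss a r x * ‖u x‖) := by
    filter_upwards [hfu] with x hx
    have hg := (gauss_pos a r x).le
    rw [norm_mul, Complex.norm_real, norm_mul, Real.norm_of_nonneg hg, Real.norm_eq_abs]
    calc gauss a r x * |Q x| * ‖f x‖
        ≤ gauss a r x * (c * ((1 + ‖r‖) ^ 2 * (1 + ‖x‖) ^ 2)) * ‖u x‖ := by
          gcongr
          exact hb x
      _ = _ := by ring
  have h1 : Integrable (fun x => ((gauss a r x * Q x : ℝ) : ℂ) * f x) :=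
    (hi.const_mul (c * (1 + ‖r‖) ^ 2)).mono'
      ((Complex.continuous_ofReal.comp
        ((continuous_gauss_right a r).mul hQ)).aestronglyMeasurable.mul hf) hpt
  refine ⟨h1, (integral_mono_ae h1.norm (hi.const_mul _) hpt).trans ?_⟩
  rw [integral_const_mul]
  calc c * (1 + ‖r‖) ^ 2 * _ ≤ c * (1 + ‖r‖) ^ 2 * (D * (1 + ‖r‖) ^ 2 * ‖u‖) := by gcongr
    _ = _ := by ring

/-- Subtracting the complex conjugate gives twice the imaginary part. As double integrals, the two
terms differ by moving the Hamiltonian factor from one variable to the other, so only the difference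
of kin + V at two points remains. -/
theorem im_star_gaussAvg_mul_hamAvg {a : ℝ} (ha : 0 < a) {C : ℝ} {V : F → ℝ}
    (hV : QuadPotential C V) (u : LTwo F) (r : F) :
    (star (gaussAvg a u r) * hamAvg a V u r).im =
      1 / 2 * ∫ p : F × F, gauss a r p.1 * gauss a r p.2 *
        ((kin a r p.1 + V p.1) - (kin a r p.2 + V p.2)) * (star (u p.2) * u p.1).im := by
  obtain ⟨D, hD0, hD⟩ := exists_integrable_gauss_mul_bound (F := F) ha
  have hC := hV.nonneg
  have hQ : Continuous fun x => kin a r x + V x :=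
    ((continuous_kin a).comp (continuous_const.prodMk continuous_id)).add hV.continuous
  have hu := Lp.aestronglyMeasurable u
  have hi1 := (hD _ _ r u u (by positivity) hQ hu (Filter.Eventually.of_forall fun _ => le_rfl)
    (abs_kin_add_le ha.le hV r)).1
  have hi2 : Integrable (fun x => (gauss a r x : ℂ) * u x) :=
    (memLp_gauss ha r).ofReal.integrable_mul (Lp.memLp u)
  have hstar : ∀ {f : F → ℂ}, Integrable f → Integrable (fun x => star (f x)) := fun hf =>
    Complex.conjCLE.toContinuousLinearMap.integrable_comp hf
  have e1 : star (gaussAvg a u r) * hamAvg a V u r = ∫ p : F × F,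
      (((gauss a r p.1 * (kin a r p.1 + V p.1) : ℝ) : ℂ) * u p.1) *
        star ((gauss a r p.2 : ℂ) * u p.2) := by
    rw [mul_comm, gaussAvg, hamAvg]
    simp only [RCLike.star_def]
    rw [← integral_conj]
    exact (integral_prod_mul (μ := (volume : Measure F)) (ν := (volume : Measure F)) _ _).symm
  have e2 : gaussAvg a u r * star (hamAvg a V u r) = ∫ p : F × F,
      ((gauss a r p.1 : ℂ) * u p.1) *
        star (((gauss a r p.2 * (kin a r p.2 + V p.2) : ℝ) : ℂ) * u p.2) := by
    rw [gaussAvg, hamAvg]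
    simp only [RCLike.star_def]
    rw [← integral_conj]
    exact (integral_prod_mul (μ := (volume : Measure F)) (ν := (volume : Measure F)) _ _).symm
  have e3 : (star (gaussAvg a u r) * hamAvg a V u r).im = 1 / 2 *
      (star (gaussAvg a u r) * hamAvg a V u r - gaussAvg a u r * star (hamAvg a V u r)).im := by
    simp
    ring
  have i1 := hi1.mul_prod (hstar hi2)
  have i2 := hi2.mul_prod (hstar hi1)
  rw [e3, e1, e2]
  congr 1
  refine (congrArg Complex.im (integral_sub i1 i2)).symm.trans ?_
  refine (integral_im (i1.sub i2)).symm.trans ?_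
  refine integral_congr_ae (Filter.Eventually.of_forall fun p => ?_)
  dsimp only
  simp
  ring

theorem inner_integral_gauss_eq_zero (c : ℝ) (z s : F) :
    ∫ r, gauss c z r * inner ℝ s (r - z) = 0 := by
  have h1 : ∫ r, gauss c z r * inner ℝ s (r - z) = ∫ r, gauss c 0 r * inner ℝ s r := by
    rw [← integral_sub_right_eq_self (fun r => gauss c 0 r * inner ℝ s r) z]
    simp [gauss]
  have h2 := integral_neg_eq_self (fun r => gauss c 0 r * inner ℝ s r) (volume : Measure F)
  have h3 : ∀ r : F, gauss c 0 (-r) * inner ℝ s (-r) = -(gauss c 0 r * inner ℝ s r) := by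
    intro r; simp [gauss]
  simp_rw [h3, integral_neg] at h2
  rw [h1]
  linarith

/-- In r the three Gaussians form one Gaussian centred at l • m, and the part linear in r − l • m
drops out by symmetry. Without the weight the kinetic part would cancel completely; the displacement
of the centre from m leaves the small factor b/(2a+b). -/
theorem integral_gauss_kernel {a b : ℝ} (ha : 0 < a) (hb : 0 < b) (V : F → ℝ) (x y : F) :
    ∫ r, gauss b 0 r * (gauss a r x * gauss a r y *
        ((kin a r x + V x) - (kin a r y + V y))) =
      Real.exp (-(a / 2) * ‖x - y‖ ^ 2 -
          (2 * a * b / (2 * a + b)) * ‖(1 / 2 : ℝ) • (x + y)‖ ^ 2) * gaussMass F (2 * a + b) *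
        (-(2 * a * (2 * a * b / (2 * a + b))) * inner ℝ (x - y) ((1 / 2 : ℝ) • (x + y)) +
          (V x - V y)) := by
  have hab : 0 < 2 * a + b := by positivity
  set m : F := (1 / 2 : ℝ) • (x + y) with hm
  set l : ℝ := 2 * a / (2 * a + b) with hl
  set e := Real.exp (-(a / 2) * ‖x - y‖ ^ 2 - (2 * a * b / (2 * a + b)) * ‖m‖ ^ 2)
  set A : ℝ := -(2 * a * (2 * a * b / (2 * a + b))) * inner ℝ (x - y) m + (V x - V y) with hA
  have h1 : ∀ r, gauss b 0 r * (gauss a r x * gauss a r y *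
        ((kin a r x + V x) - (kin a r y + V y))) =
      e * A * gauss (2 * a + b) (l • m) r +
        e * (4 * a ^ 2) * (gauss (2 * a + b) (l • m) r * inner ℝ (x - y) (r - l • m)) := by
    intro r
    have hk := kin_sub_kin a x y r (l • m)
    rw [← hm] at hk
    have hml : inner ℝ (x - y) (m - l • m) = (b / (2 * a + b)) * inner ℝ (x - y) m := by
      rw [inner_sub_right, real_inner_smul_right (x - y) m l, hl]
      field_simp
      ring
    rw [hml] at hk
    have h2 : (kin a r x + V x) - (kin a r y + V y) =
        A + 4 * a ^ 2 * inner ℝ (x - y) (r - l • m) := by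
      rw [hA, add_sub_add_comm, hk]
      field_simp
      ring
    rw [h2, ← mul_assoc, gauss_mul_gauss_mul_gauss ha hb]
    ring
  simp_rw [h1]
  have hi : Integrable fun r => gauss (2 * a + b) (l • m) r * inner ℝ (x - y) (r - l • m) := by
    refine ((integrable_weight_gauss hab 1 (l • m)).const_mul (‖x - y‖ * (1 + ‖l • m‖))).mono'
      (Continuous.aestronglyMeasurable ((continuous_gauss_right _ _).mul (by fun_prop)))
      (Filter.Eventually.of_forall fun r => ?_)
    have hg := (gauss_pos (2 * a + b) (l • m) r).le
    rw [norm_mul, Real.norm_of_nonneg hg]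
    have h3 : ‖inner ℝ (x - y) (r - l • m)‖ ≤ ‖x - y‖ * ((1 + ‖l • m‖) * (1 + ‖r‖)) := by
      refine (norm_inner_le_norm _ _).trans ?_
      gcongr
      refine (norm_sub_le _ _).trans ?_
      nlinarith [norm_nonneg r, norm_nonneg (l • m)]
    calc _ ≤ gauss (2 * a + b) (l • m) r * (‖x - y‖ * ((1 + ‖l • m‖) * (1 + ‖r‖))) := by gcongr
      _ = _ := by ring
  rw [integral_add ((integrable_gauss hab _).const_mul _) (hi.const_mul _), integral_const_mul,
    integral_const_mul, inner_integral_gauss_eq_zero, integral_gauss]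
  ring

/-- The scales are tied by ab = 1. Then aγ ≤ 1 bounds the kinetic coefficient, while γ ≥ 2/(3a)
leaves enough decay in the midpoint to absorb the linear growth of the increments of V and of the
drift. -/
theorem abs_gauss_kernel_le {ε : ℝ} (hε : 0 < ε) (hε1 : ε ≤ 1) {C : ℝ} {V : F → ℝ}
    (hV : QuadPotential C V) (x y : F) :
    |∫ r, gauss (ε ^ 2) 0 r * (gauss (ε⁻¹ ^ 2) r x * gauss (ε⁻¹ ^ 2) r y *
        ((kin (ε⁻¹ ^ 2) r x + V x) - (kin (ε⁻¹ ^ 2) r y + V y)))| ≤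
      (4 + 9 * C) * gaussMass F (ε⁻¹ ^ 2) * gauss (ε⁻¹ ^ 2 / 4) y x := by
  have hb : 0 < ε ^ 2 := by positivity
  have ha : 0 < ε⁻¹ ^ 2 := by positivity
  rw [integral_gauss_kernel ha hb]
  have hab1 : ε⁻¹ ^ 2 * ε ^ 2 = 1 := by field_simp
  have ha1 : 1 ≤ ε⁻¹ ^ 2 := one_le_pow₀ ((one_le_inv₀ hε).2 hε1)
  have hb1 : ε ^ 2 ≤ 1 := pow_le_one₀ hε.le hε1
  set a := ε⁻¹ ^ 2
  set b := ε ^ 2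
  set γ := 2 * a * b / (2 * a + b) with hγ
  have hγ2 : γ = 2 / (2 * a + b) := by rw [hγ, mul_assoc, hab1, mul_one]
  have hγ3 : a * γ ≤ 1 := by
    rw [hγ2, ← mul_div_assoc, div_le_one (by positivity)]; linarith
  have hγ4 : 2 / (3 * a) ≤ γ := by
    rw [hγ2]
    gcongr
    linarith
  have hγ0 : 0 < γ := by rw [hγ2]; positivity
  set m : F := (1 / 2 : ℝ) • (x + y) with hm
  have hC := hV.nonneg
  have hx : ‖x‖ ≤ ‖m‖ + ‖x - y‖ / 2 := by
    have : x = m + (1 / 2 : ℝ) • (x - y) := by rw [hm]; module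
    calc ‖x‖ = ‖m + (1 / 2 : ℝ) • (x - y)‖ := by rw [← this]
      _ ≤ _ := by
        refine (norm_add_le _ _).trans (le_of_eq ?_)
        rw [norm_smul (1 / 2 : ℝ) (x - y), Real.norm_of_nonneg (by norm_num)]; ring
  have hy : ‖y‖ ≤ ‖m‖ + ‖x - y‖ / 2 := by
    have : y = m - (1 / 2 : ℝ) • (x - y) := by rw [hm]; module
    calc ‖y‖ = ‖m - (1 / 2 : ℝ) • (x - y)‖ := by rw [← this]
      _ ≤ _ := by
        refine (norm_sub_le _ _).trans (le_of_eq ?_)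
        rw [norm_smul (1 / 2 : ℝ) (x - y), Real.norm_of_nonneg (by norm_num)]; ring
  set s := ‖x - y‖ with hs
  set μ := ‖m‖ with hμ
  have hs0 : 0 ≤ s := norm_nonneg _
  have hμ0 : 0 ≤ μ := norm_nonneg _
  -- X is half of the decay in x − y and Y all of the decay in the midpoint. Spending X + Y on
  -- polynomial factors leaves the Gaussian of exponent a/4.
  set X := a * s ^ 2 / 4 with hX
  set Y := γ * μ ^ 2 with hY
  have hX0 : 0 ≤ X := by positivity
  have hY0 : 0 ≤ Y := by positivity
  have hsX : s ^ 2 ≤ 4 * X := by rw [hX]; nlinarith [sq_nonneg s]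
  have e1 : s * μ ≤ 2 * Real.exp (X + Y) := by
    have h1 : X + Y ≤ Real.exp (X + Y) := by linarith [Real.add_one_le_exp (X + Y)]
    have h2 : s * μ ≤ 2 * (X + Y) := by
      have h3 : 2 / (3 * a) * μ ^ 2 ≤ Y := by rw [hY]; gcongr
      have h4 : 2 * (X + 2 / (3 * a) * μ ^ 2) - s * μ =
          ((a * s - μ) ^ 2 + 5 / 3 * μ ^ 2) / (2 * a) := by
        rw [hX]; field_simp; ring
      have h5 : 0 ≤ ((a * s - μ) ^ 2 + 5 / 3 * μ ^ 2) / (2 * a) := by positivity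
      linarith
    linarith
  have e2 : s ≤ Real.exp (X + Y) := by
    have h1 := Real.add_one_le_exp (X + Y)
    nlinarith [sq_nonneg (s / 2 - 1)]
  have e3 : s ^ 2 ≤ 4 * Real.exp (X + Y) := by
    have h1 := Real.add_one_le_exp (X + Y)
    linarith
  have hJ : |-(2 * a * γ) * inner ℝ (x - y) m + (V x - V y)| ≤
      (4 + 9 * C) * Real.exp (X + Y) := by
    refine (abs_add_le _ _).trans ?_
    have h1 : |-(2 * a * γ) * inner ℝ (x - y) m| ≤ 4 * Real.exp (X + Y) := by
      rw [abs_mul, abs_neg, abs_of_nonneg (by positivity)]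
      calc 2 * a * γ * |inner ℝ (x - y) m| ≤ 2 * (s * μ) := by
            have := abs_real_inner_le_norm (x - y) m
            have h0 : 2 * a * γ ≤ 2 := by linarith
            calc _ ≤ 2 * |inner ℝ (x - y) m| := by gcongr
              _ ≤ _ := by gcongr
        _ ≤ _ := by linarith
    have h2 : |V x - V y| ≤ C * (9 * Real.exp (X + Y)) := by
      refine (hV.lip x y).trans (mul_le_mul_of_nonneg_left ?_ hC)
      have : s * (1 + ‖x‖ + ‖y‖) ≤ s * (1 + 2 * μ + s) := by
        exact mul_le_mul_of_nonneg_left (by linarith) hs0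
      refine this.trans ?_
      -- With `e2`, `e1` and `e3` the three terms cost 1, 2 · 2 and 4 exponentials, whence the 9.
      have h9 : s * (1 + 2 * μ + s) = s + 2 * (s * μ) + s ^ 2 := by ring
      linarith
    linarith
  rw [abs_mul, abs_of_nonneg (mul_nonneg (Real.exp_pos _).le (gaussMass_pos (by positivity)).le)]
  have hK : gaussMass F (2 * a + b) ≤ gaussMass F a := gaussMass_anti ha (by linarith)
  have hK0 : 0 < gaussMass F (2 * a + b) := gaussMass_pos (by positivity)
  have hexp : Real.exp (-(a / 2) * s ^ 2 - γ * μ ^ 2) * Real.exp (X + Y) = gauss (a / 4) y x := by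
    rw [gauss, ← Real.exp_add, ← hs]
    congr 1
    rw [hX, hY]
    ring
  calc Real.exp (-(a / 2) * s ^ 2 - γ * μ ^ 2) * gaussMass F (2 * a + b) * _
      ≤ Real.exp (-(a / 2) * s ^ 2 - γ * μ ^ 2) * gaussMass F a *
        ((4 + 9 * C) * Real.exp (X + Y)) := by
        have := hK0.le.trans hK
        gcongr
    _ = (4 + 9 * C) * gaussMass F a *
        (Real.exp (-(a / 2) * s ^ 2 - γ * μ ^ 2) * Real.exp (X + Y)) := by ring
    _ = _ := by rw [hexp]

theorem integrable_commutator_kernel {a b : ℝ} (ha : 0 < a) (hb : 0 < b) {C : ℝ} {V : F → ℝ}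
    (hV : QuadPotential C V) (u : LTwo F) :
    Integrable (Function.uncurry fun (r : F) (p : F × F) =>
      gauss b 0 r * (gauss a r p.1 * gauss a r p.2 *
        ((kin a r p.1 + V p.1) - (kin a r p.2 + V p.2))) * (star (u p.2) * u p.1).im)
      (volume.prod (volume.prod volume)) := by
  obtain ⟨D, hD0, hD⟩ := exists_integral_weight_gauss_le (F := F) a ha 2
  have hC := hV.nonneg
  set c := a * Module.finrank ℝ F + 2 * a ^ 2 + C with hc
  have hc0 : 0 ≤ c := by positivity
  have hu : Measurable u := (Lp.stronglyMeasurable u).measurable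
  have hker : Continuous fun q : F × (F × F) => gauss b 0 q.1 * (gauss a q.1 q.2.1 *
      gauss a q.1 q.2.2 * ((kin a q.1 q.2.1 + V q.2.1) - (kin a q.1 q.2.2 + V q.2.2))) := by
    have hV1 := hV.continuous
    unfold gauss kin
    fun_prop
  have hmeas : AEStronglyMeasurable (Function.uncurry fun (r : F) (p : F × F) =>
      gauss b 0 r * (gauss a r p.1 * gauss a r p.2 *
        ((kin a r p.1 + V p.1) - (kin a r p.2 + V p.2))) * (star (u p.2) * u p.1).im)
      (volume.prod (volume.prod volume)) := by
    refine hker.aestronglyMeasurable.mul (Measurable.aestronglyMeasurable ?_)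
    refine Complex.measurable_im.comp (Measurable.mul ?_ ?_)
    · exact continuous_star.measurable.comp (hu.comp (measurable_snd.comp measurable_snd))
    · exact hu.comp (measurable_fst.comp measurable_snd)
  have hpt : ∀ (r : F) (p : F × F), ‖gauss b 0 r * (gauss a r p.1 * gauss a r p.2 *
        ((kin a r p.1 + V p.1) - (kin a r p.2 + V p.2))) * (star (u p.2) * u p.1).im‖ ≤
      2 * c * ((1 + ‖r‖) ^ 2 * gauss b 0 r) * (((1 + ‖p.1‖) ^ 2 * gauss a r p.1 * ‖u p.1‖) *
        ((1 + ‖p.2‖) ^ 2 * gauss a r p.2 * ‖u p.2‖)) := by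
    rintro r ⟨x, y⟩
    have h1 := abs_kin_add_le ha.le hV r x
    have h2 := abs_kin_add_le ha.le hV r y
    have h3 : (1 : ℝ) ≤ (1 + ‖y‖) ^ 2 := one_le_pow₀ (by linarith [norm_nonneg y])
    have h4 : (1 : ℝ) ≤ (1 + ‖x‖) ^ 2 := one_le_pow₀ (by linarith [norm_nonneg x])
    have h5 : |(kin a r x + V x) - (kin a r y + V y)| ≤
        2 * c * ((1 + ‖r‖) ^ 2 * ((1 + ‖x‖) ^ 2 * (1 + ‖y‖) ^ 2)) := by
      refine (abs_sub _ _).trans ?_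
      have h6 : c * ((1 + ‖r‖) ^ 2 * (1 + ‖x‖) ^ 2) ≤
          c * ((1 + ‖r‖) ^ 2 * ((1 + ‖x‖) ^ 2 * (1 + ‖y‖) ^ 2)) := by
        gcongr
        exact le_mul_of_one_le_right (by positivity) h3
      have h7 : c * ((1 + ‖r‖) ^ 2 * (1 + ‖y‖) ^ 2) ≤
          c * ((1 + ‖r‖) ^ 2 * ((1 + ‖x‖) ^ 2 * (1 + ‖y‖) ^ 2)) := by
        gcongr
        exact le_mul_of_one_le_left (by positivity) h4
      linarith
    have h8 : |(star (u y) * u x).im| ≤ ‖u y‖ * ‖u x‖ := by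
      refine (Complex.abs_im_le_norm _).trans ?_
      rw [norm_mul, norm_star]
    have g1 := gauss_pos b 0 r
    have g2 := gauss_pos a r x
    have g3 := gauss_pos a r y
    simp only [norm_mul, Real.norm_eq_abs, abs_of_pos g1, abs_of_pos g2, abs_of_pos g3]
    calc _ ≤ gauss b 0 r * (gauss a r x * gauss a r y *
          (2 * c * ((1 + ‖r‖) ^ 2 * ((1 + ‖x‖) ^ 2 * (1 + ‖y‖) ^ 2)))) * (‖u y‖ * ‖u x‖) := by
          gcongr
      _ = _ := by ring
  rw [integrable_prod_iff hmeas]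
  have hmeas2 := fun r : F => (hker.comp (Continuous.prodMk_right r)).aestronglyMeasurable.mul
    (Measurable.aestronglyMeasurable (μ := (volume : Measure F).prod (volume : Measure F))
    (f := fun p : F × F => (star (u p.2) * u p.1).im) (Complex.measurable_im.comp
      ((continuous_star.measurable.comp (hu.comp measurable_snd)).mul (hu.comp measurable_fst))))
  have hint : ∀ r : F, Integrable (fun p : F × F => 2 * c * ((1 + ‖r‖) ^ 2 * gauss b 0 r) *
      (((1 + ‖p.1‖) ^ 2 * gauss a r p.1 * ‖u p.1‖) *
        ((1 + ‖p.2‖) ^ 2 * gauss a r p.2 * ‖u p.2‖))) (volume.prod volume) := fun r =>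
    ((hD r u).1.mul_prod (hD r u).1).const_mul _
  have hint2 : ∀ r : F, Integrable (fun p : F × F => gauss b 0 r * (gauss a r p.1 * gauss a r p.2 *
        ((kin a r p.1 + V p.1) - (kin a r p.2 + V p.2))) * (star (u p.2) * u p.1).im)
        (volume.prod volume) := fun r =>
    (hint r).mono' (hmeas2 r) (Filter.Eventually.of_forall (hpt r))
  refine ⟨Filter.Eventually.of_forall hint2, ?_⟩
  -- Power 6: two from the bound on kin + V and two from each of the two weighted pairings with u.
  refine ((integrable_weight_gauss hb 6 (0 : F)).const_mul (2 * c * (D * ‖u‖) ^ 2)).mono'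
    hmeas.norm.integral_prod_right' (Filter.Eventually.of_forall fun r => ?_)
  rw [Real.norm_of_nonneg (integral_nonneg fun _ => norm_nonneg _)]
  refine (integral_mono (hint2 r).norm (hint r) (hpt r)).trans ?_
  rw [integral_const_mul]
  have e := integral_prod_mul (μ := (volume : Measure F)) (ν := (volume : Measure F))
    (fun x => (1 + ‖x‖) ^ 2 * gauss a r x * ‖u x‖) (fun x => (1 + ‖x‖) ^ 2 * gauss a r x * ‖u x‖)
  rw [e]
  have hn : 0 ≤ ∫ x, (1 + ‖x‖) ^ 2 * gauss a r x * ‖u x‖ := integral_nonneg fun x => by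
    have := (gauss_pos a r x).le
    positivity
  have g1 := (gauss_pos b 0 r).le
  calc 2 * c * ((1 + ‖r‖) ^ 2 * gauss b 0 r) * (_ * _)
      ≤ 2 * c * ((1 + ‖r‖) ^ 2 * gauss b 0 r) *
        ((D * (1 + ‖r‖) ^ 2 * ‖u‖) * (D * (1 + ‖r‖) ^ 2 * ‖u‖)) := by
        have := (hD r u).2
        gcongr
    _ = _ := by ring

/-- Integrating over the centre first produces the explicit kernel, which is bounded by a Gaussian
of width comparable to ε. One factor of the squared mass comes from that kernel bound, the other
from the Jacobian in the oscillation estimate, so after normalisation the bound is a constant times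
the modulus of continuity. -/
theorem abs_integral_commutator_le {ε : ℝ} (hε : 0 < ε) (hε1 : ε ≤ 1) {C : ℝ} {V : F → ℝ}
    (hV : QuadPotential C V) (u : LTwo F) :
    |∫ r, gauss (ε ^ 2) 0 r *
        (star (gaussAvg (ε⁻¹ ^ 2) u r) * hamAvg (ε⁻¹ ^ 2) V u r).im| ≤
      (4 + 9 * C) / gaussMass F 1 * gaussMass F (ε⁻¹ ^ 2) ^ 2 * (‖u‖ * oscLp ε u) := by
  have hb : 0 < ε ^ 2 := by positivity
  have ha : 0 < ε⁻¹ ^ 2 := by positivity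
  have hC := hV.nonneg
  have hosc := oscLp_nonneg ε u
  have hZ : 0 < gaussMass F (ε⁻¹ ^ 2) := gaussMass_pos ha
  have hZ1 : 0 < gaussMass F 1 := gaussMass_pos one_pos
  have hu : Measurable u := (Lp.stronglyMeasurable u).measurable
  have hswap := integral_integral_swap (integrable_commutator_kernel ha hb hV u)
  have e1 : ∫ r, gauss (ε ^ 2) 0 r *
        (star (gaussAvg (ε⁻¹ ^ 2) u r) * hamAvg (ε⁻¹ ^ 2) V u r).im =
      1 / 2 * ∫ p : F × F, (∫ r, gauss (ε ^ 2) 0 r * (gauss (ε⁻¹ ^ 2) r p.1 *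
        gauss (ε⁻¹ ^ 2) r p.2 * ((kin (ε⁻¹ ^ 2) r p.1 + V p.1) -
          (kin (ε⁻¹ ^ 2) r p.2 + V p.2)))) * (star (u p.2) * u p.1).im := by
    simp_rw [← integral_mul_const]
    refine Eq.trans ?_ (congrArg (1 / 2 * ·) hswap)
    rw [← integral_const_mul]
    congr 1 with r
    rw [im_star_gaussAvg_mul_hamAvg ha hV, mul_left_comm, ← integral_const_mul]
    congr 2 with p
    ring
  rw [e1, abs_mul, abs_of_pos (by norm_num : (0 : ℝ) < 1 / 2)]
  set M := (4 + 9 * C) * gaussMass F (ε⁻¹ ^ 2) with hM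
  have hM0 : 0 ≤ M := by positivity
  have e2 : ENNReal.ofReal |∫ p : F × F, (∫ r, gauss (ε ^ 2) 0 r * (gauss (ε⁻¹ ^ 2) r p.1 *
        gauss (ε⁻¹ ^ 2) r p.2 * ((kin (ε⁻¹ ^ 2) r p.1 + V p.1) -
          (kin (ε⁻¹ ^ 2) r p.2 + V p.2)))) * (star (u p.2) * u p.1).im| ≤
      ENNReal.ofReal (M * (ε ^ Module.finrank ℝ F * (‖u‖ * oscLp ε u))) := by
    rw [← Real.norm_eq_abs, ofReal_norm]
    refine (enorm_integral_le_lintegral_enorm _).trans ?_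
    calc _ ≤ ∫⁻ p : F × F, ENNReal.ofReal M * (ENNReal.ofReal (gauss (ε⁻¹ ^ 2 / 4) p.2 p.1) *
          (‖u p.2‖ₑ * ‖u p.1 - u p.2‖ₑ)) := by
          refine lintegral_mono fun p => ?_
          rw [enorm_mul, ← mul_assoc, ← ENNReal.ofReal_mul hM0]
          refine mul_le_mul' ?_ ?_
          · rw [← ofReal_norm, Real.norm_eq_abs]
            exact ENNReal.ofReal_le_ofReal (abs_gauss_kernel_le hε hε1 hV p.1 p.2)
          -- The subtracted |u(y)|² is real; this is where smallness enters.
          · have h1 : (star (u p.2) * u p.1).im = (star (u p.2) * (u p.1 - u p.2)).im := by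
              simp
              ring
            rw [h1, ← ofReal_norm, ← ofReal_norm, ← ofReal_norm, ← ENNReal.ofReal_mul
              (norm_nonneg _)]
            refine ENNReal.ofReal_le_ofReal ((Complex.abs_im_le_norm _).trans ?_)
            rw [norm_mul, norm_star]
      _ = ENNReal.ofReal M * ∫⁻ y, ∫⁻ x, ENNReal.ofReal (gauss (ε⁻¹ ^ 2 / 4) y x) *
          (‖u y‖ₑ * ‖u x - u y‖ₑ) := by
          rw [lintegral_const_mul' _ _ ENNReal.ofReal_ne_top]
          congr 1
          refine lintegral_prod_symm _ (Measurable.aemeasurable ?_)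
          exact Measurable.mul
            ((continuous_gauss (ε⁻¹ ^ 2 / 4)).comp continuous_swap).measurable.ennreal_ofReal
            ((hu.comp measurable_snd).enorm.mul
              ((hu.comp measurable_fst).sub (hu.comp measurable_snd)).enorm)
      _ ≤ _ := by
          rw [ENNReal.ofReal_mul hM0]
          gcongr
          exact lintegral_gauss_mul_diff_le hε u
  rw [ENNReal.ofReal_le_ofReal_iff (by positivity)] at e2
  have h5 : ε ^ Module.finrank ℝ F = gaussMass F (ε⁻¹ ^ 2) / gaussMass F 1 := by
    rw [gaussMass_inv_sq hε]
    field_simp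
  rw [h5] at e2
  have h6 : M * (gaussMass F (ε⁻¹ ^ 2) / gaussMass F 1 * (‖u‖ * oscLp ε u)) =
      (4 + 9 * C) / gaussMass F 1 * gaussMass F (ε⁻¹ ^ 2) ^ 2 * (‖u‖ * oscLp ε u) := by
    rw [hM]
    ring
  rw [h6] at e2
  have h7 : 0 ≤ (4 + 9 * C) / gaussMass F 1 * gaussMass F (ε⁻¹ ^ 2) ^ 2 * (‖u‖ * oscLp ε u) := by
    positivity
  linarith

end Commutator

/-! ### The energy estimate for weak solutions. -/

section Energy

variable {F : Type*} [NormedAddCommGroup F] [InnerProductSpace ℝ F] [FiniteDimensional ℝ F]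
  [MeasurableSpace F] [BorelSpace F]

/-- `i ∂_t u = (-½ Δ + V) u + S` at time `t`, tested against Gaussians. -/
def WeakEqAt (V : F → ℝ) (S : F → ℂ) (u : ℝ → LTwo F) (t : ℝ) : Prop :=
  ∀ a : ℝ, 0 < a → ∀ r : F, HasDerivAt (fun s => gaussAvg a (u s) r)
    (-Complex.I * (hamAvg a V (u t) r + gaussAvg a S r)) t

/-- A function dominated by `(1 + |x|)²` times an `L²` function of norm at most `C`. -/
structure SourceBound (C : ℝ) (S : F → ℂ) : Prop where
  meas : AEStronglyMeasurable S volume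
  bound : ∃ w : LTwo F, ‖w‖ ≤ C ∧ ∀ᵐ x, ‖S x‖ ≤ (1 + ‖x‖) ^ 2 * ‖w x‖

theorem exists_norm_gaussAvg_le {a : ℝ} (ha : 0 < a) :
    ∃ D : ℝ, 0 ≤ D ∧ ∀ (C : ℝ) (S : F → ℂ), SourceBound C S → ∀ r : F,
      ‖gaussAvg a S r‖ ≤ D * C * (1 + ‖r‖) ^ 4 := by
  obtain ⟨D, hD0, hD⟩ := exists_integral_weight_gauss_le (F := F) a ha 2
  refine ⟨D, hD0, fun C S hS r => ?_⟩
  obtain ⟨w, hwC, hw⟩ := hS.bound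
  obtain ⟨hi, hle⟩ := hD r w
  refine (norm_integral_le_of_norm_le hi ?_).trans (hle.trans ?_)
  · filter_upwards [hw] with x hx
    have hg := (gauss_pos a r x).le
    rw [norm_mul, Complex.norm_real, Real.norm_of_nonneg hg]
    calc gauss a r x * ‖S x‖ ≤ gauss a r x * ((1 + ‖x‖) ^ 2 * ‖w x‖) := by gcongr
      _ = _ := by ring
  · have h1 : (1 + ‖r‖) ^ 2 ≤ (1 + ‖r‖) ^ 4 :=
      pow_le_pow_right₀ (by linarith [norm_nonneg r]) (by norm_num)
    have hC0 : 0 ≤ C := (norm_nonneg w).trans hwC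
    calc D * (1 + ‖r‖) ^ 2 * ‖w‖ ≤ D * (1 + ‖r‖) ^ 4 * C := by gcongr
      _ = _ := by ring

theorem sourceBound_coe (u : LTwo F) : SourceBound ‖u‖ (u : F → ℂ) :=
  ⟨Lp.aestronglyMeasurable u, u, le_rfl, Filter.Eventually.of_forall fun x =>
    le_mul_of_one_le_left (norm_nonneg _) (one_le_pow₀ (by linarith [norm_nonneg x]))⟩

theorem exists_norm_hamAvg_le {a : ℝ} (ha : 0 < a) (C : ℝ) :
    ∃ D : ℝ, 0 ≤ D ∧ ∀ V : F → ℝ, QuadPotential C V → ∀ (u : LTwo F) (r : F),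
      ‖hamAvg a V u r‖ ≤ D * ‖u‖ * (1 + ‖r‖) ^ 4 := by
  obtain ⟨D, hD0, hD⟩ := exists_integrable_gauss_mul_bound (F := F) ha
  by_cases hC : 0 ≤ C
  swap
  · exact ⟨0, le_rfl, fun V hV => absurd hV.nonneg hC⟩
  refine ⟨(a * Module.finrank ℝ F + 2 * a ^ 2 + C) * D, by positivity, fun V hV u r => ?_⟩
  have hQ : Continuous fun x => kin a r x + V x :=
    ((continuous_kin a).comp (continuous_const.prodMk continuous_id)).add hV.continuous
  have h := (hD _ _ r u u (by positivity) hQ (Lp.aestronglyMeasurable u)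
    (Filter.Eventually.of_forall fun _ => le_rfl) (abs_kin_add_le ha.le hV r)).2
  refine (norm_integral_le_integral_norm _).trans (h.trans (le_of_eq ?_))
  ring

theorem aestronglyMeasurable_hamAvg {a C : ℝ} {V : F → ℝ} (hV : QuadPotential C V) (u : LTwo F) :
    AEStronglyMeasurable (hamAvg a V u) volume :=
  aestronglyMeasurable_integral_mul (Q := fun p => gauss a p.1 p.2 * (kin a p.1 p.2 + V p.2))
    ((continuous_gauss a).mul ((continuous_kin a).add (hV.continuous.comp continuous_snd)))
    (Lp.aestronglyMeasurable u)

theorem integrable_gauss_mul_of_bound {b : ℝ} (hb : 0 < b) {g : F → ℝ}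
    (hg : AEStronglyMeasurable g volume) {c : ℝ} (m : ℕ) (h : ∀ r, |g r| ≤ c * (1 + ‖r‖) ^ m) :
    Integrable fun r => gauss b 0 r * g r := by
  refine ((integrable_weight_gauss hb m (0 : F)).const_mul c).mono'
    ((continuous_gauss_right _ _).aestronglyMeasurable.mul hg)
    (Filter.Eventually.of_forall fun r => ?_)
  rw [norm_mul, Real.norm_of_nonneg (gauss_pos _ _ _).le, Real.norm_eq_abs]
  calc gauss b 0 r * |g r| ≤ gauss b 0 r * (c * (1 + ‖r‖) ^ m) :=
        mul_le_mul_of_nonneg_left (h r) (gauss_pos _ _ _).le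
    _ = _ := by ring

theorem abs_im_star_mul_le (z w : ℂ) : |(star z * w).im| ≤ ‖z‖ * ‖w‖ := by
  refine (Complex.abs_im_le_norm _).trans ?_
  rw [norm_mul, norm_star]

/-- Differentiate under the integral; the factor −i turns the real part of the pairing into an
imaginary part. Each Gaussian pairing grows at most like the fourth power of the centre, so products
have growth 8, which the weight makes integrable. -/
theorem hasDerivAt_regMass {u : ℝ → LTwo F} (hu : Continuous u) {V : ℝ → F → ℝ}
    {S : ℝ → F → ℂ} {t₀ t₁ C : ℝ} (hV : ∀ t ∈ Ioo t₀ t₁, QuadPotential C (V t))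
    (hS : ∀ t ∈ Ioo t₀ t₁, SourceBound C (S t))
    (heq : ∀ t ∈ Ioo t₀ t₁, WeakEqAt (V t) (S t) u t) {ε : ℝ} (hε : 0 < ε) {t : ℝ}
    (ht : t ∈ Ioo t₀ t₁) :
    HasDerivAt (fun s => regMass ε (u s))
      (2 * ((∫ r, gauss (ε ^ 2) 0 r *
          (star (gaussAvg (ε⁻¹ ^ 2) (u t) r) * hamAvg (ε⁻¹ ^ 2) (V t) (u t) r).im) +
        ∫ r, gauss (ε ^ 2) 0 r *
          (star (gaussAvg (ε⁻¹ ^ 2) (u t) r) * gaussAvg (ε⁻¹ ^ 2) (S t) r).im)) t := by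
  have hb : 0 < ε ^ 2 := by positivity
  have ha : 0 < ε⁻¹ ^ 2 := by positivity
  obtain ⟨D₁, hD₁, h₁⟩ := exists_norm_gaussAvg_le (F := F) ha
  obtain ⟨D₂, hD₂, h₂⟩ := exists_norm_hamAvg_le (F := F) ha C
  set a := ε⁻¹ ^ 2
  set b := ε ^ 2
  -- By continuity of u this bounds the norm on a neighbourhood of t, giving domination uniform in
  -- s.
  set M := ‖u t‖ + 1 with hM
  have hM0 : 0 ≤ M := by positivity
  have hC : 0 ≤ C := (hV t ht).nonneg
  have hA : ∀ s, ‖u s‖ ≤ M → ∀ r, ‖gaussAvg a (u s) r‖ ≤ D₁ * M * (1 + ‖r‖) ^ 4 := by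
    intro s hs r
    refine (h₁ _ _ (sourceBound_coe (u s)) r).trans ?_
    gcongr
  have hT : ∀ s ∈ Ioo t₀ t₁, ‖u s‖ ≤ M → ∀ r,
      ‖hamAvg a (V s) (u s) r‖ ≤ D₂ * M * (1 + ‖r‖) ^ 4 := by
    intro s hs hs' r
    refine (h₂ _ (hV s hs) (u s) r).trans ?_
    gcongr
  have hcross : ∀ s ∈ Ioo t₀ t₁, ‖u s‖ ≤ M → ∀ r,
      |(star (gaussAvg a (u s) r) * hamAvg a (V s) (u s) r).im| ≤
        D₁ * M * (D₂ * M) * (1 + ‖r‖) ^ 8 := by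
    intro s hs hs' r
    refine (abs_im_star_mul_le _ _).trans ?_
    calc _ ≤ (D₁ * M * (1 + ‖r‖) ^ 4) * (D₂ * M * (1 + ‖r‖) ^ 4) := by
          gcongr
          · exact hA s hs' r
          · exact hT s hs hs' r
      _ = _ := by ring
  have hsrc : ∀ s ∈ Ioo t₀ t₁, ‖u s‖ ≤ M → ∀ r,
      |(star (gaussAvg a (u s) r) * gaussAvg a (S s) r).im| ≤
        D₁ * M * (D₁ * C) * (1 + ‖r‖) ^ 8 := by
    intro s hs hs' r
    refine (abs_im_star_mul_le _ _).trans ?_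
    calc _ ≤ (D₁ * M * (1 + ‖r‖) ^ 4) * (D₁ * C * (1 + ‖r‖) ^ 4) := by
          gcongr
          · exact hA s hs' r
          · exact h₁ _ _ (hS s hs) r
      _ = _ := by ring
  have htM : ‖u t‖ ≤ M := by rw [hM]; linarith
  have hmA : ∀ s, AEStronglyMeasurable (gaussAvg a (u s)) volume := fun s =>
    aestronglyMeasurable_gaussAvg a (Lp.aestronglyMeasurable (u s))
  have hm1 : AEStronglyMeasurable
      (fun r => (star (gaussAvg a (u t) r) * hamAvg a (V t) (u t) r).im) volume :=
    Complex.continuous_im.comp_aestronglyMeasurable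
      ((continuous_star.comp_aestronglyMeasurable (hmA t)).mul
        (aestronglyMeasurable_hamAvg (hV t ht) (u t)))
  have hm2 : AEStronglyMeasurable
      (fun r => (star (gaussAvg a (u t) r) * gaussAvg a (S t) r).im) volume :=
    Complex.continuous_im.comp_aestronglyMeasurable
      ((continuous_star.comp_aestronglyMeasurable (hmA t)).mul
        (aestronglyMeasurable_gaussAvg a (hS t ht).meas))
  have i1 := integrable_gauss_mul_of_bound hb hm1 8 (hcross t ht htM)
  have i2 := integrable_gauss_mul_of_bound hb hm2 8 (hsrc t ht htM)
  have hnhds : Ioo t₀ t₁ ∩ {s | ‖u s‖ < M} ∈ nhds t := by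
    refine Filter.inter_mem (Ioo_mem_nhds ht.1 ht.2) ?_
    exact (isOpen_lt hu.norm continuous_const).mem_nhds (by simp [hM])
  have key := hasDerivAt_integral_of_dominated_loc_of_deriv_le (μ := (volume : Measure F))
    (F := fun s r => gauss b 0 r * ‖gaussAvg a (u s) r‖ ^ 2)
    (F' := fun s r => 2 * (gauss b 0 r * (star (gaussAvg a (u s) r) * hamAvg a (V s) (u s) r).im +
      gauss b 0 r * (star (gaussAvg a (u s) r) * gaussAvg a (S s) r).im)) (x₀ := t)
    (bound := fun r => 2 * ((D₁ * M * (D₂ * M) + D₁ * M * (D₁ * C)) *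
      ((1 + ‖r‖) ^ 8 * gauss b 0 r)))
    hnhds (Filter.Eventually.of_forall fun s =>
      (continuous_gauss_right _ _).aestronglyMeasurable.mul ((hmA s).norm.pow 2)) ?_ ?_ ?_ ?_ ?_
  · refine key.2.congr_deriv ?_
    rw [integral_const_mul, integral_add i1 i2]
  · refine integrable_gauss_mul_of_bound hb ((hmA t).norm.pow 2) 8 (c := (D₁ * M) ^ 2)
      fun r => ?_
    rw [abs_of_nonneg (sq_nonneg _)]
    calc ‖gaussAvg a (u t) r‖ ^ 2 ≤ (D₁ * M * (1 + ‖r‖) ^ 4) ^ 2 := by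
          gcongr
          exact hA t htM r
      _ = _ := by ring
  · exact (i1.add i2).aestronglyMeasurable.const_mul 2
  · refine Filter.Eventually.of_forall fun r s hs => ?_
    have hs' : ‖u s‖ ≤ M := le_of_lt hs.2
    rw [norm_mul, Real.norm_of_nonneg (by norm_num : (0 : ℝ) ≤ 2), ← mul_add, norm_mul,
      Real.norm_of_nonneg (gauss_pos _ _ _).le]
    refine mul_le_mul_of_nonneg_left ?_ (by norm_num)
    have h3 : ‖(star (gaussAvg a (u s) r) * hamAvg a (V s) (u s) r).im +
        (star (gaussAvg a (u s) r) * gaussAvg a (S s) r).im‖ ≤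
        (D₁ * M * (D₂ * M) + D₁ * M * (D₁ * C)) * (1 + ‖r‖) ^ 8 := by
      refine (norm_add_le _ _).trans ?_
      rw [add_mul]
      exact add_le_add (hcross s hs.1 hs' r) (hsrc s hs.1 hs' r)
    calc gauss b 0 r * _ ≤ gauss b 0 r *
          ((D₁ * M * (D₂ * M) + D₁ * M * (D₁ * C)) * (1 + ‖r‖) ^ 8) :=
          mul_le_mul_of_nonneg_left h3 (gauss_pos _ _ _).le
      _ = _ := by ring
  · exact ((integrable_weight_gauss hb 8 (0 : F)).const_mul _).const_mul 2
  · refine Filter.Eventually.of_forall fun r s hs => ?_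
    have h4 := ((heq s hs.1 a ha r).norm_sq).const_mul (gauss b 0 r)
    refine h4.congr_deriv ?_
    rw [Complex.inner]
    simp
    ring

theorem tendsto_integral_oscLp {u : ℝ → LTwo F} (hu : Continuous u) (s t : ℝ) :
    Filter.Tendsto (fun ε : ℝ => ∫ τ in s..t, ‖u τ‖ * oscLp ε (u τ))
        (nhdsWithin 0 (Ioi 0)) (nhds 0) := by
  have hf : Continuous (Function.uncurry fun (ε τ : ℝ) => ‖u τ‖ * oscLp ε (u τ)) := by
    have h1 : Continuous fun p : ℝ × ℝ => ‖u p.2‖ := (hu.comp continuous_snd).norm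
    have h2 : Continuous fun p : ℝ × ℝ => (p.1, u p.2) :=
      continuous_fst.prodMk (hu.comp continuous_snd)
    have h3 : Continuous fun p : ℝ × ℝ => oscLp p.1 (u p.2) :=
      (continuous_oscLp (F := F)).comp h2
    exact h1.mul h3
  have hc := intervalIntegral.continuous_parametric_intervalIntegral_of_continuous'
    (μ := volume) hf s t
  have h3 := hc.tendsto 0
  have h4 : ∫ τ in s..t, ‖u τ‖ * oscLp 0 (u τ) = 0 := by
    simp [oscLp_zero]
  rw [h4] at h3
  exact h3.mono_left nhdsWithin_le_nhds

/-- The shift δ keeps the square root differentiable where the mass vanishes. In its derivative the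
source contributes at most g, because the root of the mass is at most Z h, while the commutator is
divided by √δ; this is harmless because ε tends to zero with δ fixed. -/
theorem abs_sqrt_regMass_sub_le {u : ℝ → LTwo F} (hu : Continuous u) {V : ℝ → F → ℝ}
    {S : ℝ → F → ℂ} {t₀ t₁ C : ℝ} (hV : ∀ t ∈ Ioo t₀ t₁, QuadPotential C (V t))
    (hS : ∀ t ∈ Ioo t₀ t₁, SourceBound C (S t))
    (heq : ∀ t ∈ Ioo t₀ t₁, WeakEqAt (V t) (S t) u t) {g : ℝ → ℝ} {s t : ℝ} (hst : s ≤ t)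
    (hs : s ∈ Ioo t₀ t₁) (ht : t ∈ Ioo t₀ t₁) (hg : IntervalIntegrable g volume s t)
    (hgS : ∀ᵐ τ, τ ∈ Ioc s t → MemLp (S τ) 2 volume ∧ (eLpNorm (S τ) 2 volume).toReal ≤ g τ)
    {δ : ℝ} (hδ : 0 < δ) {ε : ℝ} (hε : 0 < ε) (hε1 : ε ≤ 1) :
    |√((√(regMass ε (u t)) / gaussMass F (ε⁻¹ ^ 2)) ^ 2 + δ) -
      √((√(regMass ε (u s)) / gaussMass F (ε⁻¹ ^ 2)) ^ 2 + δ)| ≤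
      (4 + 9 * C) / gaussMass F 1 / √δ * (∫ τ in s..t, ‖u τ‖ * oscLp ε (u τ)) +
        ∫ τ in s..t, g τ := by
  set Z := gaussMass F (ε⁻¹ ^ 2) with hZ
  have hZ0 : 0 < Z := gaussMass_pos (by positivity)
  have hZ1 : 0 < gaussMass F 1 := gaussMass_pos one_pos
  set K := (4 + 9 * C) / gaussMass F 1 with hK
  have hC : 0 ≤ C := (hV t ht).nonneg
  have hK0 : 0 ≤ K := by positivity
  have hsub : Icc s t ⊆ Ioo t₀ t₁ := fun τ hτ => ⟨hs.1.trans_le hτ.1, hτ.2.trans_lt ht.2⟩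
  set h : ℝ → ℝ := fun τ => √((√(regMass ε (u τ)) / Z) ^ 2 + δ) with hh
  have hh2 : h = fun τ => √(regMass ε (u τ) / Z ^ 2 + δ) := by
    ext τ
    simp only [hh]
    rw [div_pow, Real.sq_sqrt (regMass_nonneg _ _)]
  set R : ℝ → ℝ := fun τ => 2 * ((∫ r, gauss (ε ^ 2) 0 r *
          (star (gaussAvg (ε⁻¹ ^ 2) (u τ) r) * hamAvg (ε⁻¹ ^ 2) (V τ) (u τ) r).im) +
        ∫ r, gauss (ε ^ 2) 0 r *
          (star (gaussAvg (ε⁻¹ ^ 2) (u τ) r) * gaussAvg (ε⁻¹ ^ 2) (S τ) r).im) with hR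
  have hpos : ∀ τ, 0 < regMass ε (u τ) / Z ^ 2 + δ := fun τ =>
    add_pos_of_nonneg_of_pos (div_nonneg (regMass_nonneg _ _) (by positivity)) hδ
  have hderiv : ∀ τ ∈ Ioo t₀ t₁, HasDerivAt h (R τ / Z ^ 2 / (2 * h τ)) τ := by
    intro τ hτ
    rw [hh2]
    exact (((hasDerivAt_regMass hu hV hS heq hε hτ).div_const (Z ^ 2)).add_const δ).sqrt
      (hpos τ).ne'
  have hcont : Continuous fun τ => ‖u τ‖ * oscLp ε (u τ) :=
    hu.norm.mul ((continuous_oscLp (F := F)).comp (continuous_const.prodMk hu))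
  have hbd : ∀ᵐ τ, τ ∈ Ioc s t → ‖deriv h τ‖ ≤ K / √δ * (‖u τ‖ * oscLp ε (u τ)) + g τ := by
    filter_upwards [hgS] with τ hτ hτst
    obtain ⟨hmem, hle⟩ := hτ hτst
    have hτJ : τ ∈ Ioo t₀ t₁ := hsub (Ioc_subset_Icc_self hτst)
    rw [(hderiv τ hτJ).deriv]
    have b1 := abs_integral_commutator_le hε hε1 (hV τ hτJ) (u τ)
    have b2 := abs_integral_inner_gaussAvg_le hε (Lp.memLp (u τ)) hmem
    rw [← hZ] at b1 b2
    have hhpos : 0 < h τ := by rw [hh2]; exact Real.sqrt_pos.2 (hpos τ)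
    have hhδ : √δ ≤ h τ := by
      simp only [hh]
      exact Real.sqrt_le_sqrt (by have := sq_nonneg (√(regMass ε (u τ)) / Z); linarith)
    have hhm : √(regMass ε (u τ)) ≤ Z * h τ := by
      rw [← div_le_iff₀' hZ0]
      simp only [hh]
      exact Real.le_sqrt_of_sq_le (by linarith)
    have hδ' : 0 < √δ := Real.sqrt_pos.2 hδ
    have hosc : 0 ≤ ‖u τ‖ * oscLp ε (u τ) := mul_nonneg (norm_nonneg _) (oscLp_nonneg _ _)
    rw [norm_div, norm_div, Real.norm_of_nonneg (by positivity : 0 ≤ Z ^ 2),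
      Real.norm_of_nonneg (by positivity : 0 ≤ 2 * h τ), Real.norm_eq_abs, div_div,
      div_le_iff₀ (by positivity)]
    have b3 : |R τ| ≤ 2 * (K * Z ^ 2 * (‖u τ‖ * oscLp ε (u τ)) + Z * h τ * (Z * g τ)) := by
      simp only [hR]
      rw [abs_mul, abs_of_pos (by norm_num : (0 : ℝ) < 2)]
      gcongr
      refine (abs_add_le _ _).trans (add_le_add b1 (b2.trans ?_))
      gcongr
    have b4 : K * (‖u τ‖ * oscLp ε (u τ)) ≤ K / √δ * (‖u τ‖ * oscLp ε (u τ)) * h τ := by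
      have e : K * (‖u τ‖ * oscLp ε (u τ)) = K / √δ * (‖u τ‖ * oscLp ε (u τ)) * √δ := by
        rw [mul_right_comm, div_mul_cancel₀ _ hδ'.ne']
      rw [e]
      gcongr
    have b5 : K * Z ^ 2 * (‖u τ‖ * oscLp ε (u τ)) ≤
        Z ^ 2 * (K / √δ * (‖u τ‖ * oscLp ε (u τ)) * h τ) := by
      calc _ = Z ^ 2 * (K * (‖u τ‖ * oscLp ε (u τ))) := by ring
        _ ≤ _ := by gcongr
    calc |R τ| ≤ 2 * (K * Z ^ 2 * (‖u τ‖ * oscLp ε (u τ)) + Z * h τ * (Z * g τ)) := b3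
      _ ≤ 2 * (Z ^ 2 * (K / √δ * (‖u τ‖ * oscLp ε (u τ)) * h τ) + Z * h τ * (Z * g τ)) := by
        gcongr
      _ = _ := by ring
  have hgi : IntervalIntegrable (fun τ => K / √δ * (‖u τ‖ * oscLp ε (u τ)) + g τ) volume s t :=
    ((hcont.intervalIntegrable s t).const_mul _).add hg
  have hdi : IntervalIntegrable (deriv h) volume s t := by
    refine hgi.mono_fun' (measurable_deriv h).aestronglyMeasurable ?_
    rw [uIoc_of_le hst]
    exact (ae_restrict_iff' measurableSet_Ioc).2 hbd
  have hftc : ∫ τ in s..t, deriv h τ = h t - h s := by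
    refine intervalIntegral.integral_eq_sub_of_hasDerivAt (fun τ hτ => ?_) hdi
    rw [uIcc_of_le hst] at hτ
    have := hderiv τ (hsub hτ)
    rwa [this.deriv]
  change |h t - h s| ≤ _
  rw [← hftc, ← Real.norm_eq_abs]
  refine (intervalIntegral.norm_integral_le_of_norm_le hst hbd hgi).trans (le_of_eq ?_)
  rw [intervalIntegral.integral_add ((hcont.intervalIntegrable s t).const_mul _) hg,
    intervalIntegral.integral_const_mul]

/-- The limit ε → 0 at fixed δ removes the commutator, and then δ → 0 removes the shift; the order
matters. -/
theorem abs_norm_sub_norm_le_integral {u : ℝ → LTwo F} (hu : Continuous u) {V : ℝ → F → ℝ}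
    {S : ℝ → F → ℂ} {t₀ t₁ C : ℝ} (hV : ∀ t ∈ Ioo t₀ t₁, QuadPotential C (V t))
    (hS : ∀ t ∈ Ioo t₀ t₁, SourceBound C (S t))
    (heq : ∀ t ∈ Ioo t₀ t₁, WeakEqAt (V t) (S t) u t) {g : ℝ → ℝ} {s t : ℝ} (hst : s ≤ t)
    (hs : s ∈ Ioo t₀ t₁) (ht : t ∈ Ioo t₀ t₁) (hg : IntervalIntegrable g volume s t)
    (hgS : ∀ᵐ τ, τ ∈ Ioc s t → MemLp (S τ) 2 volume ∧ (eLpNorm (S τ) 2 volume).toReal ≤ g τ) :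
    |‖u t‖ - ‖u s‖| ≤ ∫ τ in s..t, g τ := by
  have h1 : ∀ δ : ℝ, 0 < δ → |√(‖u t‖ ^ 2 + δ) - √(‖u s‖ ^ 2 + δ)| ≤ ∫ τ in s..t, g τ := by
    intro δ hδ
    have hosc := tendsto_integral_oscLp hu s t
    have hl : ∀ τ, Filter.Tendsto
        (fun ε : ℝ => √((√(regMass ε (u τ)) / gaussMass F (ε⁻¹ ^ 2)) ^ 2 + δ))
        (nhdsWithin 0 (Ioi 0)) (nhds √(‖u τ‖ ^ 2 + δ)) := fun τ =>
      (((tendsto_sqrt_regMass (u τ)).pow 2).add_const δ).sqrt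
    have hr := (hosc.const_mul ((4 + 9 * C) / gaussMass F 1 / √δ)).add_const (∫ τ in s..t, g τ)
    rw [mul_zero, zero_add] at hr
    refine le_of_tendsto_of_tendsto ((hl t).sub (hl s)).abs hr ?_
    filter_upwards [Ioo_mem_nhdsGT (zero_lt_one (α := ℝ))] with ε hε
    exact abs_sqrt_regMass_sub_le hu hV hS heq hst hs ht hg hgS hδ hε.1 hε.2.le
  have hl : ∀ τ, Filter.Tendsto (fun δ : ℝ => √(‖u τ‖ ^ 2 + δ)) (nhdsWithin 0 (Ioi 0))
      (nhds ‖u τ‖) := by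
    intro τ
    have hc : Continuous fun δ : ℝ => √(‖u τ‖ ^ 2 + δ) := by fun_prop
    have := (hc.tendsto 0).mono_left (nhdsWithin_le_nhds (s := Ioi (0 : ℝ)))
    simpa using this
  refine le_of_tendsto ((hl t).sub (hl s)).abs ?_
  filter_upwards [self_mem_nhdsWithin] with δ hδ using h1 δ hδ

/-- The energy estimate for weak solutions of `i ∂_t u = (-½ Δ + V(t)) u + S(t)`. -/
theorem abs_norm_sub_norm_le_lintegral {u : ℝ → LTwo F} (hu : Continuous u) {V : ℝ → F → ℝ}
    {S : ℝ → F → ℂ} {t₀ t₁ C : ℝ} (hV : ∀ t ∈ Ioo t₀ t₁, QuadPotential C (V t))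
    (hS : ∀ t ∈ Ioo t₀ t₁, SourceBound C (S t))
    (heq : ∀ t ∈ Ioo t₀ t₁, WeakEqAt (V t) (S t) u t) {β : ℝ → ℝ≥0∞} (hβ : Measurable β)
    (hSβ : ∀ t ∈ Ioo t₀ t₁, eLpNorm (S t) 2 volume ≤ β t) {s t : ℝ} (hst : s ≤ t)
    (hs : s ∈ Ioo t₀ t₁) (ht : t ∈ Ioo t₀ t₁) :
    ENNReal.ofReal |‖u t‖ - ‖u s‖| ≤ ∫⁻ τ in Icc s t, β τ := by
  by_cases htop : ∫⁻ τ in Icc s t, β τ = ⊤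
  · rw [htop]; exact le_top
  have hsub : Icc s t ⊆ Ioo t₀ t₁ := fun τ hτ => ⟨hs.1.trans_le hτ.1, hτ.2.trans_lt ht.2⟩
  rw [setLIntegral_congr Ioc_ae_eq_Icc.symm] at htop ⊢
  have hfin : ∀ᵐ τ, τ ∈ Ioc s t → β τ < ⊤ :=
    (ae_restrict_iff' measurableSet_Ioc).1 (ae_lt_top hβ htop)
  have hint : IntegrableOn (fun τ => (β τ).toReal) (Ioc s t) :=
    integrable_toReal_of_lintegral_ne_top hβ.aemeasurable htop
  have h := abs_norm_sub_norm_le_integral hu hV hS heq hst hs ht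
    ((intervalIntegrable_iff_integrableOn_Ioc_of_le hst).2 hint) (by
      filter_upwards [hfin] with τ hτ hτst
      have hτJ := hsub (Ioc_subset_Icc_self hτst)
      have hlt := hτ hτst
      exact ⟨⟨(hS τ hτJ).meas, (hSβ τ hτJ).trans_lt hlt⟩,
        ENNReal.toReal_mono hlt.ne (hSβ τ hτJ)⟩)
  refine (ENNReal.ofReal_le_ofReal h).trans (le_of_eq ?_)
  rw [intervalIntegral.integral_of_le hst, integral_toReal hβ.aemeasurable
    ((ae_restrict_iff' measurableSet_Ioc).2 hfin), ENNReal.ofReal_toReal htop]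

end Energy

/-! ### Growth of potentials, and mean value bounds for W. -/

section Potentials

theorem QuadPotential.mono {F : Type*} [NormedAddCommGroup F] {C C' : ℝ} {V : F → ℝ}
    (h : QuadPotential C V) (hC : C ≤ C') : QuadPotential C' V where
  continuous := h.continuous
  bound x := (h.bound x).trans (by gcongr)
  lip x y := (h.lip x y).trans (by gcongr)

theorem QuadPotential.add {F : Type*} [NormedAddCommGroup F] {C C' : ℝ} {V V' : F → ℝ}
    (h : QuadPotential C V) (h' : QuadPotential C' V') :
    QuadPotential (C + C') fun x => V x + V' x where
  continuous := h.continuous.add h'.continuous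
  bound x := by
    refine (abs_add_le _ _).trans ?_
    rw [add_mul]
    exact add_le_add (h.bound x) (h'.bound x)
  lip x y := by
    rw [add_sub_add_comm]
    refine (abs_add_le _ _).trans ?_
    rw [add_mul]
    exact add_le_add (h.lip x y) (h'.lip x y)

theorem QuadPotential.comp {F G : Type*} [NormedAddCommGroup F] [NormedAddCommGroup G] {C : ℝ}
    {V : F → ℝ} (h : QuadPotential C V) {f : G → F} (hf : Continuous f)
    (hlip : ∀ x y, ‖f x - f y‖ ≤ ‖x - y‖) (hnorm : ∀ x, ‖f x‖ ≤ ‖x‖) :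
    QuadPotential C fun x => V (f x) where
  continuous := h.continuous.comp hf
  bound x := by
    have hC := h.nonneg
    refine (h.bound _).trans ?_
    gcongr
    exact hnorm x
  lip x y := by
    have hC := h.nonneg
    refine (h.lip _ _).trans ?_
    gcongr
    · exact hlip x y
    · exact hnorm x
    · exact hnorm y

theorem quadPotential_of_lip {F : Type*} [NormedAddCommGroup F] {C : ℝ} {V : F → ℝ}
    (hC : 0 ≤ C) (hlip : ∀ x y, |V x - V y| ≤ C * (‖x - y‖ * (1 + ‖x‖ + ‖y‖))) :
    QuadPotential (|V 0| + C) V where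
  continuous := by
    rw [continuous_iff_continuousAt]
    intro x
    rw [ContinuousAt, tendsto_iff_norm_sub_tendsto_zero]
    refine squeeze_zero (fun _ => norm_nonneg _) (fun y => hlip y x) ?_
    have : Continuous fun y => C * (‖y - x‖ * (1 + ‖y‖ + ‖x‖)) := by fun_prop
    simpa using this.tendsto x
  bound x := by
    have h1 := hlip x 0
    simp only [sub_zero, norm_zero, add_zero] at h1
    have h2 : |V x| ≤ |V 0| + |V x - V 0| := by
      have := abs_add_le (V 0) (V x - V 0)
      simpa using this
    have hx := norm_nonneg x
    have h3 : ‖x‖ * (1 + ‖x‖) ≤ (1 + ‖x‖) ^ 2 := by nlinarith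
    have h4 : 1 ≤ (1 + ‖x‖) ^ 2 := one_le_pow₀ (by linarith)
    have h5 : |V 0| ≤ |V 0| * (1 + ‖x‖) ^ 2 := le_mul_of_one_le_right (abs_nonneg _) h4
    have h6 : C * (‖x‖ * (1 + ‖x‖)) ≤ C * (1 + ‖x‖) ^ 2 := by gcongr
    linarith
  lip x y := by
    refine (hlip x y).trans ?_
    gcongr
    linarith [abs_nonneg (V 0)]

variable {Z : Type*} [NormedAddCommGroup Z] [NormedSpace ℝ Z]

theorem AtMostQuadratic.exists_fderiv_lip {V : Z → ℝ} (hV : AtMostQuadratic V) :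
    ∃ C : ℝ, 0 ≤ C ∧ ∀ x y, ‖fderiv ℝ V x - fderiv ℝ V y‖ ≤ C * ‖x - y‖ := by
  obtain ⟨C, hC⟩ := hV.bounded 2 le_rfl
  have hd : Differentiable ℝ (fderiv ℝ V) :=
    (hV.smooth.fderiv_right (m := 1) (by norm_cast)).differentiable (by norm_num)
  have hb : ∀ z, ‖fderiv ℝ (fderiv ℝ V) z‖ ≤ C := by
    intro z
    have h1 := hC z
    rw [← norm_iteratedFDeriv_fderiv, ← norm_iteratedFDeriv_fderiv, norm_iteratedFDeriv_zero] at h1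
    exact h1
  refine ⟨C, (norm_nonneg (fderiv ℝ (fderiv ℝ V) 0)).trans (hb 0), fun x y => ?_⟩
  exact convex_univ.norm_image_sub_le_of_norm_fderiv_le (fun z _ => hd z) (fun z _ => hb z)
    (mem_univ y) (mem_univ x)

/-- Bounded second derivatives make the first derivative grow at most linearly; the mean value
theorem on the ball of radius |x| + |y| then controls increments. -/
theorem AtMostQuadratic.exists_quadPotential {V : Z → ℝ} (hV : AtMostQuadratic V) :
    ∃ C : ℝ, QuadPotential C V := by
  obtain ⟨C, hC0, hC⟩ := hV.exists_fderiv_lip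
  have hd : Differentiable ℝ V := hV.smooth.differentiable (by simp)
  set A := ‖fderiv ℝ V 0‖ with hA
  have hb : ∀ z, ‖fderiv ℝ V z‖ ≤ A + C * ‖z‖ := by
    intro z
    have h1 := hC z 0
    rw [sub_zero] at h1
    have h2 := norm_add_le (fderiv ℝ V z - fderiv ℝ V 0) (fderiv ℝ V 0)
    rw [sub_add_cancel] at h2
    linarith
  refine ⟨_, quadPotential_of_lip (C := A + C) (by positivity) fun x y => ?_⟩
  have h1 := (convex_closedBall (0 : Z) (‖x‖ + ‖y‖)).norm_image_sub_le_of_norm_fderiv_le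
    (f := V) (𝕜 := ℝ) (C := A + C * (‖x‖ + ‖y‖)) (x := y) (y := x)
    (fun z _ => hd z) (fun z hz => (hb z).trans (by
      rw [mem_closedBall_zero_iff] at hz
      gcongr)) (by simp) (by simp)
  rw [Real.norm_eq_abs] at h1
  refine h1.trans ?_
  have hx := norm_nonneg x
  have hy := norm_nonneg y
  have hxy := norm_nonneg (x - y)
  have hA0 : 0 ≤ A := norm_nonneg _
  calc (A + C * (‖x‖ + ‖y‖)) * ‖x - y‖
      ≤ ((A + C) * (1 + ‖x‖ + ‖y‖)) * ‖x - y‖ := by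
        gcongr
        nlinarith [mul_nonneg hA0 (add_nonneg hx hy)]
    _ = _ := by ring

/-- The set where the bound holds has full measure, hence is dense, and is closed by continuity.
This turns L^∞ norms into the pointwise bounds needed by the mean value theorem. -/
theorem enorm_le_eLpNorm_top {X E : Type*} [TopologicalSpace X] [MeasurableSpace X]
    {μ : Measure X} [μ.IsOpenPosMeasure] [NormedAddCommGroup E] {f : X → E}
    (hf : Continuous f) (x : X) : ‖f x‖ₑ ≤ eLpNorm f ⊤ μ := by
  have h1 : ∀ᵐ x ∂μ, ‖f x‖ₑ ≤ eLpNorm f ⊤ μ := by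
    rw [eLpNorm_exponent_top]
    exact ae_le_eLpNormEssSup
  have h2 : Dense {x | ‖f x‖ₑ ≤ eLpNorm f ⊤ μ} := Measure.dense_of_ae h1
  have h3 : IsClosed {x | ‖f x‖ₑ ≤ eLpNorm f ⊤ μ} := isClosed_le hf.enorm continuous_const
  have h4 := h3.closure_eq ▸ h2.closure_eq
  exact (h4 ▸ mem_univ x : x ∈ {x | ‖f x‖ₑ ≤ eLpNorm f ⊤ μ})

theorem norm_le_eLpNorm_top {X E : Type*} [TopologicalSpace X] [MeasurableSpace X]
    {μ : Measure X} [μ.IsOpenPosMeasure] [NormedAddCommGroup E] {f : X → E}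
    (hf : Continuous f) (hfin : eLpNorm f ⊤ μ ≠ ⊤) (x : X) : ‖f x‖ ≤ (eLpNorm f ⊤ μ).toReal := by
  have := ENNReal.toReal_mono hfin (enorm_le_eLpNorm_top (μ := μ) hf x)
  simpa using this

variable {n d : ℕ} {W : Euc n × Euc d → ℝ}

theorem hasFDerivAt_slice_right (hW : AtMostQuadratic W) (z : Euc n × Euc d) :
    HasFDerivAt (fun y => W (z.1, y))
      ((fderiv ℝ W z).comp (ContinuousLinearMap.inr ℝ (Euc n) (Euc d))) z.2 := by
  have h1 : HasFDerivAt W (fderiv ℝ W z) (z.1, z.2) :=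
    (hW.smooth.differentiable (by simp) z).hasFDerivAt
  exact h1.comp z.2 (hasFDerivAt_prodMk_right z.1 z.2)

theorem norm_gradY_sub (hW : AtMostQuadratic W) (z z' : Euc n × Euc d) :
    ‖gradY W z - gradY W z'‖ = ‖(fderiv ℝ W z).comp (ContinuousLinearMap.inr ℝ (Euc n) (Euc d)) -
      (fderiv ℝ W z').comp (ContinuousLinearMap.inr ℝ (Euc n) (Euc d))‖ := by
  rw [gradY, gradY, gradient, gradient, ← map_sub, LinearIsometryEquiv.norm_map,
    (hasFDerivAt_slice_right hW z).fderiv, (hasFDerivAt_slice_right hW z').fderiv]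

theorem gradY_eq_sum (hW : AtMostQuadratic W) (z : Euc n × Euc d) :
    gradY W z = ∑ k, (fderiv ℝ W z (0, EuclideanSpace.basisFun (Fin d) ℝ k)) •
      EuclideanSpace.basisFun (Fin d) ℝ k := by
  rw [← (EuclideanSpace.basisFun (Fin d) ℝ).sum_repr' (gradY W z)]
  refine Finset.sum_congr rfl fun k _ => ?_
  congr 1
  rw [real_inner_comm, gradY, gradient, InnerProductSpace.toDual_symm_apply,
    (hasFDerivAt_slice_right hW z).fderiv]
  simp

theorem contDiff_gradY (hW : AtMostQuadratic W) : ContDiff ℝ 1 (gradY W) := by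
  have h1 : ContDiff ℝ 1 (fderiv ℝ W) := hW.smooth.fderiv_right (by norm_cast)
  have h2 : gradY W = fun z => ∑ k, (fderiv ℝ W z (0, EuclideanSpace.basisFun (Fin d) ℝ k)) •
      EuclideanSpace.basisFun (Fin d) ℝ k := funext (gradY_eq_sum hW)
  rw [h2]
  exact ContDiff.sum fun k _ => (h1.clm_apply contDiff_const).smul contDiff_const

theorem hasFDerivAt_gradY_left (hW : AtMostQuadratic W) (z : Euc n × Euc d) :
    HasFDerivAt (fun x => gradY W (x, z.2))
      ((fderiv ℝ (gradY W) z).comp (ContinuousLinearMap.inl ℝ (Euc n) (Euc d))) z.1 := by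
  have h1 : HasFDerivAt (gradY W) (fderiv ℝ (gradY W) z) (z.1, z.2) :=
    ((contDiff_gradY hW).differentiable (by norm_num) z).hasFDerivAt
  have h2 : HasFDerivAt (fun x => (x, z.2)) (ContinuousLinearMap.inl ℝ (Euc n) (Euc d)) z.1 :=
    hasFDerivAt_prodMk_left z.1 z.2
  exact h1.comp z.1 h2

theorem continuous_gradXGradY (hW : AtMostQuadratic W) : Continuous (gradXGradY W) := by
  have h1 : gradXGradY W = fun z => (fderiv ℝ (gradY W) z).comp
      (ContinuousLinearMap.inl ℝ (Euc n) (Euc d)) :=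
    funext fun z => (hasFDerivAt_gradY_left hW z).fderiv
  rw [h1]
  exact ((contDiff_gradY hW).continuous_fderiv (by norm_num)).clm_comp continuous_const

/-- The derivative of W is Lipschitz, so x ↦ ∇_y W is Lipschitz with the same constant uniformly in
y. Finiteness permits working with the real number behind the norm. -/
theorem eLpNorm_gradXGradY_ne_top (hW : AtMostQuadratic W) :
    eLpNorm (gradXGradY W) ⊤ volume ≠ ⊤ := by
  obtain ⟨C, hC0, hC⟩ := hW.exists_fderiv_lip
  have hb : ∀ z, ‖gradXGradY W z‖ ≤ C := by
    intro z
    have h1 : LipschitzWith C.toNNReal (fun x => gradY W (x, z.2)) := by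
      refine LipschitzWith.of_dist_le_mul fun x x' => ?_
      rw [dist_eq_norm, norm_gradY_sub hW, ← ContinuousLinearMap.sub_comp,
        Real.coe_toNNReal _ hC0]
      refine (ContinuousLinearMap.opNorm_comp_le _ _).trans ?_
      have h2 : ‖ContinuousLinearMap.inr ℝ (Euc n) (Euc d)‖ ≤ 1 :=
        ContinuousLinearMap.opNorm_le_bound _ zero_le_one fun y => by simp
      have h3 := hC (x, z.2) (x', z.2)
      have h4 : ‖((x, z.2) : Euc n × Euc d) - (x', z.2)‖ = dist x x' := by
        simp [dist_eq_norm]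
      rw [h4] at h3
      calc _ ≤ (C * dist x x') * 1 := by gcongr
        _ = _ := mul_one _
    have := norm_fderiv_le_of_lipschitz ℝ h1 (x₀ := z.1)
    rwa [Real.coe_toNNReal _ hC0] at this
  exact (memLp_top_of_bound (continuous_gradXGradY hW).aestronglyMeasurable C
    (Filter.Eventually.of_forall hb)).2.ne

theorem eLpNorm_gradY_ne_top (hW : AtMostQuadratic W) (h : ∃ C : ℝ, ∀ z, ‖gradY W z‖ ≤ C) :
    eLpNorm (gradY W) ⊤ volume ≠ ⊤ := by
  obtain ⟨C, hC⟩ := h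
  exact (memLp_top_of_bound (contDiff_gradY hW).continuous.aestronglyMeasurable C
    (Filter.Eventually.of_forall hC)).2.ne

theorem norm_fderiv_slice_right (z : Euc n × Euc d) :
    ‖fderiv ℝ (fun y => W (z.1, y)) z.2‖ = ‖gradY W z‖ := by
  rw [gradY, gradient, LinearIsometryEquiv.norm_map]

theorem abs_sub_le_gradY (hW : AtMostQuadratic W) (h : ∃ C : ℝ, ∀ z, ‖gradY W z‖ ≤ C)
    (x : Euc n) (y y' : Euc d) :
    |W (x, y) - W (x, y')| ≤ (eLpNorm (gradY W) ⊤ volume).toReal * ‖y - y'‖ := by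
  have hfin := eLpNorm_gradY_ne_top hW h
  refine convex_univ.norm_image_sub_le_of_norm_fderiv_le (𝕜 := ℝ) (f := fun y => W (x, y))
    (fun y _ => (hasFDerivAt_slice_right hW (x, y)).differentiableAt) (fun y _ => ?_)
    (mem_univ y') (mem_univ y)
  rw [norm_fderiv_slice_right (x, y)]
  exact norm_le_eLpNorm_top (contDiff_gradY hW).continuous hfin _

/-- The mean value theorem twice: in x for ∇_y W, then in y for W(x,·) − W(x',·). -/
theorem abs_mixed_sub_le (hW : AtMostQuadratic W) (x x' : Euc n) (y y' : Euc d) :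
    |W (x, y) - W (x', y) - (W (x, y') - W (x', y'))| ≤
      (eLpNorm (gradXGradY W) ⊤ volume).toReal * (‖x - x'‖ * ‖y - y'‖) := by
  have hfin := eLpNorm_gradXGradY_ne_top hW
  set M := (eLpNorm (gradXGradY W) ⊤ volume).toReal
  have h1 : ∀ y, ‖gradY W (x, y) - gradY W (x', y)‖ ≤ M * ‖x - x'‖ := by
    intro y
    refine convex_univ.norm_image_sub_le_of_norm_fderiv_le (𝕜 := ℝ) (f := fun x => gradY W (x, y))
      (fun x _ => (hasFDerivAt_gradY_left hW (x, y)).differentiableAt) (fun x _ => ?_)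
      (mem_univ x') (mem_univ x)
    exact norm_le_eLpNorm_top (continuous_gradXGradY hW) hfin (x, y)
  rw [← mul_assoc]
  refine convex_univ.norm_image_sub_le_of_norm_hasFDerivWithin_le (𝕜 := ℝ)
    (f := fun y => W (x, y) - W (x', y))
    (fun y _ => ((hasFDerivAt_slice_right hW (x, y)).sub
      (hasFDerivAt_slice_right hW (x', y))).hasFDerivWithinAt) (fun y _ => ?_)
    (mem_univ y') (mem_univ y)
  rw [← norm_gradY_sub hW]
  exact h1 y

end Potentials

/-! ### The weak equation on a single Euclidean space. -/

section SingleSpace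

theorem schrodingerOp_gauss {N : ℕ} (V : Euc N → ℝ) (a : ℝ) (r x : Euc N) :
    schrodingerOp V (fun y => (gauss a r y : ℂ)) x =
      ((gauss a r x * (kin a r x + V x) : ℝ) : ℂ) := by
  rw [schrodingerOp, laplacian_gauss, kin]
  push_cast
  ring

theorem gaussAvg_zero {F : Type*} [NormedAddCommGroup F] [InnerProductSpace ℝ F]
    [FiniteDimensional ℝ F] [MeasurableSpace F] [BorelSpace F] (a : ℝ) (r : F) :
    gaussAvg a (0 : F → ℂ) r = 0 := by
  simp [gaussAvg]

theorem IsSchrodingerSolution.weakEqAt {N : ℕ} {V : ℝ → Euc N → ℝ} {u₀ : Euc N → ℂ}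
    {u : ℝ → LTwo (Euc N)} (h : IsSchrodingerSolution (fun t => schrodingerOp (V t)) u₀ u)
    (t : ℝ) : WeakEqAt (V t) 0 u t := by
  intro a ha r
  obtain ⟨χ, hχ⟩ := exists_schwartz_gauss a ha r
  have h1 := h.equation χ t
  have hχ' : (χ : Euc N → ℂ) = fun x => (gauss a r x : ℂ) := funext hχ
  simp only [hχ', schrodingerOp_gauss, RCLike.inner_apply, Complex.conj_ofReal] at h1
  simp only [gaussAvg, hamAvg, mul_comm _ ((u _ : Euc N → ℂ) _), Pi.zero_apply, mul_zero,
    integral_zero, add_zero]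
  exact h1

end SingleSpace

/-! ### From the supremum-norm product to the Euclidean product. -/

section Transfer

variable {n d : ℕ}

/-- The Euclidean (as opposed to supremum) product of two Euclidean spaces. -/
abbrev EucProd (n d : ℕ) : Type := WithLp 2 (Euc n × Euc d)

theorem measurePreserving_ofLp_eucProd :
    MeasurePreserving (WithLp.ofLp : EucProd n d → Euc n × Euc d) volume volume :=
  WithLp.volume_preserving_ofLp (Euc n) (Euc d)

theorem measurableEmbedding_ofLp_eucProd :
    MeasurableEmbedding (WithLp.ofLp : EucProd n d → Euc n × Euc d) :=
  (WithLp.homeomorphProd 2 (Euc n) (Euc d)).measurableEmbedding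

theorem integral_comp_ofLp {E : Type*} [NormedAddCommGroup E] [NormedSpace ℝ E]
    (f : Euc n × Euc d → E) : ∫ z : EucProd n d, f z.ofLp = ∫ z, f z :=
  measurePreserving_ofLp_eucProd.integral_comp measurableEmbedding_ofLp_eucProd f

/-- Transfer of `L²` functions to the Euclidean product. -/
noncomputable def toEucProd (u : LTwo (Euc n × Euc d)) : LTwo (EucProd n d) :=
  Lp.compMeasurePreserving WithLp.ofLp measurePreserving_ofLp_eucProd u

theorem coeFn_toEucProd (u : LTwo (Euc n × Euc d)) :
    toEucProd u =ᵐ[volume] fun z => u z.ofLp :=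
  Lp.coeFn_compMeasurePreserving _ _

theorem norm_toEucProd (u : LTwo (Euc n × Euc d)) : ‖toEucProd u‖ = ‖u‖ :=
  Lp.norm_compMeasurePreserving _ _

theorem continuous_toEucProd :
    Continuous (toEucProd : LTwo (Euc n × Euc d) → LTwo (EucProd n d)) :=
  (Lp.isometry_compMeasurePreserving measurePreserving_ofLp_eucProd).continuous

/-- This factorisation needs the Euclidean norm on the product. It is what makes Gaussian averages
of tensor products factor. -/
theorem gauss_eucProd (a : ℝ) (r z : EucProd n d) :
    gauss a r z = gauss a r.fst z.fst * gauss a r.snd z.snd := by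
  rw [gauss, gauss, gauss, ← Real.exp_add, WithLp.prod_norm_sq_eq_of_L2]
  congr 1
  simp
  ring

theorem kin_eucProd (a : ℝ) (r z : EucProd n d) :
    kin a r z = kin a r.fst z.fst + kin a r.snd z.snd := by
  have h : Module.finrank ℝ (EucProd n d) = n + d := by
    rw [(WithLp.linearEquiv 2 ℝ (Euc n × Euc d)).finrank_eq, Module.finrank_prod]
    simp
  rw [kin, kin, kin, WithLp.prod_norm_sq_eq_of_L2, h]
  simp
  ring

theorem gaussAvg_congr {F : Type*} [NormedAddCommGroup F] [InnerProductSpace ℝ F]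
    [FiniteDimensional ℝ F] [MeasurableSpace F] [BorelSpace F] {a : ℝ} {f g : F → ℂ}
    (h : f =ᵐ[volume] g) (r : F) : gaussAvg a f r = gaussAvg a g r :=
  integral_congr_ae (h.mono fun x hx => by simp only [hx])

theorem hamAvg_congr {F : Type*} [NormedAddCommGroup F] [InnerProductSpace ℝ F]
    [FiniteDimensional ℝ F] [MeasurableSpace F] [BorelSpace F] {a : ℝ} {V : F → ℝ} {f g : F → ℂ}
    (h : f =ᵐ[volume] g) (r : F) : hamAvg a V f r = hamAvg a V g r :=
  integral_congr_ae (h.mono fun x hx => by simp only [hx])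

theorem gaussAvg_eucProd (a : ℝ) (f : Euc n × Euc d → ℂ) (r : EucProd n d) :
    gaussAvg a (fun z => f z.ofLp) r =
      ∫ z : Euc n × Euc d, ((gauss a r.fst z.1 * gauss a r.snd z.2 : ℝ) : ℂ) * f z := by
  rw [← integral_comp_ofLp, gaussAvg]
  simp_rw [gauss_eucProd]
  rfl

theorem hamAvg_eucProd (a : ℝ) (V : Euc n × Euc d → ℝ) (f : Euc n × Euc d → ℂ)
    (r : EucProd n d) :
    hamAvg a (fun z => V z.ofLp) (fun z => f z.ofLp) r =
      ∫ z : Euc n × Euc d, ((gauss a r.fst z.1 * gauss a r.snd z.2 *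
        (kin a r.fst z.1 + kin a r.snd z.2 + V z) : ℝ) : ℂ) * f z := by
  rw [← integral_comp_ofLp, hamAvg]
  simp_rw [gauss_eucProd, kin_eucProd]
  rfl

theorem laplacian_gauss_mul_const {N : ℕ} (a : ℝ) (r x : Euc N) (c : ℂ) :
    (Δ (fun y => (gauss a r y : ℂ) * c)) x =
      (((4 * a ^ 2 * ‖x - r‖ ^ 2 - 2 * a * Module.finrank ℝ (Euc N)) *
        gauss a r x : ℝ) : ℂ) * c := by
  have h1 : ContDiffAt ℝ 2 (fun y => (gauss a r y : ℂ)) x :=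
    (Complex.ofRealCLM.contDiff.comp (contDiff_gauss a r)).contDiffAt
  have h2 : (fun y => (gauss a r y : ℂ) * c) = c • fun y => (gauss a r y : ℂ) := by
    ext y
    simp [mul_comm]
  rw [h2, InnerProductSpace.laplacian_smul c h1, laplacian_gauss, smul_eq_mul, mul_comm]

theorem schrodingerOp_gauss_mul_const {N : ℕ} (V : Euc N → ℝ) (a : ℝ) (r x : Euc N) (c : ℂ) :
    schrodingerOp V (fun y => (gauss a r y : ℂ) * c) x =
      ((gauss a r x * (kin a r x + V x) : ℝ) : ℂ) * c := by
  rw [schrodingerOp, laplacian_gauss_mul_const, kin]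
  push_cast
  ring

theorem fullHamiltonian_gauss (V₁ : Euc n → ℝ) (V₂ : Euc d → ℝ) (W : Euc n × Euc d → ℝ) (a : ℝ)
    (r : EucProd n d) (z : Euc n × Euc d) :
    fullHamiltonian V₁ V₂ W
      (fun z => ((gauss a r.fst z.1 * gauss a r.snd z.2 : ℝ) : ℂ)) z =
      ((gauss a r.fst z.1 * gauss a r.snd z.2 *
        (kin a r.fst z.1 + kin a r.snd z.2 + (V₁ z.1 + V₂ z.2 + W z)) : ℝ) : ℂ) := by
  have h1 : (fun x => ((gauss a r.fst x * gauss a r.snd z.2 : ℝ) : ℂ)) =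
      fun x => (gauss a r.fst x : ℂ) * (gauss a r.snd z.2 : ℂ) := by
    ext x; push_cast; rfl
  have h2 : (fun y => ((gauss a r.fst z.1 * gauss a r.snd y : ℝ) : ℂ)) =
      fun y => (gauss a r.snd y : ℂ) * (gauss a r.fst z.1 : ℂ) := by
    ext y; push_cast; ring
  rw [fullHamiltonian]
  simp only [h1, h2, schrodingerOp_gauss_mul_const]
  push_cast
  ring

theorem exists_schwartz_gauss_prod (a : ℝ) (ha : 0 < a) (r : EucProd n d) :
    ∃ χ : 𝓢(Euc n × Euc d, ℂ),
      ∀ z, χ z = ((gauss a r.fst z.1 * gauss a r.snd z.2 : ℝ) : ℂ) := by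
  obtain ⟨χ, hχ⟩ := exists_schwartz_gauss a ha r
  refine ⟨SchwartzMap.compCLMOfContinuousLinearEquiv ℂ
    (WithLp.prodContinuousLinearEquiv 2 ℝ (Euc n) (Euc d)).symm χ, fun z => ?_⟩
  rw [SchwartzMap.compCLMOfContinuousLinearEquiv_apply, Function.comp_apply, hχ, gauss_eucProd]
  rfl

theorem IsSchrodingerSolution.weakEqAt_prod {V₁ : Euc n → ℝ} {V₂ : Euc d → ℝ}
    {W : Euc n × Euc d → ℝ} {u₀ : Euc n × Euc d → ℂ} {ψ : ℝ → LTwo (Euc n × Euc d)}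
    (h : IsSchrodingerSolution (fun _ => fullHamiltonian V₁ V₂ W) u₀ ψ) (t : ℝ) :
    WeakEqAt (fun z : EucProd n d => V₁ z.ofLp.1 + V₂ z.ofLp.2 + W z.ofLp) 0
      (fun s => toEucProd (ψ s)) t := by
  intro a ha r
  obtain ⟨χ, hχ⟩ := exists_schwartz_gauss_prod a ha r
  have h1 := h.equation χ t
  have hχ' : (χ : Euc n × Euc d → ℂ) =
      fun z => ((gauss a r.fst z.1 * gauss a r.snd z.2 : ℝ) : ℂ) := funext hχ
  simp only [hχ', fullHamiltonian_gauss, RCLike.inner_apply, Complex.conj_ofReal] at h1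
  rw [gaussAvg_zero, add_zero, hamAvg_congr (coeFn_toEucProd (ψ t)),
    hamAvg_eucProd a (fun z => V₁ z.1 + V₂ z.2 + W z) (ψ t)]
  simp_rw [gaussAvg_congr (coeFn_toEucProd (ψ _)), gaussAvg_eucProd]
  simp only [mul_comm _ ((ψ _ : Euc n × Euc d → ℂ) _)]
  exact h1

end Transfer

/-! ### Tensor products of L² functions. -/

section Tensor

variable {X Y : Type*} [MeasurableSpace X] [MeasurableSpace Y] {μ : Measure X} {ν : Measure Y}
  [SFinite ν]

theorem eLpNorm_tensor {f : X → ℂ} {g : Y → ℂ} (hf : AEStronglyMeasurable f μ)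
    (hg : AEStronglyMeasurable g ν) :
    eLpNorm (fun z : X × Y => f z.1 * g z.2) 2 (μ.prod ν) = eLpNorm f 2 μ * eLpNorm g 2 ν := by
  have h : eLpNorm (fun z : X × Y => f z.1 * g z.2) 2 (μ.prod ν) ^ 2 =
      (eLpNorm f 2 μ * eLpNorm g 2 ν) ^ 2 := by
    rw [mul_pow, eLpNorm_two_sq, eLpNorm_two_sq, eLpNorm_two_sq,
      ← lintegral_prod_mul (hf.enorm.pow_const 2) (hg.enorm.pow_const 2)]
    refine lintegral_congr fun z => ?_
    rw [enorm_mul, mul_pow]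
  exact (ENNReal.pow_right_strictMono two_ne_zero).injective h

theorem memLp_tensor {f : X → ℂ} {g : Y → ℂ} (hf : MemLp f 2 μ) (hg : MemLp g 2 ν) :
    MemLp (fun z : X × Y => f z.1 * g z.2) 2 (μ.prod ν) :=
  ⟨hf.1.comp_fst.mul hg.1.comp_snd, by
    rw [eLpNorm_tensor hf.1 hg.1]; exact ENNReal.mul_lt_top hf.2 hg.2⟩

end Tensor

section TensorLp

variable {n d : ℕ}

/-- The tensor product of two `L²` functions. -/
noncomputable def tensorLp (u : LTwo (Euc n)) (v : LTwo (Euc d)) : LTwo (Euc n × Euc d) :=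
  (memLp_tensor (Lp.memLp u) (Lp.memLp v)).toLp _

theorem coeFn_tensorLp (u : LTwo (Euc n)) (v : LTwo (Euc d)) :
    tensorLp u v =ᵐ[volume] fun z => u z.1 * v z.2 :=
  MemLp.coeFn_toLp _

theorem norm_tensorLp (u : LTwo (Euc n)) (v : LTwo (Euc d)) : ‖tensorLp u v‖ = ‖u‖ * ‖v‖ := by
  rw [tensorLp, Lp.norm_toLp, Lp.norm_def, Lp.norm_def, ← ENNReal.toReal_mul,
    ← eLpNorm_tensor (Lp.aestronglyMeasurable u) (Lp.aestronglyMeasurable v)]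


theorem ae_fst {p : Euc n → Prop} (h : ∀ᵐ x, p x) : ∀ᵐ z : Euc n × Euc d, p z.1 :=
  Measure.quasiMeasurePreserving_fst.ae h

theorem ae_snd {p : Euc d → Prop} (h : ∀ᵐ y, p y) : ∀ᵐ z : Euc n × Euc d, p z.2 :=
  Measure.quasiMeasurePreserving_snd.ae h

theorem tensorLp_sub_tensorLp (u u' : LTwo (Euc n)) (v v' : LTwo (Euc d)) :
    tensorLp u v - tensorLp u' v' = tensorLp (u - u') v + tensorLp u' (v - v') := by
  refine Lp.ext ?_
  filter_upwards [Lp.coeFn_sub (tensorLp u v) (tensorLp u' v'),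
    Lp.coeFn_add (tensorLp (u - u') v) (tensorLp u' (v - v')), coeFn_tensorLp u v,
    coeFn_tensorLp u' v', coeFn_tensorLp (u - u') v, coeFn_tensorLp u' (v - v'),
    ae_fst (Lp.coeFn_sub u u'), ae_snd (Lp.coeFn_sub v v')] with z h1 h2 h3 h4 h5 h6 h7 h8
  rw [h1, h2, Pi.sub_apply, Pi.add_apply, h3, h4, h5, h6, h7, h8, Pi.sub_apply, Pi.sub_apply]
  ring

theorem continuous_tensorLp {u : ℝ → LTwo (Euc n)} {v : ℝ → LTwo (Euc d)} (hu : Continuous u)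
    (hv : Continuous v) : Continuous fun t => tensorLp (u t) (v t) := by
  rw [continuous_iff_continuousAt]
  intro t
  rw [ContinuousAt, tendsto_iff_norm_sub_tendsto_zero]
  refine squeeze_zero (fun _ => norm_nonneg _)
    (g := fun s => ‖u s - u t‖ * ‖v s‖ + ‖u t‖ * ‖v s - v t‖) (fun s => ?_) ?_
  · rw [tensorLp_sub_tensorLp]
    refine (norm_add_le _ _).trans (le_of_eq ?_)
    rw [norm_tensorLp, norm_tensorLp]
  · have : Continuous fun s => ‖u s - u t‖ * ‖v s‖ + ‖u t‖ * ‖v s - v t‖ := by fun_prop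
    simpa using this.tendsto t

end TensorLp

/-! ### Linearity of the weak equation. -/

section WeakEq

variable {F : Type*} [NormedAddCommGroup F] [InnerProductSpace ℝ F] [FiniteDimensional ℝ F]
  [MeasurableSpace F] [BorelSpace F]

theorem integrable_gauss_mul {a : ℝ} (ha : 0 < a) (u : LTwo F) (r : F) :
    Integrable fun x => (gauss a r x : ℂ) * u x :=
  (memLp_gauss ha r).ofReal.integrable_mul (Lp.memLp u)

theorem integrable_hamAvg {a C : ℝ} (ha : 0 < a) {V : F → ℝ} (hV : QuadPotential C V)
    (u : LTwo F) (r : F) :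
    Integrable fun x => ((gauss a r x * (kin a r x + V x) : ℝ) : ℂ) * u x := by
  obtain ⟨D, hD0, hD⟩ := exists_integrable_gauss_mul_bound (F := F) ha
  have hC := hV.nonneg
  have hQ : Continuous fun x => kin a r x + V x :=
    ((continuous_kin a).comp (continuous_const.prodMk continuous_id)).add hV.continuous
  exact (hD _ _ r u u (by positivity) hQ (Lp.aestronglyMeasurable u)
    (Filter.Eventually.of_forall fun _ => le_rfl) (abs_kin_add_le ha.le hV r)).1

theorem gaussAvg_potential_sub {a C C' : ℝ} (ha : 0 < a) {V Q : F → ℝ} (hV : QuadPotential C V)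
    (hQ : QuadPotential C' Q) (u : LTwo F) (r : F) :
    gaussAvg a (fun x => ((Q x - V x : ℝ) : ℂ) * u x) r = hamAvg a Q u r - hamAvg a V u r := by
  rw [hamAvg, hamAvg, ← integral_sub (integrable_hamAvg ha hQ u r) (integrable_hamAvg ha hV u r)]
  refine integral_congr_ae (Filter.Eventually.of_forall fun x => ?_)
  push_cast
  ring

theorem gaussAvg_sub_lp {a : ℝ} (ha : 0 < a) (u v : LTwo F) (r : F) :
    gaussAvg a (u - v : LTwo F) r = gaussAvg a u r - gaussAvg a v r := by
  rw [gaussAvg_congr (Lp.coeFn_sub u v), gaussAvg, gaussAvg, gaussAvg,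
    ← integral_sub (integrable_gauss_mul ha u r) (integrable_gauss_mul ha v r)]
  refine integral_congr_ae (Filter.Eventually.of_forall fun x => ?_)
  simp only [Pi.sub_apply]
  ring

theorem hamAvg_sub_lp {a C : ℝ} (ha : 0 < a) {V : F → ℝ} (hV : QuadPotential C V) (u v : LTwo F)
    (r : F) : hamAvg a V (u - v : LTwo F) r = hamAvg a V u r - hamAvg a V v r := by
  rw [hamAvg_congr (Lp.coeFn_sub u v), hamAvg, hamAvg, hamAvg,
    ← integral_sub (integrable_hamAvg ha hV u r) (integrable_hamAvg ha hV v r)]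
  refine integral_congr_ae (Filter.Eventually.of_forall fun x => ?_)
  simp only [Pi.sub_apply]
  ring

theorem gaussAvg_neg (a : ℝ) (f : F → ℂ) (r : F) :
    gaussAvg a (-f) r = -gaussAvg a f r := by
  simp [gaussAvg, integral_neg]

theorem WeakEqAt.sub {C : ℝ} {V : F → ℝ} (hV : QuadPotential C V) {S : F → ℂ}
    {u w : ℝ → LTwo F} {t : ℝ} (hu : WeakEqAt V 0 u t) (hw : WeakEqAt V S w t) :
    WeakEqAt V (-S) (fun s => u s - w s) t := by
  intro a ha r
  have h := (hu a ha r).sub (hw a ha r)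
  rw [gaussAvg_zero] at h
  have e : (fun s => gaussAvg a (u s - w s : LTwo F) r) =
      (fun s => gaussAvg a (u s) r) - fun s => gaussAvg a (w s) r :=
    funext fun s => gaussAvg_sub_lp ha (u s) (w s) r
  rw [e, hamAvg_sub_lp ha hV, gaussAvg_neg]
  exact h.congr_deriv (by ring)

end WeakEq

/-! ### The equation and the error bound for a phase-corrected product. -/

section TensorEq

variable {n d : ℕ}

/-- The phase-corrected tensor product, on the Euclidean product space. -/
noncomputable def phaseTensor (θ : ℝ) (u : LTwo (Euc n)) (v : LTwo (Euc d)) :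
    LTwo (EucProd n d) :=
  toEucProd (Complex.exp (Complex.I * θ) • tensorLp u v)

theorem norm_exp_I_mul (θ : ℝ) : ‖Complex.exp (Complex.I * θ)‖ = 1 := by
  rw [mul_comm, Complex.norm_exp_ofReal_mul_I]

theorem coeFn_phase_smul (θ : ℝ) (u : LTwo (Euc n)) (v : LTwo (Euc d)) :
    (Complex.exp (Complex.I * θ) • tensorLp u v : LTwo (Euc n × Euc d)) =ᵐ[volume]
      fun z => Complex.exp (Complex.I * θ) * (u z.1 * v z.2) := by
  filter_upwards [Lp.coeFn_smul (Complex.exp (Complex.I * θ)) (tensorLp u v),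
    coeFn_tensorLp u v] with z h1 h2
  rw [h1, Pi.smul_apply, h2, smul_eq_mul]

theorem coeFn_phaseTensor (θ : ℝ) (u : LTwo (Euc n)) (v : LTwo (Euc d)) :
    phaseTensor θ u v =ᵐ[volume]
      fun z => Complex.exp (Complex.I * θ) * (u z.ofLp.1 * v z.ofLp.2) := by
  refine (coeFn_toEucProd _).trans ?_
  exact measurePreserving_ofLp_eucProd.quasiMeasurePreserving.ae_eq_comp (coeFn_phase_smul θ u v)

theorem gaussAvg_phaseTensor (a θ : ℝ) (u : LTwo (Euc n)) (v : LTwo (Euc d)) (r : EucProd n d) :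
    gaussAvg a (phaseTensor θ u v) r =
      Complex.exp (Complex.I * θ) * (gaussAvg a u r.fst * gaussAvg a v r.snd) := by
  rw [gaussAvg_congr (coeFn_phaseTensor θ u v),
    gaussAvg_eucProd a (fun z => Complex.exp (Complex.I * θ) * (u z.1 * v z.2)) r,
    gaussAvg, gaussAvg, ← integral_prod_mul, ← integral_const_mul]
  refine integral_congr_ae (Filter.Eventually.of_forall fun z => ?_)
  push_cast
  ring

theorem hamAvg_phaseTensor {a C₁ C₂ : ℝ} (ha : 0 < a) {U₁ : Euc n → ℝ} {U₂ : Euc d → ℝ}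
    (h₁ : QuadPotential C₁ U₁) (h₂ : QuadPotential C₂ U₂) (θ c : ℝ)
    (u : LTwo (Euc n)) (v : LTwo (Euc d)) (r : EucProd n d) :
    hamAvg a (fun z : EucProd n d => U₁ z.ofLp.1 + U₂ z.ofLp.2 + c) (phaseTensor θ u v) r =
      Complex.exp (Complex.I * θ) * (hamAvg a U₁ u r.fst * gaussAvg a v r.snd +
        gaussAvg a u r.fst * hamAvg a U₂ v r.snd +
        c * (gaussAvg a u r.fst * gaussAvg a v r.snd)) := by
  rw [hamAvg_congr (coeFn_phaseTensor θ u v),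
    hamAvg_eucProd a (fun z => U₁ z.1 + U₂ z.2 + c)
      (fun z => Complex.exp (Complex.I * θ) * (u z.1 * v z.2)) r,
    gaussAvg, gaussAvg, hamAvg, hamAvg, ← integral_prod_mul, ← integral_prod_mul,
    ← integral_prod_mul, ← integral_const_mul (c : ℂ)]
  have i1 := integrable_hamAvg ha h₁ u r.fst
  have i2 := integrable_hamAvg ha h₂ v r.snd
  have i3 := integrable_gauss_mul ha u r.fst
  have i4 := integrable_gauss_mul ha v r.snd
  have j1 := i1.mul_prod i4
  have j2 := i3.mul_prod i2
  have j3 := (i3.mul_prod i4).const_mul (c : ℂ)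
  have e := integral_add (j1.add j2) j3
  simp only [Pi.add_apply] at e
  rw [← integral_add j1 j2]
  refine Eq.trans ?_ (congrArg _ e)
  rw [← integral_const_mul]
  refine integral_congr_ae (Filter.Eventually.of_forall fun z => ?_)
  push_cast
  ring

theorem norm_fst_le_eucProd (z : EucProd n d) : ‖z.ofLp.1‖ ≤ ‖z‖ := by
  refine le_of_sq_le_sq ?_ (norm_nonneg z)
  rw [WithLp.prod_norm_sq_eq_of_L2]
  exact le_add_of_nonneg_right (sq_nonneg _)

theorem norm_snd_le_eucProd (z : EucProd n d) : ‖z.ofLp.2‖ ≤ ‖z‖ := by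
  refine le_of_sq_le_sq ?_ (norm_nonneg z)
  rw [WithLp.prod_norm_sq_eq_of_L2]
  exact le_add_of_nonneg_left (sq_nonneg _)

theorem QuadPotential.comp_fst {C : ℝ} {V : Euc n → ℝ} (h : QuadPotential C V) :
    QuadPotential C fun z : EucProd n d => V z.ofLp.1 :=
  h.comp (f := fun z : EucProd n d => z.ofLp.1) (by fun_prop)
    (fun x y => norm_fst_le_eucProd (x - y)) norm_fst_le_eucProd

theorem QuadPotential.comp_snd {C : ℝ} {V : Euc d → ℝ} (h : QuadPotential C V) :
    QuadPotential C fun z : EucProd n d => V z.ofLp.2 :=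
  h.comp (f := fun z : EucProd n d => z.ofLp.2) (by fun_prop)
    (fun x y => norm_snd_le_eucProd (x - y)) norm_snd_le_eucProd

theorem QuadPotential.comp_ofLp {C : ℝ} {V : Euc n × Euc d → ℝ} (h : QuadPotential C V) :
    QuadPotential C fun z : EucProd n d => V z.ofLp := by
  have hn : ∀ z : EucProd n d, ‖z.ofLp‖ ≤ ‖z‖ := fun z =>
    max_le (norm_fst_le_eucProd z) (norm_snd_le_eucProd z)
  exact h.comp (f := fun z : EucProd n d => z.ofLp) (by fun_prop) (fun x y => hn (x - y)) hn

theorem quadPotential_const {F : Type*} [NormedAddCommGroup F] (c : ℝ) :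
    QuadPotential |c| fun _ : F => c where
  continuous := continuous_const
  bound x := le_mul_of_one_le_right (abs_nonneg _) (one_le_pow₀ (by linarith [norm_nonneg x]))
  lip x y := by
    rw [sub_self, abs_zero]
    positivity

/-- The Gaussian average of the ansatz is a product of three scalar functions of time, so the
ordinary product rule applies. The phase acts as the constant potential −c, and the mismatch with V
becomes the source. -/
theorem weakEqAt_phaseTensor {C C₁ C₂ : ℝ} {U₁ : Euc n → ℝ} {U₂ : Euc d → ℝ}
    {V : EucProd n d → ℝ} (hV : QuadPotential C V)
    (h₁ : QuadPotential C₁ U₁) (h₂ : QuadPotential C₂ U₂) {θ : ℝ → ℝ} {c t : ℝ}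
    (hθ : HasDerivAt θ c t) {u : ℝ → LTwo (Euc n)} {v : ℝ → LTwo (Euc d)}
    (hu : WeakEqAt U₁ 0 u t) (hv : WeakEqAt U₂ 0 v t) :
    WeakEqAt V (fun z : EucProd n d =>
        ((U₁ z.ofLp.1 + U₂ z.ofLp.2 + -c - V z : ℝ) : ℂ) * phaseTensor (θ t) (u t) (v t) z)
      (fun s => phaseTensor (θ s) (u s) (v s)) t := by
  intro a ha r
  have h1 := hu a ha r.fst
  have h2 := hv a ha r.snd
  rw [gaussAvg_zero, add_zero] at h1 h2
  rw [gaussAvg_potential_sub ha hV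
    ((h₁.comp_fst.add h₂.comp_snd).add (quadPotential_const (-c))),
    hamAvg_phaseTensor ha h₁ h₂]
  simp_rw [gaussAvg_phaseTensor]
  have h3 : HasDerivAt (fun s => Complex.exp (Complex.I * θ s))
      (Complex.exp (Complex.I * θ t) * (Complex.I * c)) t :=
    (hθ.ofReal_comp.const_mul Complex.I).cexp
  refine (h3.mul (h1.mul h2)).congr_deriv ?_
  simp only [Pi.mul_apply]
  push_cast
  ring

theorem continuous_phaseTensor {θ : ℝ → ℝ} (hθ : Continuous θ) {u : ℝ → LTwo (Euc n)}
    {v : ℝ → LTwo (Euc d)} (hu : Continuous u) (hv : Continuous v) :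
    Continuous fun t => phaseTensor (θ t) (u t) (v t) := by
  have h1 : Continuous fun t => Complex.exp (Complex.I * θ t) := by fun_prop
  exact continuous_toEucProd.comp (h1.smul (continuous_tensorLp hu hv))

theorem sourceBound_mul {F : Type*} [NormedAddCommGroup F] [InnerProductSpace ℝ F]
    [FiniteDimensional ℝ F] [MeasurableSpace F] [BorelSpace F] {C D : ℝ} {Q : F → ℝ}
    (hQ : Continuous Q) (hC : 0 ≤ C) (hb : ∀ x, |Q x| ≤ C * (1 + ‖x‖) ^ 2) (w : LTwo F)
    (hw : ‖w‖ ≤ D) :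
    SourceBound (C * D) fun x => (Q x : ℂ) * w x where
  meas := (Complex.continuous_ofReal.comp hQ).aestronglyMeasurable.mul (Lp.aestronglyMeasurable w)
  bound := by
    refine ⟨(C : ℂ) • w, ?_, ?_⟩
    · rw [norm_smul, Complex.norm_real, Real.norm_of_nonneg hC]
      gcongr
    · filter_upwards [Lp.coeFn_smul (C : ℂ) w] with x hx
      rw [hx, Pi.smul_apply, norm_smul, norm_mul, Complex.norm_real, Complex.norm_real,
        Real.norm_of_nonneg hC, Real.norm_eq_abs]
      calc |Q x| * ‖w x‖ ≤ C * (1 + ‖x‖) ^ 2 * ‖w x‖ := by gcongr; exact hb x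
        _ = _ := by ring

/-- The error of a phase-corrected product ansatz is controlled by the residual potential. -/
theorem eLpNorm_sub_tensor_le {V₁ : Euc n → ℝ} {V₂ : Euc d → ℝ} {W : Euc n × Euc d → ℝ}
    (hV₁ : AtMostQuadratic V₁) (hV₂ : AtMostQuadratic V₂) (hW : AtMostQuadratic W)
    {u₀ : Euc n → ℂ} {v₀ : Euc d → ℂ} {ψ : ℝ → LTwo (Euc n × Euc d)}
    (hψ : IsSchrodingerSolution (fun _ => fullHamiltonian V₁ V₂ W)
      (fun z => u₀ z.1 * v₀ z.2) ψ)
    {A₁ : ℝ → Euc n → ℝ} {A₂ : ℝ → Euc d → ℝ}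
    {u : ℝ → LTwo (Euc n)} {v : ℝ → LTwo (Euc d)}
    (hu : IsSchrodingerSolution (fun t => schrodingerOp fun x => V₁ x + A₁ t x) u₀ u)
    (hv : IsSchrodingerSolution (fun t => schrodingerOp fun y => V₂ y + A₂ t y) v₀ v)
    (hA₁ : ∀ T : ℝ, ∃ C, ∀ t ∈ Ioo (-T) T, QuadPotential C (A₁ t))
    (hA₂ : ∀ T : ℝ, ∃ C, ∀ t ∈ Ioo (-T) T, QuadPotential C (A₂ t))
    {θ c : ℝ → ℝ} (hθ : ∀ t, HasDerivAt θ (c t) t) (hθ₀ : θ 0 = 0) (hc : Continuous c)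
    {β : ℝ → ℝ≥0∞} (hβ : Measurable β)
    (hBβ : ∀ t, eLpNorm (fun z : Euc n × Euc d =>
      ((W z - A₁ t z.1 - A₂ t z.2 + c t : ℝ) : ℂ) * (u t z.1 * v t z.2)) 2 volume ≤ β t)
    {t : ℝ} (ht : 0 ≤ t) :
    eLpNorm (fun z => ψ t z - Complex.exp (Complex.I * θ t) * (u t z.1 * v t z.2)) 2 volume ≤
      ∫⁻ s in Icc 0 t, β s := by
  have hθc : Continuous θ := continuous_iff_continuousAt.2 fun t => (hθ t).continuousAt
  obtain ⟨K₁, hK₁⟩ := hV₁.exists_quadPotential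
  obtain ⟨K₂, hK₂⟩ := hV₂.exists_quadPotential
  obtain ⟨K, hK⟩ := hW.exists_quadPotential
  -- The open window of radius t + 1 contains [0, t], and all constants are uniform on it.
  obtain ⟨B₁, hB₁⟩ := hA₁ (t + 1)
  obtain ⟨B₂, hB₂⟩ := hA₂ (t + 1)
  set Vf : EucProd n d → ℝ := fun z => V₁ z.ofLp.1 + V₂ z.ofLp.2 + W z.ofLp with hVf
  have hVq : QuadPotential (K₁ + K₂ + K) Vf :=
    (hK₁.comp_fst.add hK₂.comp_snd).add hK.comp_ofLp
  set w : ℝ → LTwo (EucProd n d) := fun s => phaseTensor (θ s) (u s) (v s) with hw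
  have hwc : Continuous w := continuous_phaseTensor hθc hu.continuous hv.continuous
  obtain ⟨D, hD⟩ := (isCompact_Icc (a := -(t + 1)) (b := t + 1)).exists_bound_of_continuousOn
    hwc.continuousOn
  obtain ⟨c₀, hc₀⟩ := (isCompact_Icc (a := -(t + 1)) (b := t + 1)).exists_bound_of_continuousOn
    hc.continuousOn
  set Q : ℝ → EucProd n d → ℝ := fun s z =>
    (V₁ z.ofLp.1 + A₁ s z.ofLp.1) + (V₂ z.ofLp.2 + A₂ s z.ofLp.2) + -c s with hQdef
  have hQ : ∀ s ∈ Ioo (-(t + 1)) (t + 1),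
      QuadPotential (K₁ + B₁ + (K₂ + B₂) + |-c s|) (Q s) := fun s hs =>
    ((hK₁.add (hB₁ s hs)).comp_fst.add (hK₂.add (hB₂ s hs)).comp_snd).add (quadPotential_const _)
  set S : ℝ → EucProd n d → ℂ := fun s z => ((Q s z - Vf z : ℝ) : ℂ) * w s z with hS
  have hw_eq : ∀ s ∈ Ioo (-(t + 1)) (t + 1), WeakEqAt Vf (S s) w s := fun s hs =>
    weakEqAt_phaseTensor hVq (hK₁.add (hB₁ s hs)) (hK₂.add (hB₂ s hs)) (hθ s)
      (hu.weakEqAt s) (hv.weakEqAt s)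
  set E : ℝ := K₁ + B₁ + (K₂ + B₂) + c₀ + (K₁ + K₂ + K) with hE
  have h0 : (0 : ℝ) ∈ Ioo (-(t + 1)) (t + 1) := ⟨by linarith, by linarith⟩
  have hE0 : 0 ≤ E := by
    have := (hQ 0 h0).nonneg
    have := hVq.nonneg
    have h3 := hc₀ 0 (Ioo_subset_Icc_self h0)
    rw [Real.norm_eq_abs, ← abs_neg] at h3
    linarith
  have hSb : ∀ s ∈ Ioo (-(t + 1)) (t + 1), SourceBound (E * D) (-S s) := by
    intro s hs
    have h1 := sourceBound_mul (Q := fun z => Q s z - Vf z)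
      ((hQ s hs).continuous.sub hVq.continuous) hE0 (fun z => by
        refine (abs_sub _ _).trans ?_
        have h3 := hc₀ s (Ioo_subset_Icc_self hs)
        rw [Real.norm_eq_abs, ← abs_neg] at h3
        have h4 := (hQ s hs).bound z
        have h5 := hVq.bound z
        have h6 : |-c s| * (1 + ‖z‖) ^ 2 ≤ c₀ * (1 + ‖z‖) ^ 2 := by gcongr
        rw [hE]
        linarith) (w s) (hD s (Ioo_subset_Icc_self hs))
    obtain ⟨f, hf, hf'⟩ := h1.bound
    exact ⟨h1.meas.neg, f, hf, hf'.mono fun x hx => by rw [Pi.neg_apply, norm_neg]; exact hx⟩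
  have hSβ : ∀ s ∈ Ioo (-(t + 1)) (t + 1), eLpNorm (-S s) 2 volume ≤ β s := fun s hs => by
    rw [eLpNorm_neg]
    refine le_trans (le_of_eq ?_) (hBβ s)
    rw [← eLpNorm_comp_measurePreserving (g := fun z : Euc n × Euc d =>
      ((W z - A₁ s z.1 - A₂ s z.2 + c s : ℝ) : ℂ) * (u s z.1 * v s z.2)) ?_
      (measurePreserving_ofLp_eucProd (n := n) (d := d))]
    swap
    · have h1 := hK.continuous
      have h2 := (hB₁ s hs).continuous
      have h3 := (hB₂ s hs).continuous
      have h4 : Continuous fun z : Euc n × Euc d =>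
          ((W z - A₁ s z.1 - A₂ s z.2 + c s : ℝ) : ℂ) := by fun_prop
      exact h4.aestronglyMeasurable.mul
        (memLp_tensor (Lp.memLp (u s)) (Lp.memLp (v s))).aestronglyMeasurable
    refine eLpNorm_congr_norm_ae ?_
    filter_upwards [coeFn_phaseTensor (θ s) (u s) (v s)] with z hz
    simp only [hS, hw, Function.comp_apply, hz, norm_mul, norm_exp_I_mul, one_mul,
      Complex.norm_real, Real.norm_eq_abs]
    congr 1
    rw [← abs_neg]
    congr 1
    simp only [hQdef, hVf]
    ring
  -- The energy estimate is applied to the error itself, which starts at zero and carries the source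
  -- −S.
  have key := abs_norm_sub_norm_le_lintegral
    (u := fun s => toEucProd (ψ s) - w s) ((continuous_toEucProd.comp hψ.continuous).sub hwc)
    (V := fun _ => Vf) (C := max (K₁ + K₂ + K) (E * D)) (S := fun s => -S s)
    (fun s _ => hVq.mono (le_max_left _ _))
    (fun s hs => ⟨(hSb s hs).meas, by
      obtain ⟨f, hf, hf'⟩ := (hSb s hs).bound
      exact ⟨f, hf.trans (le_max_right _ _), hf'⟩⟩)
    (fun s hs => (hψ.weakEqAt_prod s).sub hVq (hw_eq s hs)) hβ hSβ ht h0
    ⟨by linarith, by linarith⟩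
  have hψ0 : ψ 0 = Complex.exp (Complex.I * θ 0) • tensorLp (u 0) (v 0) := by
    refine Lp.ext ?_
    filter_upwards [hψ.initial, coeFn_phase_smul (θ 0) (u 0) (v 0), ae_fst hu.initial,
      ae_snd hv.initial] with z h1 h2 h3 h4
    rw [h1, h2, h3, h4, hθ₀]
    simp
  have e0 : toEucProd (ψ 0) - w 0 = 0 := by
    rw [hw, hψ0]
    exact sub_self _
  have et : toEucProd (ψ t) - w t =
      toEucProd (ψ t - Complex.exp (Complex.I * θ t) • tensorLp (u t) (v t)) := by
    rw [hw]
    exact (map_sub (Lp.compMeasurePreservingₗ ℂ _ measurePreserving_ofLp_eucProd) _ _).symm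
  simp only [e0, et, norm_zero, sub_zero, abs_norm, norm_toEucProd, ofReal_norm] at key
  refine le_trans (le_of_eq ?_) key
  rw [Lp.enorm_def]
  refine eLpNorm_congr_ae ?_
  filter_upwards [Lp.coeFn_sub (ψ t) (Complex.exp (Complex.I * θ t) • tensorLp (u t) (v t)),
    coeFn_phase_smul (θ t) (u t) (v t)] with z h1 h2
  rw [h1, Pi.sub_apply, h2]

end TensorEq

/-! ### Conservation of the L² norm. -/

section Conservation

theorem sourceBound_zero {F : Type*} [NormedAddCommGroup F] [InnerProductSpace ℝ F]
    [FiniteDimensional ℝ F] [MeasurableSpace F] [BorelSpace F] {C : ℝ} (hC : 0 ≤ C) :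
    SourceBound C (0 : F → ℂ) where
  meas := aestronglyMeasurable_zero
  bound := ⟨0, by simpa using hC, Filter.Eventually.of_forall fun x => by
    rw [Pi.zero_apply, norm_zero]
    positivity⟩

theorem IsSchrodingerSolution.norm_eq_of_le {N : ℕ} {V : ℝ → Euc N → ℝ} {u₀ : Euc N → ℂ}
    {u : ℝ → LTwo (Euc N)} (h : IsSchrodingerSolution (fun t => schrodingerOp (V t)) u₀ u)
    {t₀ t₁ C : ℝ} (hV : ∀ t ∈ Ioo t₀ t₁, QuadPotential C (V t)) {s t : ℝ} (hst : s ≤ t)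
    (hs : s ∈ Ioo t₀ t₁) (ht : t ∈ Ioo t₀ t₁) : ‖u t‖ = ‖u s‖ := by
  have h1 := abs_norm_sub_norm_le_lintegral h.continuous hV
    (S := fun _ => 0) (fun t ht => sourceBound_zero (hV t ht).nonneg) (fun t _ => h.weakEqAt t)
    (β := 0) measurable_const (fun t _ => by simp) hst hs ht
  simp only [Pi.zero_apply, lintegral_zero, nonpos_iff_eq_zero, ENNReal.ofReal_eq_zero] at h1
  exact sub_eq_zero.1 (abs_nonpos_iff.1 h1)

theorem IsSchrodingerSolution.norm_eq {N : ℕ} {V : ℝ → Euc N → ℝ} {u₀ : Euc N → ℂ}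
    {u : ℝ → LTwo (Euc N)} (h : IsSchrodingerSolution (fun t => schrodingerOp (V t)) u₀ u)
    {t₀ t₁ C : ℝ} (hV : ∀ t ∈ Ioo t₀ t₁, QuadPotential C (V t)) {s t : ℝ}
    (hs : s ∈ Ioo t₀ t₁) (ht : t ∈ Ioo t₀ t₁) : ‖u t‖ = ‖u s‖ :=
  (le_total s t).elim (fun hst => h.norm_eq_of_le hV hst hs ht)
    fun hst => (h.norm_eq_of_le hV hst ht hs).symm

theorem eLpNorm_coe_eq_enorm {Z : Type*} [MeasureSpace Z] (u : LTwo Z) :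
    eLpNorm u 2 volume = ‖u‖ₑ := (Lp.enorm_def u).symm

theorem eLpNorm_eq_of_norm_eq {Z : Type*} [NormedAddCommGroup Z] [NormedSpace ℝ Z]
    [MeasureSpace Z] {H : ℝ → (Z → ℂ) → Z → ℂ} {u₀ : Z → ℂ} {u : ℝ → LTwo Z}
    (h : IsSchrodingerSolution H u₀ u) {t : ℝ} (ht : ‖u t‖ = ‖u 0‖) :
    eLpNorm (u t) 2 volume = eLpNorm u₀ 2 volume := by
  rw [← eLpNorm_congr_ae h.initial, eLpNorm_coe_eq_enorm, eLpNorm_coe_eq_enorm, ← ofReal_norm, ht,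
    ofReal_norm]

end Conservation

/-! ### Measurability in time of moments, and weighted tensor bounds. -/

section Moments

/-- Representatives are chosen separately at each time, so joint measurability is not at hand. For
an indicator, restriction is a continuous map on L², so the integral is a constant multiple of a
continuous function of time; sums and monotone limits give the rest. -/
theorem measurable_lintegral_mul_enorm_sq {Z : Type*} [MeasureSpace Z] {u : ℝ → LTwo Z}
    (hu : Continuous u) {f : Z → ℝ≥0∞} (hf : Measurable f) :
    Measurable fun s => ∫⁻ z, f z * ‖u s z‖ₑ ^ 2 := by
  have hm : ∀ s, AEMeasurable (fun z => ‖u s z‖ₑ ^ 2) volume := fun s =>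
    (Lp.aestronglyMeasurable (u s)).enorm.pow_const 2
  refine Measurable.ennreal_induction
    (motive := fun f : Z → ℝ≥0∞ => Measurable fun s => ∫⁻ z, f z * ‖u s z‖ₑ ^ 2)
    (fun c A hA => ?_) (fun f g _ hf hg h1 h2 => ?_) (fun f hf hmono h1 => ?_) hf
  · have h : (fun s => ∫⁻ z, A.indicator (fun _ => c) z * ‖u s z‖ₑ ^ 2) = fun s =>
        c * ‖LpToLpRestrictCLM Z ℂ ℂ volume 2 A (u s)‖ₑ ^ 2 := by
      ext s
      rw [Lp.enorm_def, eLpNorm_congr_ae (LpToLpRestrictCLM_coeFn ℂ A (u s)), eLpNorm_two_sq,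
        ← lintegral_const_mul'' _ (hm s).restrict, ← lintegral_indicator hA]
      refine lintegral_congr fun z => ?_
      by_cases hz : z ∈ A <;> simp [hz]
    rw [h]
    have hc : Continuous fun s => LpToLpRestrictCLM Z ℂ ℂ volume 2 A (u s) :=
      (LpToLpRestrictCLM Z ℂ ℂ volume 2 A).continuous.comp hu
    exact (hc.enorm.measurable.pow_const 2).const_mul c
  · have h : (fun s => ∫⁻ z, (f + g) z * ‖u s z‖ₑ ^ 2) = fun s =>
        (∫⁻ z, f z * ‖u s z‖ₑ ^ 2) + ∫⁻ z, g z * ‖u s z‖ₑ ^ 2 := by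
      ext s
      rw [← lintegral_add_left' (f := fun z => f z * ‖u s z‖ₑ ^ 2) (hf.aemeasurable.mul (hm s))]
      simp [add_mul]
    rw [h]
    exact h1.add h2
  · dsimp only
    have h : (fun s => ∫⁻ z, (⨆ k, f k z) * ‖u s z‖ₑ ^ 2) = fun s =>
        ⨆ k, ∫⁻ z, f k z * ‖u s z‖ₑ ^ 2 := by
      ext s
      rw [← lintegral_iSup' (f := fun k z => f k z * ‖u s z‖ₑ ^ 2)
        (fun k => (hf k).aemeasurable.mul (hm s))
        (Filter.Eventually.of_forall fun z i j hij => mul_le_mul_left (hmono hij z) _)]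
      simp [ENNReal.iSup_mul]
    rw [h]
    exact Measurable.iSup h1

theorem measurable_momentNorm {N : ℕ} {u : ℝ → LTwo (Euc N)} (hu : Continuous u) :
    Measurable fun s => momentNorm (u s) := by
  have h := measurable_lintegral_mul_enorm_sq hu (f := fun z : Euc N => ‖z‖ₑ ^ 2) (by fun_prop)
  have e : (fun s => momentNorm (u s)) = fun s =>
      (∫⁻ z, ‖z‖ₑ ^ 2 * ‖u s z‖ₑ ^ 2) ^ (1 / 2 : ℝ) := by
    ext s
    rw [momentNorm]
    have h1 := eLpNorm_two_sq (μ := (volume : Measure (Euc N))) (fun z => (‖z‖ : ℂ) * u s z)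
    simp only [enorm_mul, mul_pow] at h1
    have h2 : ∀ z : Euc N, ‖(‖z‖ : ℂ)‖ₑ = ‖z‖ₑ := fun z => by
      rw [← ofReal_norm, Complex.norm_real, norm_norm, ofReal_norm]
    simp only [h2] at h1
    rw [← h1, ← ENNReal.rpow_natCast, ← ENNReal.rpow_mul]
    norm_num
  rw [e]
  exact h.pow_const _

/-- A potential dominated by a product of weights, tested on a tensor product. -/
theorem eLpNorm_mul_tensor_le {n d : ℕ} {B : Euc n × Euc d → ℝ} {k : ℝ} {p : Euc n → ℝ}
    {q : Euc d → ℝ} (hp : Continuous p) (hq : Continuous q)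
    (hB : ∀ z, |B z| ≤ k * |p z.1 * q z.2|) (u : LTwo (Euc n)) (v : LTwo (Euc d)) :
    eLpNorm (fun z : Euc n × Euc d => (B z : ℂ) * (u z.1 * v z.2)) 2 volume ≤
      ENNReal.ofReal k * (eLpNorm (fun x => (p x : ℂ) * u x) 2 volume *
        eLpNorm (fun y => (q y : ℂ) * v y) 2 volume) := by
  have hpu : AEStronglyMeasurable (fun x => (p x : ℂ) * u x) volume :=
    (Complex.continuous_ofReal.comp hp).aestronglyMeasurable.mul (Lp.aestronglyMeasurable u)
  have hqv : AEStronglyMeasurable (fun y => (q y : ℂ) * v y) volume :=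
    (Complex.continuous_ofReal.comp hq).aestronglyMeasurable.mul (Lp.aestronglyMeasurable v)
  rw [← eLpNorm_tensor hpu hqv]
  refine eLpNorm_le_mul_eLpNorm_of_ae_le_mul (Filter.Eventually.of_forall fun z => ?_) 2
  have h := hB z
  rw [norm_mul, Complex.norm_real, Real.norm_eq_abs]
  refine (mul_le_mul_of_nonneg_right h (norm_nonneg _)).trans (le_of_eq ?_)
  simp only [norm_mul, Complex.norm_real, Real.norm_eq_abs, abs_mul]
  ring

end Moments

/-! ### The brute-force bounds. -/

section BruteForce

variable {n d : ℕ}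

theorem QuadPotential.slice_left {C : ℝ} {W : Euc n × Euc d → ℝ} (h : QuadPotential C W) :
    QuadPotential C fun x : Euc n => W (x, 0) := by
  refine h.comp (f := fun x : Euc n => (x, (0 : Euc d))) (by fun_prop) (fun x y => ?_) fun x => ?_
  · simp [Prod.norm_def]
  · simp [Prod.norm_def]

theorem QuadPotential.slice_right {C : ℝ} {W : Euc n × Euc d → ℝ} (h : QuadPotential C W) :
    QuadPotential C fun y : Euc d => W (0, y) := by
  refine h.comp (f := fun y : Euc d => ((0 : Euc n), y)) (by fun_prop) (fun x y => ?_) fun x => ?_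
  · simp [Prod.norm_def]
  · simp [Prod.norm_def]

variable {V₁ : Euc n → ℝ} {V₂ : Euc d → ℝ} {W : Euc n × Euc d → ℝ}
  {u₀ : Euc n → ℂ} {v₀ : Euc d → ℂ} {ψ : ℝ → LTwo (Euc n × Euc d)}
  {u : ℝ → LTwo (Euc n)} {v : ℝ → LTwo (Euc d)}

/-- The phase t W(0,0) supplies the fourth term that completes the residual to a second difference.
-/
theorem IsBruteForceSolution.eLpNorm_sub_le (hV₁ : AtMostQuadratic V₁) (hV₂ : AtMostQuadratic V₂)
    (hW : AtMostQuadratic W)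
    (hψ : IsSchrodingerSolution (fun _ => fullHamiltonian V₁ V₂ W)
      (fun z => u₀ z.1 * v₀ z.2) ψ)
    (h : IsBruteForceSolution V₁ V₂ W u₀ v₀ u v) {β : ℝ → ℝ≥0∞} (hβ : Measurable β)
    (hBβ : ∀ t, eLpNorm (fun z : Euc n × Euc d =>
      ((W z - W (z.1, 0) - W (0, z.2) + W (0, 0) : ℝ) : ℂ) * (u t z.1 * v t z.2)) 2 volume ≤ β t)
    {t : ℝ} (ht : 0 ≤ t) :
    eLpNorm (fun z => ψ t z - bruteForceApprox W u v t z) 2 volume ≤ ∫⁻ s in Icc 0 t, β s := by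
  obtain ⟨K, hK⟩ := hW.exists_quadPotential
  have h1 := eLpNorm_sub_tensor_le hV₁ hV₂ hW hψ (A₁ := fun _ x => W (x, 0))
    (A₂ := fun _ y => W (0, y)) h.eq_x h.eq_y (fun _ => ⟨K, fun _ _ => hK.slice_left⟩)
    (fun _ => ⟨K, fun _ _ => hK.slice_right⟩) (θ := fun t => t * W (0, 0))
    (c := fun _ => W (0, 0)) (fun t => by simpa using (hasDerivAt_id t).mul_const (W (0, 0)))
    (by simp) continuous_const hβ hBβ ht
  refine le_trans (le_of_eq ?_) h1
  congr 1
  ext z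
  rw [bruteForceApprox]
  push_cast
  ring_nf

/-- The second difference is a difference of two y-increments, each at most the gradient bound times
|y|; hence the 2. The x-factor is the norm of φˣ, which is conserved. -/
theorem IsBruteForceSolution.eLpNorm_sub_le_gradY (hV₁ : AtMostQuadratic V₁)
    (hV₂ : AtMostQuadratic V₂) (hW : AtMostQuadratic W)
    (hgradY : ∃ C : ℝ, ∀ z, ‖gradY W z‖ ≤ C)
    (hψ : IsSchrodingerSolution (fun _ => fullHamiltonian V₁ V₂ W)
      (fun z => u₀ z.1 * v₀ z.2) ψ)
    (h : IsBruteForceSolution V₁ V₂ W u₀ v₀ u v) {t : ℝ} (ht : 0 ≤ t) :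
    eLpNorm (fun z => ψ t z - bruteForceApprox W u v t z) 2 volume ≤
      2 * eLpNorm (gradY W) ⊤ volume * eLpNorm u₀ 2 volume *
        ∫⁻ s in Icc 0 t, momentNorm (v s) := by
  set G := eLpNorm (gradY W) ⊤ volume with hG
  have hG' : G ≠ ⊤ := eLpNorm_gradY_ne_top hW hgradY
  have hm := measurable_momentNorm h.eq_y.continuous
  rw [← lintegral_const_mul _ hm]
  refine h.eLpNorm_sub_le hV₁ hV₂ hW hψ (hm.const_mul _) (fun s => ?_) ht
  obtain ⟨K₁, hK₁⟩ := hV₁.exists_quadPotential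
  obtain ⟨K, hK⟩ := hW.exists_quadPotential
  have hcons : ‖u s‖ = ‖u 0‖ := h.eq_x.norm_eq (t₀ := -(|s| + 1)) (t₁ := |s| + 1)
    (fun _ _ => hK₁.add hK.slice_left) ⟨by linarith [abs_nonneg s], by linarith [abs_nonneg s]⟩
    ⟨by linarith [neg_abs_le s], by linarith [le_abs_self s]⟩
  rw [← eLpNorm_eq_of_norm_eq h.eq_x hcons]
  refine (eLpNorm_mul_tensor_le (k := 2 * G.toReal) (p := fun _ => 1) (q := fun y => ‖y‖)
    continuous_const continuous_norm (fun z => ?_) (u s) (v s)).trans (le_of_eq ?_)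
  · have h1 := abs_sub_le_gradY hW hgradY z.1 z.2 0
    have h2 := abs_sub_le_gradY hW hgradY 0 z.2 0
    rw [sub_zero] at h1 h2
    rw [one_mul, abs_norm]
    calc |W z - W (z.1, 0) - W (0, z.2) + W (0, 0)|
        = |(W (z.1, z.2) - W (z.1, 0)) - (W (0, z.2) - W (0, 0))| := by
          congr 1; ring
      _ ≤ G.toReal * ‖z.2‖ + G.toReal * ‖z.2‖ := (abs_sub _ _).trans (add_le_add h1 h2)
      _ = _ := by ring
  · rw [ENNReal.ofReal_mul zero_le_two, ENNReal.ofReal_toReal hG']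
    simp only [Complex.ofReal_one, one_mul, momentNorm, ENNReal.ofReal_ofNat]
    ring

theorem IsBruteForceSolution.eLpNorm_sub_le_gradXGradY (hV₁ : AtMostQuadratic V₁)
    (hV₂ : AtMostQuadratic V₂) (hW : AtMostQuadratic W)
    (hψ : IsSchrodingerSolution (fun _ => fullHamiltonian V₁ V₂ W)
      (fun z => u₀ z.1 * v₀ z.2) ψ)
    (h : IsBruteForceSolution V₁ V₂ W u₀ v₀ u v) {t : ℝ} (ht : 0 ≤ t) :
    eLpNorm (fun z => ψ t z - bruteForceApprox W u v t z) 2 volume ≤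
      eLpNorm (gradXGradY W) ⊤ volume *
        ∫⁻ s in Icc 0 t, momentNorm (u s) * momentNorm (v s) := by
  set M := eLpNorm (gradXGradY W) ⊤ volume with hM
  have hM' : M ≠ ⊤ := eLpNorm_gradXGradY_ne_top hW
  have hm : Measurable fun s => momentNorm (u s) * momentNorm (v s) :=
    (measurable_momentNorm h.eq_x.continuous).mul (measurable_momentNorm h.eq_y.continuous)
  rw [← lintegral_const_mul _ hm]
  refine h.eLpNorm_sub_le hV₁ hV₂ hW hψ (hm.const_mul _) (fun s => ?_) ht
  refine (eLpNorm_mul_tensor_le (k := M.toReal) (p := fun x => ‖x‖) (q := fun y => ‖y‖)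
    continuous_norm continuous_norm (fun z => ?_) (u s) (v s)).trans (le_of_eq ?_)
  · have h1 := abs_mixed_sub_le hW z.1 0 z.2 0
    rw [sub_zero, sub_zero] at h1
    rw [abs_mul, abs_norm, abs_norm]
    refine le_trans (le_of_eq ?_) h1
    congr 1
    ring
  · rw [ENNReal.ofReal_toReal hM']
    rfl

end BruteForce

/-! ### Continuous weighted L² curves from Σ¹ solutions. -/

section Weighted

variable {N : ℕ}

theorem norm_le_sum_abs (z : Euc N) : ‖z‖ ≤ ∑ j, ‖z j‖ := by
  conv_lhs => rw [← (EuclideanSpace.basisFun (Fin N) ℝ).sum_repr z]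
  refine (norm_sum_le _ _).trans (Finset.sum_le_sum fun j _ => ?_)
  rw [norm_smul, (EuclideanSpace.basisFun (Fin N) ℝ).orthonormal.1 j, mul_one]
  simp

theorem norm_weight_mul_le {f : Euc N → ℂ} {m : Fin N → Euc N → ℂ} {z : Euc N}
    (h : ∀ j, m j z = (z j : ℂ) * f z) :
    ‖((1 + ‖z‖ : ℝ) : ℂ) * f z‖ ≤ ‖f z‖ + ∑ j, ‖m j z‖ := by
  simp only [h, norm_mul, Complex.norm_real]
  rw [← Finset.sum_mul, Real.norm_of_nonneg (by positivity), add_mul, one_mul]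
  gcongr
  exact norm_le_sum_abs z

/-- Since |z| ≤ Σ |z_j|, the coordinate moments control the weight 1 + |z|, and applying the same
bound to increments gives continuity. The weighted curve bounds averages of quadratically growing
functions locally uniformly in time. -/
theorem IsContSigmaOne.exists_weighted {u : ℝ → LTwo (Euc N)} (h : IsContSigmaOne u) :
    ∃ m : ℝ → LTwo (Euc N), Continuous m ∧
      ∀ t, m t =ᵐ[volume] fun z => ((1 + ‖z‖ : ℝ) : ℂ) * u t z := by
  choose m hm hme using h.moment
  have hw : Continuous fun z : Euc N => ((1 + ‖z‖ : ℝ) : ℂ) := by fun_prop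
  have hmem : ∀ t, MemLp (fun z => ((1 + ‖z‖ : ℝ) : ℂ) * u t z) 2 volume := fun t => by
    refine MemLp.of_le (g := fun z => ‖u t z‖ + ∑ j, ‖m j t z‖)
      ((Lp.memLp (u t)).norm.add (memLp_finsetSum _ fun j _ => (Lp.memLp (m j t)).norm))
      (hw.aestronglyMeasurable.mul (Lp.aestronglyMeasurable (u t))) ?_
    filter_upwards [ae_all_iff.2 fun j => hme j t] with z hz
    refine (norm_weight_mul_le hz).trans (le_of_eq ?_)
    rw [Real.norm_of_nonneg (by positivity)]
  refine ⟨fun t => (hmem t).toLp, ?_, fun t => (hmem t).coeFn_toLp⟩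
  rw [continuous_iff_continuousAt]
  intro t
  rw [ContinuousAt, tendsto_iff_edist_tendsto_0]
  have hc : Continuous fun s => ‖u s - u t‖ₑ + ∑ j, ‖m j s - m j t‖ₑ := by
    have h1 := h.continuous
    fun_prop
  have hc0 := hc.tendsto t
  simp only [sub_self, enorm_zero, Finset.sum_const_zero, add_zero] at hc0
  refine tendsto_of_tendsto_of_tendsto_of_le_of_le tendsto_const_nhds hc0 (fun _ => zero_le)
    fun s => ?_
  rw [edist_eq_enorm_sub, ← MemLp.toLp_sub, Lp.enorm_toLp, Lp.enorm_def, Finset.sum_congr rfl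
    fun j _ => Lp.enorm_def (m j s - m j t)]
  have h1 : eLpNorm (fun z => ‖(u s - u t : LTwo (Euc N)) z‖ +
      ∑ j, ‖(m j s - m j t : LTwo (Euc N)) z‖) 2 volume ≤
      eLpNorm (u s - u t : LTwo (Euc N)) 2 volume +
        ∑ j, eLpNorm (m j s - m j t : LTwo (Euc N)) 2 volume := by
    have h3 : ∀ j, AEStronglyMeasurable (fun z => ‖(m j s - m j t : LTwo (Euc N)) z‖) volume :=
      fun j => (Lp.aestronglyMeasurable _).norm
    refine (eLpNorm_add_le (Lp.aestronglyMeasurable _).norm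
      (Finset.aestronglyMeasurable_fun_sum _ fun j _ => h3 j) one_le_two).trans ?_
    rw [eLpNorm_norm]
    gcongr
    have h2 := eLpNorm_sum_le (s := Finset.univ) (p := 2) (μ := (volume : Measure (Euc N)))
      (f := fun j z => ‖(m j s - m j t : LTwo (Euc N)) z‖) (fun j _ => h3 j) one_le_two
    simp only [eLpNorm_norm] at h2
    refine le_trans (le_of_eq ?_) h2
    congr 1
    ext z
    simp
  refine le_trans (eLpNorm_mono_ae ?_) h1
  filter_upwards [ae_all_iff.2 fun j => hme j t, ae_all_iff.2 fun j => hme j s,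
    Lp.coeFn_sub (u s) (u t), ae_all_iff.2 fun j => Lp.coeFn_sub (m j s) (m j t)]
    with z h1 h2 h3 h4
  have h5 := norm_weight_mul_le (f := (u s - u t : LTwo (Euc N)))
    (m := fun j => (m j s - m j t : LTwo (Euc N))) (z := z) fun j => by
      rw [h4, h3, Pi.sub_apply, Pi.sub_apply, h1, h2]
      ring
  rw [Pi.sub_apply, ← mul_sub, ← Pi.sub_apply, ← h3, Real.norm_of_nonneg (by positivity)]
  exact h5

theorem integral_norm_sq_lp {Z : Type*} [MeasureSpace Z] (u : LTwo Z) :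
    ∫ z, ‖u z‖ ^ 2 = ‖u‖ ^ 2 := by
  rw [integral_norm_sq_eq (Lp.memLp u), Lp.norm_def]

theorem integrable_norm_sq_lp {Z : Type*} [MeasureSpace Z] (u : LTwo Z) :
    Integrable fun z => ‖u z‖ ^ 2 :=
  (Lp.memLp u).integrable_norm_pow two_ne_zero

theorem integrable_weight_norm_sq {u m : LTwo (Euc N)}
    (h : m =ᵐ[volume] fun z => ((1 + ‖z‖ : ℝ) : ℂ) * u z) :
    Integrable (fun z => (1 + ‖z‖) ^ 2 * ‖u z‖ ^ 2) ∧
      ∫ z, (1 + ‖z‖) ^ 2 * ‖u z‖ ^ 2 = ‖m‖ ^ 2 := by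
  have e : (fun z => ‖m z‖ ^ 2) =ᵐ[volume] fun z => (1 + ‖z‖) ^ 2 * ‖u z‖ ^ 2 := by
    filter_upwards [h] with z hz
    rw [hz, norm_mul, Complex.norm_real, Real.norm_of_nonneg (by positivity), mul_pow]
  exact ⟨(integrable_norm_sq_lp m).congr e, by rw [← integral_congr_ae e, integral_norm_sq_lp]⟩

theorem integrable_mul_norm_sq {u m : LTwo (Euc N)}
    (h : m =ᵐ[volume] fun z => ((1 + ‖z‖ : ℝ) : ℂ) * u z) {f : Euc N → ℝ} (hf : Continuous f)
    {C : ℝ} (hb : ∀ z, |f z| ≤ C * (1 + ‖z‖) ^ 2) :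
    Integrable (fun z => f z * ‖u z‖ ^ 2) ∧ |∫ z, f z * ‖u z‖ ^ 2| ≤ C * ‖m‖ ^ 2 := by
  obtain ⟨h1, h2⟩ := integrable_weight_norm_sq h
  have hpt : ∀ z, ‖f z * ‖u z‖ ^ 2‖ ≤ C * ((1 + ‖z‖) ^ 2 * ‖u z‖ ^ 2) := fun z => by
    rw [norm_mul, Real.norm_eq_abs, norm_pow, norm_norm, ← mul_assoc]
    gcongr
    exact hb z
  refine ⟨(h1.const_mul C).mono'
    (hf.aestronglyMeasurable.mul ((Lp.aestronglyMeasurable u).norm.pow 2))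
    (Filter.Eventually.of_forall hpt), ?_⟩
  rw [← h2, ← integral_const_mul]
  exact norm_integral_le_of_norm_le (h1.const_mul C) (Filter.Eventually.of_forall hpt)

end Weighted

/-! ### Partial averages of W, and the mean-field residual. -/

section Averages

variable {n d : ℕ}

theorem one_add_norm_prod_le (x : Euc n) (y : Euc d) : 1 + ‖(x, y)‖ ≤ (1 + ‖x‖) * (1 + ‖y‖) := by
  have hx := norm_nonneg x
  have hy := norm_nonneg y
  have : ‖(x, y)‖ ≤ ‖x‖ + ‖y‖ := max_le (by linarith) (by linarith)
  nlinarith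

theorem QuadPotential.abs_prod_le {K : ℝ} {W : Euc n × Euc d → ℝ} (hW : QuadPotential K W)
    (x : Euc n) (y : Euc d) : |W (x, y)| ≤ K * (1 + ‖x‖) ^ 2 * (1 + ‖y‖) ^ 2 := by
  have hK := hW.nonneg
  refine (hW.bound _).trans ?_
  rw [mul_assoc, ← mul_pow]
  gcongr
  exact one_add_norm_prod_le x y

/-- Averaging preserves the class because the growth of W in y is paid for by the second weighted
moment. In 3K, one K bounds the value at 0 and 2K bounds the increments. -/
theorem QuadPotential.avgY {K : ℝ} {W : Euc n × Euc d → ℝ} (hW : QuadPotential K W)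
    {v m : LTwo (Euc d)} (h : m =ᵐ[volume] fun z => ((1 + ‖z‖ : ℝ) : ℂ) * v z) (hv : ‖v‖ ≠ 0) :
    QuadPotential (3 * K * (‖m‖ ^ 2 / ‖v‖ ^ 2)) (avgY W v) := by
  have hK := hW.nonneg
  have hWc := hW.continuous
  have hi : ∀ x, Integrable fun y => W (x, y) * ‖v y‖ ^ 2 := fun x =>
    (integrable_mul_norm_sq h (f := fun y => W (x, y)) (by fun_prop) (hW.abs_prod_le x)).1
  have hlip : ∀ x x', |_root_.avgY W v x - _root_.avgY W v x'| ≤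
      2 * K * (‖m‖ ^ 2 / ‖v‖ ^ 2) * (‖x - x'‖ * (1 + ‖x‖ + ‖x'‖)) := fun x x' => by
    rw [_root_.avgY, _root_.avgY, ← sub_div, ← integral_sub (hi x) (hi x'), integral_norm_sq_lp,
      abs_div, abs_of_nonneg (sq_nonneg ‖v‖)]
    simp_rw [← sub_mul]
    have h2 := (integrable_mul_norm_sq h (f := fun y => W (x, y) - W (x', y)) (by fun_prop)
      (C := 2 * K * (‖x - x'‖ * (1 + ‖x‖ + ‖x'‖))) fun y => ?_).2
    · calc _ ≤ 2 * K * (‖x - x'‖ * (1 + ‖x‖ + ‖x'‖)) * ‖m‖ ^ 2 / ‖v‖ ^ 2 := by gcongr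
        _ = _ := by ring
    · have h3 := hW.lip (x, y) (x', y)
      have h4 : ‖(x, y) - (x', y)‖ = ‖x - x'‖ := by simp [Prod.norm_def]
      rw [h4] at h3
      have hx := norm_nonneg x
      have hx' := norm_nonneg x'
      have hy := norm_nonneg y
      have h5 : ‖(x, y)‖ ≤ ‖x‖ + ‖y‖ := max_le (by linarith) (by linarith)
      have h6 : ‖(x', y)‖ ≤ ‖x'‖ + ‖y‖ := max_le (by linarith) (by linarith)
      have h7 : 1 + ‖(x, y)‖ + ‖(x', y)‖ ≤ (1 + ‖x‖ + ‖x'‖) * (2 * (1 + ‖y‖) ^ 2) := by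
        nlinarith [mul_nonneg hx hy, mul_nonneg hx' hy, mul_nonneg hx (sq_nonneg ‖y‖),
          mul_nonneg hx' (sq_nonneg ‖y‖)]
      calc _ ≤ K * (‖x - x'‖ * (1 + ‖(x, y)‖ + ‖(x', y)‖)) := h3
        _ ≤ K * (‖x - x'‖ * ((1 + ‖x‖ + ‖x'‖) * (2 * (1 + ‖y‖) ^ 2))) := by gcongr
        _ = _ := by ring
  have h0 : |_root_.avgY W v 0| ≤ K * (‖m‖ ^ 2 / ‖v‖ ^ 2) := by
    have h2 := (integrable_mul_norm_sq h (f := fun y => W (0, y)) (by fun_prop)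
      (hW.abs_prod_le 0)).2
    rw [_root_.avgY, integral_norm_sq_lp, abs_div, abs_of_nonneg (sq_nonneg ‖v‖), ← mul_div_assoc]
    gcongr
    simpa using h2
  exact (quadPotential_of_lip (by positivity) hlip).mono (by linarith)

theorem QuadPotential.avgX {K : ℝ} {W : Euc n × Euc d → ℝ} (hW : QuadPotential K W)
    {u m : LTwo (Euc n)} (h : m =ᵐ[volume] fun z => ((1 + ‖z‖ : ℝ) : ℂ) * u z) (hu : ‖u‖ ≠ 0) :
    QuadPotential (3 * K * (‖m‖ ^ 2 / ‖u‖ ^ 2)) (avgX W u) := by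
  have h1 : QuadPotential K fun p : Euc d × Euc n => W (p.2, p.1) := by
    have hn : ∀ p : Euc d × Euc n, ‖(p.2, p.1)‖ ≤ ‖p‖ := fun p => by
      rw [Prod.norm_def, Prod.norm_def, max_comm]
    exact hW.comp (f := fun p : Euc d × Euc n => (p.2, p.1)) (by fun_prop)
      (fun x y => hn (x - y)) hn
  exact h1.avgY h hu

theorem integrable_mul_tensor_norm_sq {K : ℝ} {W : Euc n × Euc d → ℝ} (hW : QuadPotential K W)
    {u m : LTwo (Euc n)} {v l : LTwo (Euc d)}
    (hm : m =ᵐ[volume] fun z => ((1 + ‖z‖ : ℝ) : ℂ) * u z)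
    (hl : l =ᵐ[volume] fun z => ((1 + ‖z‖ : ℝ) : ℂ) * v z) :
    Integrable fun z : Euc n × Euc d => W z * ‖u z.1 * v z.2‖ ^ 2 := by
  refine (((integrable_weight_norm_sq hm).1.mul_prod
    (integrable_weight_norm_sq hl).1).const_mul K).mono'
    (hW.continuous.aestronglyMeasurable.mul
      ((memLp_tensor (Lp.memLp u) (Lp.memLp v)).aestronglyMeasurable.norm.pow 2))
    (Filter.Eventually.of_forall fun z => ?_)
  rw [norm_mul, norm_pow, norm_norm, norm_mul, mul_pow, Real.norm_eq_abs]
  calc |W z| * (‖u z.1‖ ^ 2 * ‖v z.2‖ ^ 2)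
      ≤ (K * (1 + ‖z.1‖) ^ 2 * (1 + ‖z.2‖) ^ 2) * (‖u z.1‖ ^ 2 * ‖v z.2‖ ^ 2) := by
        gcongr
        exact hW.abs_prod_le z.1 z.2
    _ = _ := by ring

theorem integral_tensor_norm_sq (u : LTwo (Euc n)) (v : LTwo (Euc d)) :
    ∫ z : Euc n × Euc d, ‖u z.1 * v z.2‖ ^ 2 = ‖u‖ ^ 2 * ‖v‖ ^ 2 := by
  rw [← integral_norm_sq_lp u, ← integral_norm_sq_lp v, ← integral_prod_mul]
  simp_rw [norm_mul, mul_pow]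
  rfl

/-- The residual potential of the mean-field approximation is an average of second differences. -/
theorem abs_residual_le {K : ℝ} {W : Euc n × Euc d → ℝ} (hW : QuadPotential K W)
    {u m : LTwo (Euc n)} {v l : LTwo (Euc d)}
    (hm : m =ᵐ[volume] fun z => ((1 + ‖z‖ : ℝ) : ℂ) * u z)
    (hl : l =ᵐ[volume] fun z => ((1 + ‖z‖ : ℝ) : ℂ) * v z) (hu : ‖u‖ ≠ 0) (hv : ‖v‖ ≠ 0)
    {k : ℝ} {p : Euc n → ℝ} {q : Euc d → ℝ} (hp : Integrable fun x => p x * ‖u x‖ ^ 2)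
    (hq : Integrable fun y => q y * ‖v y‖ ^ 2) (x : Euc n) (y : Euc d)
    (hk : ∀ x' y', |W (x, y) - W (x, y') - W (x', y) + W (x', y')| ≤ k * (p x' * q y')) :
    |W (x, y) - avgY W v x - avgX W u y + avgFull W u v| ≤
      k * ((∫ x', p x' * ‖u x'‖ ^ 2) / ‖u‖ ^ 2 * ((∫ y', q y' * ‖v y'‖ ^ 2) / ‖v‖ ^ 2)) := by
  have hWc := hW.continuous
  have iu := integrable_norm_sq_lp u
  have iv := integrable_norm_sq_lp v
  have i1 : Integrable fun y' => W (x, y') * ‖v y'‖ ^ 2 :=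
    (integrable_mul_norm_sq hl (f := fun y => W (x, y)) (by fun_prop) (hW.abs_prod_le x)).1
  have i2 : Integrable fun x' => W (x', y) * ‖u x'‖ ^ 2 :=
    (integrable_mul_norm_sq hm (f := fun x => W (x, y)) (by fun_prop)
      (C := K * (1 + ‖y‖) ^ 2) fun x' => (hW.abs_prod_le x' y).trans (le_of_eq (by ring))).1
  have j0 := (iu.mul_prod iv).const_mul (W (x, y))
  have j1 := iu.mul_prod i1
  have j2 := i2.mul_prod iv
  have j3 := integrable_mul_tensor_norm_sq hW hm hl
  -- After multiplication by both masses, each of the four terms is an integral over the product,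
  -- the missing variables being integrated trivially.
  have e : (W (x, y) - avgY W v x - avgX W u y + avgFull W u v) * (‖u‖ ^ 2 * ‖v‖ ^ 2) =
      ∫ z : Euc n × Euc d, (W (x, y) - W (x, z.2) - W (z.1, y) + W (z.1, z.2)) *
        (‖u z.1‖ ^ 2 * ‖v z.2‖ ^ 2) := by
    have e1 := integral_add ((j0.sub j1).sub j2) j3
    have e2 := integral_sub (j0.sub j1) j2
    have e3 := integral_sub j0 j1
    rw [integral_const_mul, integral_prod_mul (fun x => ‖u x‖ ^ 2) (fun y => ‖v y‖ ^ 2),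
      integral_prod_mul (fun x => ‖u x‖ ^ 2)
      (fun y' => W (x, y') * ‖v y'‖ ^ 2)] at e3
    rw [integral_prod_mul (fun x' => W (x', y) * ‖u x'‖ ^ 2) (fun y => ‖v y‖ ^ 2)] at e2
    simp only [Pi.sub_apply] at e1 e2 e3
    rw [e2, e3, integral_norm_sq_lp, integral_norm_sq_lp] at e1
    rw [avgY, avgX, avgFull, integral_norm_sq_lp, integral_norm_sq_lp, integral_tensor_norm_sq]
    refine Eq.trans ?_ (e1.symm.trans (integral_congr_ae (Filter.Eventually.of_forall fun z => ?_)))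
    · field_simp
      rfl
    · simp only [norm_mul]
      ring
  have hN : 0 < ‖u‖ ^ 2 * ‖v‖ ^ 2 := by positivity
  have h1 : |W (x, y) - avgY W v x - avgX W u y + avgFull W u v| * (‖u‖ ^ 2 * ‖v‖ ^ 2) ≤
      k * ((∫ x', p x' * ‖u x'‖ ^ 2) * ∫ y', q y' * ‖v y'‖ ^ 2) := by
    rw [← abs_of_pos hN, ← abs_mul, ← Real.norm_eq_abs, e, ← integral_prod_mul,
      ← integral_const_mul]
    refine norm_integral_le_of_norm_le ((hp.mul_prod hq).const_mul k)
      (Filter.Eventually.of_forall fun z => ?_)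
    rw [norm_mul, Real.norm_eq_abs, Real.norm_of_nonneg (by positivity)]
    calc _ ≤ k * (p z.1 * q z.2) * (‖u z.1‖ ^ 2 * ‖v z.2‖ ^ 2) := by gcongr; exact hk _ _
      _ = _ := by ring
  rw [← le_div_iff₀ hN] at h1
  refine h1.trans (le_of_eq ?_)
  field_simp

end Averages

/-! ### Continuity in time of the full average. -/

section Continuity

theorem abs_integral_mul_norm_sq_sub_le {Z : Type*} [MeasureSpace Z] {b : Z → ℝ} {K : ℝ}
    (hb : AEStronglyMeasurable b volume) (hbK : ∀ z, |b z| ≤ K) (f g : LTwo Z) :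
    |(∫ z, b z * ‖f z‖ ^ 2) - ∫ z, b z * ‖g z‖ ^ 2| ≤ K * (‖f - g‖ * (‖f‖ + ‖g‖)) := by
  have hi : ∀ f : LTwo Z, Integrable fun z => b z * ‖f z‖ ^ 2 := fun f =>
    (integrable_norm_sq_lp f).bdd_mul hb (Filter.Eventually.of_forall hbK)
  have hmul : ∀ f g : LTwo Z, Integrable (fun z => ‖f z‖ * ‖g z‖) ∧
      ∫ z, ‖f z‖ * ‖g z‖ ≤ ‖f‖ * ‖g‖ := fun f g => by
    refine ⟨(Lp.memLp f).norm.integrable_mul (Lp.memLp g).norm, ?_⟩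
    have h := integral_norm_mul_norm_le_sqrt (Lp.memLp f) (Lp.memLp g)
    rwa [integral_norm_sq_lp, integral_norm_sq_lp, Real.sqrt_sq (norm_nonneg _),
      Real.sqrt_sq (norm_nonneg _)] at h
  obtain ⟨i1, h1⟩ := hmul (f - g) f
  obtain ⟨i2, h2⟩ := hmul (f - g) g
  rw [← integral_sub (hi f) (hi g), ← Real.norm_eq_abs]
  refine (norm_integral_le_of_norm_le ((i1.add i2).const_mul K) ?_).trans ?_
  · filter_upwards [Lp.coeFn_sub f g] with z hz
    rw [← mul_sub, norm_mul, Real.norm_eq_abs, Pi.add_apply, hz, Pi.sub_apply]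
    have h3 : ‖‖f z‖ ^ 2 - ‖g z‖ ^ 2‖ ≤ ‖f z - g z‖ * ‖f z‖ + ‖f z - g z‖ * ‖g z‖ := by
      rw [sq_sub_sq, norm_mul, ← mul_add, mul_comm, Real.norm_eq_abs, Real.norm_eq_abs,
        abs_of_nonneg (by positivity : 0 ≤ ‖f z‖ + ‖g z‖)]
      gcongr
      exact abs_norm_sub_norm_le _ _
    exact mul_le_mul (hbK z) h3 (norm_nonneg _) ((abs_nonneg _).trans (hbK z))
  · rw [integral_const_mul]
    -- Non-negativity of K is read off at a point of Z; for empty Z both sides vanish.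
    by_cases hZ : Nonempty Z
    · have hK : 0 ≤ K := (abs_nonneg _).trans (hbK hZ.some)
      have e := integral_add i1 i2
      gcongr
      exact e.le.trans (by linarith)
    · have : IsEmpty Z := not_nonempty_iff.1 hZ
      have hf : f - g = 0 := Lp.ext (Filter.Eventually.of_forall fun z => this.elim z)
      rw [hf]
      simp [integral_of_isEmpty]

theorem continuous_integral_mul_norm_sq {Z : Type*} [MeasureSpace Z] {b : Z → ℝ} {K : ℝ}
    (hb : AEStronglyMeasurable b volume) (hbK : ∀ z, |b z| ≤ K) {f : ℝ → LTwo Z}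
    (hf : Continuous f) : Continuous fun t => ∫ z, b z * ‖f t z‖ ^ 2 := by
  rw [continuous_iff_continuousAt]
  intro t
  rw [ContinuousAt, tendsto_iff_norm_sub_tendsto_zero]
  refine squeeze_zero (fun _ => norm_nonneg _)
    (fun s => abs_integral_mul_norm_sq_sub_le hb hbK (f s) (f t)) ?_
  have : Continuous fun s => K * (‖f s - f t‖ * (‖f s‖ + ‖f t‖)) := by fun_prop
  simpa using this.tendsto t

variable {n d : ℕ}

/-- Divide W by its weight to get a bounded function and move the weight onto u and v. The integral
is then a bounded quadratic form evaluated along a continuous L² curve. Continuity makes the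
mean-field phase differentiable. -/
theorem continuous_avgFull {K : ℝ} {W : Euc n × Euc d → ℝ} (hW : QuadPotential K W)
    {u m : ℝ → LTwo (Euc n)} {v l : ℝ → LTwo (Euc d)}
    (hu : Continuous u) (hv : Continuous v) (hmc : Continuous m) (hlc : Continuous l)
    (hm : ∀ t, m t =ᵐ[volume] fun z => ((1 + ‖z‖ : ℝ) : ℂ) * u t z)
    (hl : ∀ t, l t =ᵐ[volume] fun z => ((1 + ‖z‖ : ℝ) : ℂ) * v t z)
    (hu0 : ∀ t, ‖u t‖ ≠ 0) (hv0 : ∀ t, ‖v t‖ ≠ 0) :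
    Continuous fun t => avgFull W (u t) (v t) := by
  have hWc := hW.continuous
  set b : Euc n × Euc d → ℝ := fun z => W z / ((1 + ‖z.1‖) ^ 2 * (1 + ‖z.2‖) ^ 2) with hbdef
  have hpos : ∀ z : Euc n × Euc d, 0 < (1 + ‖z.1‖) ^ 2 * (1 + ‖z.2‖) ^ 2 := fun z => by positivity
  have hb : Continuous b := hWc.div (by fun_prop) fun z => (hpos z).ne'
  have hbK : ∀ z, |b z| ≤ K := fun z => by
    rw [hbdef, abs_div, abs_of_pos (hpos z), div_le_iff₀ (hpos z), ← mul_assoc]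
    exact hW.abs_prod_le z.1 z.2
  have h1 := continuous_integral_mul_norm_sq hb.aestronglyMeasurable hbK
    (continuous_tensorLp hmc hlc)
  have e : (fun t => avgFull W (u t) (v t)) = fun t =>
      (∫ z, b z * ‖tensorLp (m t) (l t) z‖ ^ 2) / (‖u t‖ ^ 2 * ‖v t‖ ^ 2) := by
    ext t
    rw [avgFull, integral_tensor_norm_sq]
    congr 1
    refine integral_congr_ae ?_
    filter_upwards [coeFn_tensorLp (m t) (l t), ae_fst (hm t), ae_snd (hl t)] with z h2 h3 h4
    rw [h2, h3, h4]
    simp only [norm_mul, Complex.norm_real, hbdef]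
    rw [Real.norm_of_nonneg (by positivity), Real.norm_of_nonneg (by positivity)]
    have := (hpos z).ne'
    field_simp
  rw [e]
  exact h1.div (by fun_prop) fun t => mul_ne_zero (pow_ne_zero 2 (hu0 t)) (pow_ne_zero 2 (hv0 t))

end Continuity

/-! ### The mean of |x|, controlled by the first moment norm. -/

section MeanMoment

variable {N : ℕ}

/-- The mean of `|x|` for the density `|u|² / ‖u‖²`. -/
noncomputable def meanAbs (u : LTwo (Euc N)) : ℝ := (∫ x, ‖x‖ * ‖u x‖ ^ 2) / ‖u‖ ^ 2

theorem meanAbs_nonneg (u : LTwo (Euc N)) : 0 ≤ meanAbs u := by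
  refine div_nonneg (integral_nonneg fun x => ?_) (sq_nonneg _)
  dsimp only [Pi.zero_apply]
  positivity

theorem norm_le_one_mul_one_add_sq (x : Euc N) : |‖x‖| ≤ 1 * (1 + ‖x‖) ^ 2 := by
  rw [abs_norm]
  nlinarith [norm_nonneg x]

theorem integrable_add_norm_mul {u m : LTwo (Euc N)}
    (hm : m =ᵐ[volume] fun z => ((1 + ‖z‖ : ℝ) : ℂ) * u z) (hu : ‖u‖ ≠ 0) (c : ℝ) :
    Integrable (fun x => (c + ‖x‖) * ‖u x‖ ^ 2) ∧
      (∫ x, (c + ‖x‖) * ‖u x‖ ^ 2) / ‖u‖ ^ 2 = c + meanAbs u := by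
  have h1 := (integrable_mul_norm_sq hm continuous_norm norm_le_one_mul_one_add_sq).1
  have h2 := (integrable_norm_sq_lp u).const_mul c
  simp_rw [add_mul]
  refine ⟨h2.add h1, ?_⟩
  rw [integral_add h2 h1, integral_const_mul, integral_norm_sq_lp, add_div, meanAbs,
    mul_div_cancel_right₀ _ (pow_ne_zero 2 hu)]

/-- Cauchy–Schwarz applied to |x| |u|² = (|x| |u|) |u|. -/
theorem ofReal_meanAbs_mul_le {u m : LTwo (Euc N)}
    (hm : m =ᵐ[volume] fun z => ((1 + ‖z‖ : ℝ) : ℂ) * u z) (hu : ‖u‖ ≠ 0) :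
    ENNReal.ofReal (meanAbs u) * ‖u‖ₑ ≤ momentNorm u := by
  have hc : Continuous fun z : Euc N => (‖z‖ : ℂ) := by fun_prop
  have hmem : MemLp (fun z => (‖z‖ : ℂ) * u z) 2 volume := by
    refine (Lp.memLp m).of_le (hc.aestronglyMeasurable.mul (Lp.aestronglyMeasurable u)) ?_
    filter_upwards [hm] with z hz
    rw [hz, norm_mul, norm_mul, Complex.norm_real, Complex.norm_real, norm_norm,
      Real.norm_of_nonneg (by positivity)]
    gcongr
    linarith
  have h := integral_norm_mul_norm_le_sqrt hmem (Lp.memLp u)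
  rw [integral_norm_sq_lp, integral_norm_sq_eq hmem, Real.sqrt_sq (norm_nonneg _),
    Real.sqrt_sq ENNReal.toReal_nonneg] at h
  have e : ∫ z, ‖(‖z‖ : ℂ) * u z‖ * ‖u z‖ = ∫ x, ‖x‖ * ‖u x‖ ^ 2 := by
    congr 1
    ext z
    rw [norm_mul, Complex.norm_real, norm_norm]
    ring
  rw [e] at h
  rw [← ofReal_norm, ← ENNReal.ofReal_mul (meanAbs_nonneg u), momentNorm,
    ← ENNReal.ofReal_toReal hmem.2.ne]
  refine ENNReal.ofReal_le_ofReal ?_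
  have hpos : 0 < ‖u‖ := lt_of_le_of_ne (norm_nonneg _) (Ne.symm hu)
  rw [meanAbs, div_mul_eq_mul_div, div_le_iff₀ (by positivity)]
  calc _ ≤ ((eLpNorm (fun z => (‖z‖ : ℂ) * u z) 2 volume).toReal * ‖u‖) * ‖u‖ := by gcongr
    _ = _ := by ring

/-- The triangle inequality: |x| and its mean each cost one moment norm. This is the loss against
the brute-force bounds. -/
theorem eLpNorm_norm_add_meanAbs_mul_le {u m : LTwo (Euc N)}
    (hm : m =ᵐ[volume] fun z => ((1 + ‖z‖ : ℝ) : ℂ) * u z) (hu : ‖u‖ ≠ 0) :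
    eLpNorm (fun x => ((‖x‖ + meanAbs u : ℝ) : ℂ) * u x) 2 volume ≤ 2 * momentNorm u := by
  have hc : Continuous fun z : Euc N => (‖z‖ : ℂ) := by fun_prop
  have e : (fun x => ((‖x‖ + meanAbs u : ℝ) : ℂ) * u x) =
      (fun x => (‖x‖ : ℂ) * u x) + (meanAbs u : ℂ) • (u : Euc N → ℂ) := by
    ext x
    simp only [Pi.add_apply, Pi.smul_apply, smul_eq_mul]
    push_cast
    ring
  rw [e, two_mul]
  refine (eLpNorm_add_le (hc.aestronglyMeasurable.mul (Lp.aestronglyMeasurable u))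
    ((Lp.aestronglyMeasurable u).const_smul _) one_le_two).trans ?_
  refine add_le_add le_rfl ?_
  rw [eLpNorm_const_smul, eLpNorm_coe_eq_enorm, ← ofReal_norm (meanAbs u : ℂ), Complex.norm_real,
    Real.norm_of_nonneg (meanAbs_nonneg u)]
  exact ofReal_meanAbs_mul_le hm hu

end MeanMoment

/-! ### The mean-field bounds. -/

section Hartree

variable {n d : ℕ} {V₁ : Euc n → ℝ} {V₂ : Euc d → ℝ} {W : Euc n × Euc d → ℝ}
  {u₀ : Euc n → ℂ} {v₀ : Euc d → ℂ} {ψ : ℝ → LTwo (Euc n × Euc d)}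
  {u : ℝ → LTwo (Euc n)} {v : ℝ → LTwo (Euc d)}

/-- The averaged potentials are controlled only while both norms are nonzero, so conservation is
proved by connectedness. The set of times with the norms of time t₀ is closed; near such a time the
norms stay nonzero and the averages are uniformly quadratic, so norms are locally constant there. -/
theorem IsHartreeSolution.norm_eq (hV₁ : AtMostQuadratic V₁) (hV₂ : AtMostQuadratic V₂)
    (hW : AtMostQuadratic W) (h : IsHartreeSolution V₁ V₂ W u₀ v₀ u v) {t₀ : ℝ}
    (hu0 : ‖u t₀‖ ≠ 0) (hv0 : ‖v t₀‖ ≠ 0) (t : ℝ) : ‖u t‖ = ‖u t₀‖ ∧ ‖v t‖ = ‖v t₀‖ := by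
  obtain ⟨K₁, hK₁⟩ := hV₁.exists_quadPotential
  obtain ⟨K₂, hK₂⟩ := hV₂.exists_quadPotential
  obtain ⟨K, hK⟩ := hW.exists_quadPotential
  have hK0 := hK.nonneg
  obtain ⟨m, hmc, hm⟩ := h.sigma_x.exists_weighted
  obtain ⟨l, hlc, hl⟩ := h.sigma_y.exists_weighted
  have huc := h.eq_x.continuous
  have hvc := h.eq_y.continuous
  have hclosed : IsClosed {t | ‖u t‖ = ‖u t₀‖ ∧ ‖v t‖ = ‖v t₀‖} :=
    (isClosed_eq huc.norm continuous_const).inter (isClosed_eq hvc.norm continuous_const)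
  have hopen : IsOpen {t | ‖u t‖ = ‖u t₀‖ ∧ ‖v t‖ = ‖v t₀‖} := by
    rw [isOpen_iff_mem_nhds]
    rintro t ⟨htu, htv⟩
    have hut : ‖u t‖ ≠ 0 := htu ▸ hu0
    have hvt : ‖v t‖ ≠ 0 := htv ▸ hv0
    have c1 : ContinuousAt (fun s => ‖m s‖ ^ 2 / ‖u s‖ ^ 2) t :=
      (hmc.norm.pow 2).continuousAt.div (huc.norm.pow 2).continuousAt (pow_ne_zero 2 hut)
    have c2 : ContinuousAt (fun s => ‖l s‖ ^ 2 / ‖v s‖ ^ 2) t :=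
      (hlc.norm.pow 2).continuousAt.div (hvc.norm.pow 2).continuousAt (pow_ne_zero 2 hvt)
    obtain ⟨ε, hε, hball⟩ := Metric.eventually_nhds_iff_ball.1
      (((c1.eventually_lt_const (lt_add_one _)).and (c2.eventually_lt_const (lt_add_one _))).and
        ((huc.norm.continuousAt.eventually_ne hut).and (hvc.norm.continuousAt.eventually_ne hvt)))
    rw [Real.ball_eq_Ioo] at hball
    have ht : t ∈ Ioo (t - ε) (t + ε) := ⟨by linarith, by linarith⟩
    filter_upwards [Ioo_mem_nhds ht.1 ht.2] with s hs
    refine ⟨htu ▸ h.eq_x.norm_eq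
      (C := K₁ + 3 * K * (‖l t‖ ^ 2 / ‖v t‖ ^ 2 + 1)) (fun τ hτ => ?_) ht hs,
      htv ▸ h.eq_y.norm_eq
      (C := K₂ + 3 * K * (‖m t‖ ^ 2 / ‖u t‖ ^ 2 + 1)) (fun τ hτ => ?_) ht hs⟩
    · have hb := hball τ hτ
      refine hK₁.add ((hK.avgY (hl τ) hb.2.2).mono ?_)
      gcongr
      exact hb.1.2.le
    · have hb := hball τ hτ
      refine hK₂.add ((hK.avgX (hm τ) hb.2.1).mono ?_)
      gcongr
      exact hb.1.1.le
  have := IsClopen.eq_univ ⟨hclosed, hopen⟩ ⟨t₀, rfl, rfl⟩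
  exact eq_univ_iff_forall.1 this t

theorem tensorLp_eq_zero_iff (u : LTwo (Euc n)) (v : LTwo (Euc d)) :
    tensorLp u v = 0 ↔ ‖u‖ = 0 ∨ ‖v‖ = 0 := by
  rw [← norm_eq_zero, norm_tensorLp, mul_eq_zero]

theorem norm_eq_norm_zero_of_fullHamiltonian (hV₁ : AtMostQuadratic V₁)
    (hV₂ : AtMostQuadratic V₂) (hW : AtMostQuadratic W) {ψ₀ : Euc n × Euc d → ℂ}
    (hψ : IsSchrodingerSolution (fun _ => fullHamiltonian V₁ V₂ W) ψ₀ ψ) {t : ℝ} (ht : 0 ≤ t) :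
    ‖ψ t‖ = ‖ψ 0‖ := by
  obtain ⟨K₁, hK₁⟩ := hV₁.exists_quadPotential
  obtain ⟨K₂, hK₂⟩ := hV₂.exists_quadPotential
  obtain ⟨K, hK⟩ := hW.exists_quadPotential
  have hVq : QuadPotential (K₁ + K₂ + K) fun z : EucProd n d =>
      V₁ z.ofLp.1 + V₂ z.ofLp.2 + W z.ofLp :=
    (hK₁.comp_fst.add hK₂.comp_snd).add hK.comp_ofLp
  have h1 := abs_norm_sub_norm_le_lintegral (t₀ := -1) (t₁ := t + 1)
    (continuous_toEucProd.comp hψ.continuous) (fun _ _ => hVq) (S := fun _ => 0)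
    (fun _ _ => sourceBound_zero hVq.nonneg) (fun t _ => hψ.weakEqAt_prod t)
    (β := 0) measurable_const (fun t _ => by simp) ht ⟨by linarith, by linarith⟩
    ⟨by linarith, by linarith⟩
  simp only [Pi.zero_apply, lintegral_zero, nonpos_iff_eq_zero, ENNReal.ofReal_eq_zero,
    Function.comp_apply, norm_toEucProd] at h1
  exact sub_eq_zero.1 (abs_nonpos_iff.1 h1)

/-- If the product were nonzero at some time, conservation from that time would make it nonzero at
time 0. So it vanishes throughout, and ψ vanishes by conservation of its own norm. -/
theorem IsHartreeSolution.eLpNorm_sub_eq_zero (hV₁ : AtMostQuadratic V₁)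
    (hV₂ : AtMostQuadratic V₂) (hW : AtMostQuadratic W)
    (hψ : IsSchrodingerSolution (fun _ => fullHamiltonian V₁ V₂ W)
      (fun z => u₀ z.1 * v₀ z.2) ψ)
    (h : IsHartreeSolution V₁ V₂ W u₀ v₀ u v) (h0 : ‖u 0‖ = 0 ∨ ‖v 0‖ = 0) {t : ℝ} (ht : 0 ≤ t) :
    eLpNorm (fun z => ψ t z - meanFieldApprox W u v t z) 2 volume = 0 := by
  have hT : ∀ s, tensorLp (u s) (v s) = 0 := fun s => by
    by_contra hs
    rw [tensorLp_eq_zero_iff, not_or] at hs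
    obtain ⟨h1, h2⟩ := h.norm_eq hV₁ hV₂ hW hs.1 hs.2 0
    rw [h1, h2] at h0
    exact not_or.2 hs h0
  have hψ0 : ψ 0 = tensorLp (u 0) (v 0) := by
    refine Lp.ext ?_
    filter_upwards [hψ.initial, coeFn_tensorLp (u 0) (v 0), ae_fst h.eq_x.initial,
      ae_snd h.eq_y.initial] with z h1 h2 h3 h4
    rw [h1, h2, h3, h4]
  have hψt : ψ t = 0 := by
    rw [← norm_eq_zero, norm_eq_norm_zero_of_fullHamiltonian hV₁ hV₂ hW hψ ht, hψ0, hT, norm_zero]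
  rw [← eLpNorm_zero (p := 2) (μ := (volume : Measure (Euc n × Euc d))) (ε := ℂ)]
  refine eLpNorm_congr_ae ?_
  filter_upwards [Lp.coeFn_zero ℂ 2 (volume : Measure (Euc n × Euc d)),
    coeFn_tensorLp (u t) (v t)] with z h1 h2
  rw [hT, h1, Pi.zero_apply] at h2
  rw [hψt, h1, meanFieldApprox, ← h2]
  simp

theorem IsHartreeSolution.eLpNorm_sub_le (hV₁ : AtMostQuadratic V₁) (hV₂ : AtMostQuadratic V₂)
    (hW : AtMostQuadratic W)
    (hψ : IsSchrodingerSolution (fun _ => fullHamiltonian V₁ V₂ W)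
      (fun z => u₀ z.1 * v₀ z.2) ψ)
    (h : IsHartreeSolution V₁ V₂ W u₀ v₀ u v) {β : ℝ → ℝ≥0∞} (hβ : Measurable β)
    (hBβ : ∀ t, ‖u t‖ = ‖u 0‖ → ‖u t‖ ≠ 0 → ‖v t‖ ≠ 0 → eLpNorm (fun z : Euc n × Euc d =>
      ((W z - avgY W (v t) z.1 - avgX W (u t) z.2 + avgFull W (u t) (v t) : ℝ) : ℂ) *
        (u t z.1 * v t z.2)) 2 volume ≤ β t)
    {t : ℝ} (ht : 0 ≤ t) :
    eLpNorm (fun z => ψ t z - meanFieldApprox W u v t z) 2 volume ≤ ∫⁻ s in Icc 0 t, β s := by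
  by_cases h0 : ‖u 0‖ = 0 ∨ ‖v 0‖ = 0
  · rw [h.eLpNorm_sub_eq_zero hV₁ hV₂ hW hψ h0 ht]
    exact zero_le
  rw [not_or] at h0
  have hcons := h.norm_eq hV₁ hV₂ hW h0.1 h0.2
  have hu0 : ∀ s, ‖u s‖ ≠ 0 := fun s => (hcons s).1 ▸ h0.1
  have hv0 : ∀ s, ‖v s‖ ≠ 0 := fun s => (hcons s).2 ▸ h0.2
  obtain ⟨K, hK⟩ := hW.exists_quadPotential
  have hK0 := hK.nonneg
  obtain ⟨m, hmc, hm⟩ := h.sigma_x.exists_weighted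
  obtain ⟨l, hlc, hl⟩ := h.sigma_y.exists_weighted
  have huc := h.eq_x.continuous
  have hvc := h.eq_y.continuous
  have hc : Continuous fun s => avgFull W (u s) (v s) :=
    continuous_avgFull hK huc hvc hmc hlc hm hl hu0 hv0
  have c1 : Continuous fun s => ‖m s‖ ^ 2 / ‖u s‖ ^ 2 :=
    (hmc.norm.pow 2).div (huc.norm.pow 2) fun s => pow_ne_zero 2 (hu0 s)
  have c2 : Continuous fun s => ‖l s‖ ^ 2 / ‖v s‖ ^ 2 :=
    (hlc.norm.pow 2).div (hvc.norm.pow 2) fun s => pow_ne_zero 2 (hv0 s)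
  have hA₁ : ∀ T : ℝ, ∃ C, ∀ s ∈ Ioo (-T) T, QuadPotential C (avgY W (v s)) := fun T => by
    obtain ⟨D, hD⟩ := (isCompact_Icc (a := -T) (b := T)).exists_bound_of_continuousOn
      c2.continuousOn
    refine ⟨3 * K * D, fun s hs => (hK.avgY (hl s) (hv0 s)).mono ?_⟩
    gcongr
    exact (le_abs_self _).trans (hD s (Ioo_subset_Icc_self hs))
  have hA₂ : ∀ T : ℝ, ∃ C, ∀ s ∈ Ioo (-T) T, QuadPotential C (avgX W (u s)) := fun T => by
    obtain ⟨D, hD⟩ := (isCompact_Icc (a := -T) (b := T)).exists_bound_of_continuousOn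
      c1.continuousOn
    refine ⟨3 * K * D, fun s hs => (hK.avgX (hm s) (hu0 s)).mono ?_⟩
    gcongr
    exact (le_abs_self _).trans (hD s (Ioo_subset_Icc_self hs))
  have h1 := eLpNorm_sub_tensor_le hV₁ hV₂ hW hψ (A₁ := fun s => avgY W (v s))
    (A₂ := fun s => avgX W (u s)) h.eq_x h.eq_y hA₁ hA₂
    (θ := fun t => ∫ s in (0 : ℝ)..t, avgFull W (u s) (v s))
    (fun t => (hc.integral_hasStrictDerivAt 0 t).hasDerivAt) (by simp) hc hβ
    (fun s => hBβ s (hcons s).1 (hu0 s) (hv0 s)) ht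
  refine le_trans (le_of_eq ?_) h1
  congr 1
  ext z
  rw [meanFieldApprox, mul_comm (Complex.exp _)]

/-- Here 4 = 2 · 2: two y-increments in each second difference, and |y − y'| ≤ |y| + |y'| with the
mean of |y'| costing a second moment norm. -/
theorem IsHartreeSolution.eLpNorm_sub_le_gradY (hV₁ : AtMostQuadratic V₁)
    (hV₂ : AtMostQuadratic V₂) (hW : AtMostQuadratic W)
    (hgradY : ∃ C : ℝ, ∀ z, ‖gradY W z‖ ≤ C)
    (hψ : IsSchrodingerSolution (fun _ => fullHamiltonian V₁ V₂ W)
      (fun z => u₀ z.1 * v₀ z.2) ψ)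
    (h : IsHartreeSolution V₁ V₂ W u₀ v₀ u v) {t : ℝ} (ht : 0 ≤ t) :
    eLpNorm (fun z => ψ t z - meanFieldApprox W u v t z) 2 volume ≤
      4 * eLpNorm (gradY W) ⊤ volume * eLpNorm u₀ 2 volume *
        ∫⁻ s in Icc 0 t, momentNorm (v s) := by
  set G := eLpNorm (gradY W) ⊤ volume with hG
  have hG' : G ≠ ⊤ := eLpNorm_gradY_ne_top hW hgradY
  have hG0 : 0 ≤ G.toReal := ENNReal.toReal_nonneg
  have hmeas := measurable_momentNorm h.eq_y.continuous
  obtain ⟨K, hK⟩ := hW.exists_quadPotential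
  obtain ⟨m, hmc, hm⟩ := h.sigma_x.exists_weighted
  obtain ⟨l, hlc, hl⟩ := h.sigma_y.exists_weighted
  rw [← lintegral_const_mul _ hmeas]
  refine h.eLpNorm_sub_le hV₁ hV₂ hW hψ (hmeas.const_mul _) (fun s hcons hu0 hv0 => ?_) ht
  rw [← eLpNorm_eq_of_norm_eq h.eq_x hcons]
  refine (eLpNorm_mul_tensor_le (k := 2 * G.toReal) (p := fun _ => 1)
    (q := fun y => ‖y‖ + meanAbs (v s)) continuous_const (by fun_prop) (fun z => ?_)
    (u s) (v s)).trans ?_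
  · obtain ⟨i2, e2⟩ := integrable_add_norm_mul (hl s) hv0 ‖z.2‖
    have h1 := abs_residual_le hK (hm s) (hl s) hu0 hv0 (k := 2 * G.toReal) (p := fun _ => 1)
      (q := fun y' => ‖z.2‖ + ‖y'‖) (by simpa using integrable_norm_sq_lp (u s)) i2 z.1 z.2
      fun x' y' => ?_
    · simp only [one_mul, integral_norm_sq_lp, div_self (pow_ne_zero 2 hu0), e2] at h1
      rw [one_mul, abs_of_nonneg (add_nonneg (norm_nonneg _) (meanAbs_nonneg _))]
      exact h1
    · have h2 := abs_sub_le_gradY hW hgradY z.1 z.2 y'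
      have h3 := abs_sub_le_gradY hW hgradY x' z.2 y'
      rw [one_mul]
      calc _ = |(W (z.1, z.2) - W (z.1, y')) - (W (x', z.2) - W (x', y'))| := by
            congr 1; ring
        _ ≤ G.toReal * ‖z.2 - y'‖ + G.toReal * ‖z.2 - y'‖ :=
            (abs_sub _ _).trans (add_le_add h2 h3)
        _ = 2 * G.toReal * ‖z.2 - y'‖ := by ring
        _ ≤ _ := by gcongr; exact norm_sub_le _ _
  · rw [ENNReal.ofReal_mul zero_le_two, ENNReal.ofReal_toReal hG']
    simp only [Complex.ofReal_one, one_mul, ENNReal.ofReal_ofNat]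
    calc _ ≤ 2 * G * (eLpNorm (u s) 2 volume * (2 * momentNorm (v s))) := by
          gcongr
          exact eLpNorm_norm_add_meanAbs_mul_le (hl s) hv0
      _ = _ := by ring

/-- The mixed bound has constant one; the 4 is a factor two in each variable, from |x| plus its mean
and |y| plus its mean. -/
theorem IsHartreeSolution.eLpNorm_sub_le_gradXGradY (hV₁ : AtMostQuadratic V₁)
    (hV₂ : AtMostQuadratic V₂) (hW : AtMostQuadratic W)
    (hψ : IsSchrodingerSolution (fun _ => fullHamiltonian V₁ V₂ W)
      (fun z => u₀ z.1 * v₀ z.2) ψ)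
    (h : IsHartreeSolution V₁ V₂ W u₀ v₀ u v) {t : ℝ} (ht : 0 ≤ t) :
    eLpNorm (fun z => ψ t z - meanFieldApprox W u v t z) 2 volume ≤
      4 * eLpNorm (gradXGradY W) ⊤ volume *
        ∫⁻ s in Icc 0 t, momentNorm (u s) * momentNorm (v s) := by
  set M := eLpNorm (gradXGradY W) ⊤ volume with hM
  have hM' : M ≠ ⊤ := eLpNorm_gradXGradY_ne_top hW
  have hM0 : 0 ≤ M.toReal := ENNReal.toReal_nonneg
  have hmeas : Measurable fun s => momentNorm (u s) * momentNorm (v s) :=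
    (measurable_momentNorm h.eq_x.continuous).mul (measurable_momentNorm h.eq_y.continuous)
  obtain ⟨K, hK⟩ := hW.exists_quadPotential
  obtain ⟨m, hmc, hm⟩ := h.sigma_x.exists_weighted
  obtain ⟨l, hlc, hl⟩ := h.sigma_y.exists_weighted
  rw [← lintegral_const_mul _ hmeas]
  refine h.eLpNorm_sub_le hV₁ hV₂ hW hψ (hmeas.const_mul _) (fun s _ hu0 hv0 => ?_) ht
  refine (eLpNorm_mul_tensor_le (k := M.toReal) (p := fun x => ‖x‖ + meanAbs (u s))
    (q := fun y => ‖y‖ + meanAbs (v s)) (by fun_prop) (by fun_prop) (fun z => ?_)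
    (u s) (v s)).trans ?_
  · obtain ⟨i1, e1⟩ := integrable_add_norm_mul (hm s) hu0 ‖z.1‖
    obtain ⟨i2, e2⟩ := integrable_add_norm_mul (hl s) hv0 ‖z.2‖
    have h1 := abs_residual_le hK (hm s) (hl s) hu0 hv0 (k := M.toReal)
      (p := fun x' => ‖z.1‖ + ‖x'‖) (q := fun y' => ‖z.2‖ + ‖y'‖) i1 i2 z.1 z.2
      fun x' y' => ?_
    · rw [e1, e2] at h1
      rw [abs_of_nonneg (mul_nonneg (add_nonneg (norm_nonneg _) (meanAbs_nonneg _))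
        (add_nonneg (norm_nonneg _) (meanAbs_nonneg _)))]
      exact h1
    · have h2 := abs_mixed_sub_le hW z.1 x' z.2 y'
      calc _ = |W (z.1, z.2) - W (x', z.2) - (W (z.1, y') - W (x', y'))| := by
            congr 1; ring
        _ ≤ M.toReal * (‖z.1 - x'‖ * ‖z.2 - y'‖) := h2
        _ ≤ _ := by
            gcongr
            · exact norm_sub_le _ _
            · exact norm_sub_le _ _
  · rw [ENNReal.ofReal_toReal hM']
    calc _ ≤ M * ((2 * momentNorm (u s)) * (2 * momentNorm (v s))) := by
          gcongr
          · exact eLpNorm_norm_add_meanAbs_mul_le (hm s) hu0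
          · exact eLpNorm_norm_add_meanAbs_mul_le (hl s) hv0
      _ = _ := by ring

end Hartree

theorem proposition3p1 (n d : ℕ)
    (V₁ : Euc n → ℝ) (V₂ : Euc d → ℝ) (W : Euc n × Euc d → ℝ)
    (hV₁ : AtMostQuadratic V₁) (hV₂ : AtMostQuadratic V₂) (hW : AtMostQuadratic W)
    (hgradY : ∃ C : ℝ, ∀ z, ‖gradY W z‖ ≤ C)
    (φ₀x : 𝓢(Euc n, ℂ)) (φ₀y : 𝓢(Euc d, ℂ))
    (ψ : ℝ → LTwo (Euc n × Euc d))
    (hψ : IsSchrodingerSolution (fun _ => fullHamiltonian V₁ V₂ W)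
      (fun z => φ₀x z.1 * φ₀y z.2) ψ) :
    (∀ (φx : ℝ → LTwo (Euc n)) (φy : ℝ → LTwo (Euc d)),
      IsBruteForceSolution V₁ V₂ W φ₀x φ₀y φx φy →
      ∀ t : ℝ, 0 ≤ t →
        eLpNorm (fun z => ψ t z - bruteForceApprox W φx φy t z) 2 volume
            ≤ 2 * eLpNorm (gradY W) ∞ volume * eLpNorm φ₀x 2 volume
              * ∫⁻ s in Icc 0 t, momentNorm (φy s) ∧
        eLpNorm (fun z => ψ t z - bruteForceApprox W φx φy t z) 2 volume
            ≤ eLpNorm (gradXGradY W) ∞ volume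
              * ∫⁻ s in Icc 0 t, momentNorm (φx s) * momentNorm (φy s)) ∧
    (∀ (ϕx : ℝ → LTwo (Euc n)) (ϕy : ℝ → LTwo (Euc d)),
      IsHartreeSolution V₁ V₂ W φ₀x φ₀y ϕx ϕy →
      ∀ t : ℝ, 0 ≤ t →
        eLpNorm (fun z => ψ t z - meanFieldApprox W ϕx ϕy t z) 2 volume
            ≤ 4 * eLpNorm (gradY W) ∞ volume * eLpNorm φ₀x 2 volume
              * ∫⁻ s in Icc 0 t, momentNorm (ϕy s) ∧
        eLpNorm (fun z => ψ t z - meanFieldApprox W ϕx ϕy t z) 2 volume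
            ≤ 4 * eLpNorm (gradXGradY W) ∞ volume
              * ∫⁻ s in Icc 0 t, momentNorm (ϕx s) * momentNorm (ϕy s)) := by
  refine ⟨fun φx φy h t ht => ⟨?_, ?_⟩, fun ϕx ϕy h t ht => ⟨?_, ?_⟩⟩
  · exact h.eLpNorm_sub_le_gradY hV₁ hV₂ hW hgradY hψ ht
  · exact h.eLpNorm_sub_le_gradXGradY hV₁ hV₂ hW hψ ht
  · exact h.eLpNorm_sub_le_gradY hV₁ hV₂ hW hgradY hψ ht
  · exact h.eLpNorm_sub_le_gradXGradY hV₁ hV₂ hW hψ ht
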